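/- Let $N\ge 2$, $k\ge 2$, and let $\Omega\subset\mathbb R^N$ be a bounded, connected open set with Lipschitz boundary. For $i=1,\dots,k$ let $d_i$ be continuous and positive on $\overline\Omega$ (for instance $d_i\equiv 1$, or $d_i\in W^{2,\infty}(\Omega)$ with $d_i>0$ on $\overline\Omega$). Let $H^{1/2}(\partial\Omega)$ be the space of traces of functions in $H^1(\Omega)$, with the norm $\|\phi\|=\inf\{\|u\|_{H^1(\Omega)}: u|_{\partial\Omega}=\phi\}$. A boundary datum $(\phi_1,\dots,\phi_k)$ is called admissible if $\phi_i\in H^{1/2}(\partial\Omega)$, $\phi_i\ge 0$, and $\phi_i\phi_j=0$ for $i\ne j$, almost everywhere on $\partial\Omega$ with respect to the surface measure. A reaction term for the index $i$ is a function $f:\Omega\times[0,\infty)\to\mathbb R$ such that (A1) $f(x,s)$ is Lipschitz continuous in $s$, uniformly in $x$, and $f(x,0)\equiv 0$; (A2) there are $b\in L^\infty(\Omega)$ and $\bar s>1$ such that $|f(x,s)|\le b(x)s$ for almost every $x\in\Omega$ and all $s\ge\bar s$, and $\int_\Omega\left(d_i^2|\nabla w|^2-b\,w^2\right)dx>0$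 for every $w\in H^1_0(\Omega)\setminus\{0\}$. Its potential is $F(x,s)=\int_0^s f(x,t)\,dt$ for $x\in\Omega$, $s\in\mathbb R$, where $f$ is extended to $s<0$ by $f(x,s)=-f(x,-s)$. Given an admissible datum $(\phi_i)$ and potentials $(F_i)$ of reaction terms $(f_i)$, a solution of the minimization problem with these data is a minimizer of $$J(U)=\sum_{i=1}^k\int_\Omega\left(\tfrac12 d_i^2(x)|\nabla u_i(x)|^2-F_i(x,u_i(x))\right)dx$$ over the set of all $U=(u_1,\dots,u_k)\in (H^1(\Omega))^k$ such that $u_i|_{\partial\Omega}=\phi_i$ and $u_i\ge 0$ for all $i$, and $u_iu_j=0$ a.e. in $\Omega$ for $i\neq j$. **Theorem (continuous dependence).** Let $f_{i,n}$ and $f_i$ ($n\in\mathbb N$, $1\le i\le k$) be reaction terms with potentials $F_{i,n}$ and $F_i$, where $b$, $\bar s$ and the Lipschitz constant may depend on $i$ and $n$, such that for every $i$ $$F_{i,n}\to F_i\quad\text{in } C^1(\Omega\times\mathbb R),$$ i.e. these functions are $C^1$ on $\Omega\times\mathbb R$ and $F_{i,n}\to F_i$, $\nabla_{(x,s)}F_{i,n}\to\nabla_{(x,s)}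 F_i$ uniformly on $\Omega\times\mathbb R$. Let $(\phi_{1,n},\dots,\phi_{k,n})$ be admissible data and $\phi_i\in H^{1/2}(\partial\Omega)$ with $\phi_{i,n}\to\phi_i$ in $H^{1/2}(\partial\Omega)$ for every $i$. For each $n$ let $U_n=(u_{1,n},\dots,u_{k,n})$ be a solution of the minimization problem with data $(\phi_{i,n})_i$ and potentials $(F_{i,n})_i$. Then $(\phi_1,\dots,\phi_k)$ is admissible, and there are a subsequence $(U_{n_m})_m$ and $U=(u_1,\dots,u_k)\in (H^1(\Omega))^k$ such that $u_{i,n_m}\to u_i$ strongly in $H^1(\Omega)$ for every $i$, and $U$ is a solution of the minimization problem with data $(\phi_i)_i$ and potentials $(F_i)_i$. -/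

import Mathlib

open MeasureTheory Filter Topology
open scoped ENNReal ContDiff

noncomputable section

namespace Segregation

/-- Euclidean space `ℝ^N`. -/
abbrev E (N : ℕ) : Type := EuclideanSpace ℝ (Fin N)

/-- `Ω` is locally, near each boundary point and in a suitable orthonormal frame, the strict
epigraph of a Lipschitz function of the `N - 1` variables orthogonal to a unit vector `e`. -/
def HasLipschitzBoundary {N : ℕ} (Ω : Set (E N)) : Prop :=
  ∀ x ∈ frontier Ω, ∃ e : E N, ‖e‖ = 1 ∧ ∃ r : ℝ, 0 < r ∧
    ∃ (γ : (Submodule.span ℝ {e})ᗮ → ℝ) (K : NNReal), LipschitzWith K γ ∧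
      ∀ y ∈ Metric.ball x r,
        (y ∈ Ω ↔ γ ((Submodule.span ℝ {e})ᗮ.orthogonalProjectionOnto y) < inner ℝ e y)

/-- A bounded connected open set with Lipschitz boundary. -/
structure IsRegularDomain {N : ℕ} (Ω : Set (E N)) : Prop where
  isOpen : IsOpen Ω
  isConnected : IsConnected Ω
  isBounded : Bornology.IsBounded Ω
  lipschitzBoundary : HasLipschitzBoundary Ω

/-- `η ∈ C_c^∞(Ω)`. -/
structure IsTestFunction {N : ℕ} (Ω : Set (E N)) (η : E N → ℝ) : Prop where
  contDiff : ContDiff ℝ ∞ η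
  hasCompactSupport : HasCompactSupport η
  tsupport_subset : tsupport η ⊆ Ω

/-- The Hilbert space `L²(Ω) × L²(Ω; ℝ^N)` with norm `(‖u‖² + ‖g‖²)^{1/2}`. -/
abbrev L2Pair {N : ℕ} (Ω : Set (E N)) : Type :=
  WithLp 2 (Lp ℝ 2 (volume.restrict Ω) × Lp (E N) 2 (volume.restrict Ω))

theorem IsTestFunction.continuous_gradient {N : ℕ} {Ω : Set (E N)} {η : E N → ℝ}
    (hη : IsTestFunction Ω η) : Continuous (gradient η) := by
  have h : Continuous (fderiv ℝ η) := hη.contDiff.continuous_fderiv (by simp)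
  exact (InnerProductSpace.toDual ℝ (E N)).symm.continuous.comp h

theorem IsTestFunction.hasCompactSupport_gradient {N : ℕ} {Ω : Set (E N)} {η : E N → ℝ}
    (hη : IsTestFunction Ω η) : HasCompactSupport (gradient η) := by
  have h : HasCompactSupport (fderiv ℝ η) := hη.hasCompactSupport.fderiv (𝕜 := ℝ)
  exact h.comp_left (g := (InnerProductSpace.toDual ℝ (E N)).symm) (map_zero _)

theorem IsTestFunction.integrable_smul_gradient {N : ℕ} {Ω : Set (E N)} {η : E N → ℝ}
    (hη : IsTestFunction Ω η) (u : Lp ℝ 2 (volume.restrict Ω)) :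
    Integrable (fun x => u x • gradient η x) (volume.restrict Ω) :=
  memLp_one_iff_integrable.1 (MemLp.smul (p := 2) (q := 2) (r := 1)
    (hη.continuous_gradient.memLp_of_hasCompactSupport hη.hasCompactSupport_gradient)
    (Lp.memLp u))

theorem IsTestFunction.integrable_smul {N : ℕ} {Ω : Set (E N)} {η : E N → ℝ}
    (hη : IsTestFunction Ω η) (g : Lp (E N) 2 (volume.restrict Ω)) :
    Integrable (fun x => η x • g x) (volume.restrict Ω) :=
  memLp_one_iff_integrable.1 (MemLp.smul (p := 2) (q := 2) (r := 1) (Lp.memLp g)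
    (hη.contDiff.continuous.memLp_of_hasCompactSupport hη.hasCompactSupport))

/-- The Sobolev space `H¹(Ω)`: the pairs `(u, g)` with `u ∈ L²(Ω)`, `g ∈ L²(Ω; ℝ^N)` such that `g`
is the weak gradient of `u`, with the norm `(‖u‖² + ‖∇u‖²)^{1/2}`. -/
def H1 {N : ℕ} (Ω : Set (E N)) : Submodule ℝ (L2Pair Ω) where
  carrier := {p | ∀ η : E N → ℝ, IsTestFunction Ω η →
    ∫ x in Ω, p.fst x • gradient η x = -∫ x in Ω, η x • p.snd x}
  zero_mem' := by
    intro η hη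
    have h1 : ∀ᵐ x ∂(volume.restrict Ω),
        ((0 : L2Pair Ω).fst x • gradient η x : E N) = 0 := by
      filter_upwards [Lp.coeFn_zero ℝ 2 (volume.restrict Ω)] with x hx
      have : (0 : L2Pair Ω).fst x = 0 := hx
      rw [this, zero_smul]
    have h2 : ∀ᵐ x ∂(volume.restrict Ω), (η x • (0 : L2Pair Ω).snd x : E N) = 0 := by
      filter_upwards [Lp.coeFn_zero (E N) 2 (volume.restrict Ω)] with x hx
      have : (0 : L2Pair Ω).snd x = 0 := hx
      rw [this, smul_zero]
    rw [integral_eq_zero_of_ae h1, integral_eq_zero_of_ae h2, neg_zero]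
  add_mem' := by
    intro p q hp hq η hη
    have h1 : ∫ x in Ω, (p + q).fst x • gradient η x
        = ∫ x in Ω, (p.fst x • gradient η x + q.fst x • gradient η x) := by
      refine integral_congr_ae ?_
      filter_upwards [Lp.coeFn_add p.fst q.fst] with x hx
      have : (p + q).fst x = p.fst x + q.fst x := hx
      rw [this, add_smul]
    have h2 : ∫ x in Ω, η x • (p + q).snd x
        = ∫ x in Ω, (η x • p.snd x + η x • q.snd x) := by
      refine integral_congr_ae ?_
      filter_upwards [Lp.coeFn_add p.snd q.snd] with x hx
      have : (p + q).snd x = p.snd x + q.snd x := hx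
      rw [this, smul_add]
    rw [h1, h2, integral_add (hη.integrable_smul_gradient _) (hη.integrable_smul_gradient _),
      integral_add (hη.integrable_smul _) (hη.integrable_smul _), hp η hη, hq η hη, neg_add]
  smul_mem' := by
    intro c p hp η hη
    have h1 : ∫ x in Ω, (c • p).fst x • gradient η x
        = ∫ x in Ω, c • (p.fst x • gradient η x) := by
      refine integral_congr_ae ?_
      filter_upwards [Lp.coeFn_smul c p.fst] with x hx
      have : (c • p).fst x = c • p.fst x := hx
      rw [this, smul_assoc]
    have h2 : ∫ x in Ω, η x • (c • p).snd x = ∫ x in Ω, c • (η x • p.snd x) := by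
      refine integral_congr_ae ?_
      filter_upwards [Lp.coeFn_smul c p.snd] with x hx
      have : (c • p).snd x = c • p.snd x := hx
      rw [this, smul_comm]
    rw [h1, h2, integral_smul, integral_smul, hp η hη, smul_neg]

/-- The function underlying an element of `H¹(Ω)`. -/
def H1fun {N : ℕ} {Ω : Set (E N)} (u : H1 Ω) : Lp ℝ 2 (volume.restrict Ω) :=
  (u : L2Pair Ω).fst

/-- The weak gradient of an element of `H¹(Ω)`. -/
def H1grad {N : ℕ} {Ω : Set (E N)} (u : H1 Ω) : Lp (E N) 2 (volume.restrict Ω) :=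
  (u : L2Pair Ω).snd

/-- `H¹₀(Ω)`: the closure of `C_c^∞(Ω)` in `H¹(Ω)`. -/
def H10 {N : ℕ} (Ω : Set (E N)) : Set (H1 Ω) :=
  closure {u | ∃ η : E N → ℝ, IsTestFunction Ω η ∧
    H1fun u =ᵐ[volume.restrict Ω] η ∧ H1grad u =ᵐ[volume.restrict Ω] gradient η}

/-- The surface measure on `∂Ω`: the `(N-1)`-dimensional Hausdorff measure. -/
def surfaceMeasure {N : ℕ} (Ω : Set (E N)) : Measure (E N) :=
  (Measure.hausdorffMeasure ((N : ℝ) - 1)).restrict (frontier Ω)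

/-- `L²(∂Ω)`. -/
abbrev L2Boundary {N : ℕ} (Ω : Set (E N)) : Type := Lp ℝ 2 (surfaceMeasure Ω)

/-- `u|_{∂Ω} = φ` in the sense of traces: the graph of the trace operator is the closure in
`H¹(Ω) × L²(∂Ω)` of the graph of `w ↦ w|_{∂Ω}`, `w` smooth up to the boundary. -/
def HasTrace {N : ℕ} (Ω : Set (E N)) (u : H1 Ω) (φ : L2Boundary Ω) : Prop :=
  (u, φ) ∈ closure {p : H1 Ω × L2Boundary Ω | ∃ w : E N → ℝ, ContDiff ℝ ∞ w ∧
    H1fun p.1 =ᵐ[volume.restrict Ω] w ∧ H1grad p.1 =ᵐ[volume.restrict Ω] gradient w ∧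
    p.2 =ᵐ[surfaceMeasure Ω] w}

/-- The norm of `H^{1/2}(∂Ω)`, the space of traces of `H¹(Ω)`:
`‖φ‖ = inf {‖u‖_{H¹(Ω)} : u|_{∂Ω} = φ}`, equal to `∞` if `φ` is not a trace. -/
def traceNorm {N : ℕ} (Ω : Set (E N)) (φ : L2Boundary Ω) : ℝ≥0∞ :=
  ⨅ (u : H1 Ω) (_ : HasTrace Ω u φ), ‖u‖ₑ

/-- `H^{1/2}(∂Ω)`, the range of the trace operator. -/
def HHalf {N : ℕ} (Ω : Set (E N)) : Set (L2Boundary Ω) :=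
  {φ | ∃ u : H1 Ω, HasTrace Ω u φ}

/-- Convergence in `H^{1/2}(∂Ω)`. -/
def TendstoHHalf {N : ℕ} (Ω : Set (E N)) (φn : ℕ → L2Boundary Ω) (φ : L2Boundary Ω) : Prop :=
  Tendsto (fun n => traceNorm Ω (φn n - φ)) atTop (𝓝 0)

/-- Admissible boundary data. -/
structure IsAdmissible {N k : ℕ} (Ω : Set (E N)) (φ : Fin k → L2Boundary Ω) : Prop where
  mem_HHalf : ∀ i, φ i ∈ HHalf Ω
  nonneg : ∀ i, ∀ᵐ x ∂(surfaceMeasure Ω), 0 ≤ φ i x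
  disjoint : ∀ i j, i ≠ j → ∀ᵐ x ∂(surfaceMeasure Ω), φ i x * φ j x = 0

/-- The odd extension in `s` of a function `f(x, s)` given for `s ≥ 0`. -/
def oddExt {N : ℕ} (f : E N → ℝ → ℝ) (x : E N) (s : ℝ) : ℝ :=
  if 0 ≤ s then f x s else -f x (-s)

/-- The potential `F(x, s) = ∫₀ˢ f(x, t) dt`, `f` being extended oddly (so `F` is even in `s`). -/
def potential {N : ℕ} (f : E N → ℝ → ℝ) (x : E N) (s : ℝ) : ℝ :=
  ∫ t in (0 : ℝ)..s, oddExt f x t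

/-- The assumptions on a reaction term `f : Ω × [0, ∞) → ℝ` (values elsewhere are irrelevant),
relative to the diffusion coefficient `d`. -/
structure IsReaction {N : ℕ} (Ω : Set (E N)) (d : E N → ℝ) (f : E N → ℝ → ℝ) : Prop where
  lipschitz : ∃ L : ℝ, ∀ x ∈ Ω, ∀ s t : ℝ, 0 ≤ s → 0 ≤ t → |f x s - f x t| ≤ L * |s - t|
  zero : ∀ x ∈ Ω, f x 0 = 0
  growth : ∃ b : E N → ℝ, MemLp b ∞ (volume.restrict Ω) ∧
    (∃ s₀ : ℝ, 1 < s₀ ∧ ∀ᵐ x ∂(volume.restrict Ω), ∀ s : ℝ, s₀ ≤ s → |f x s| ≤ b x * s) ∧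
    ∀ w ∈ H10 Ω, w ≠ 0 →
      0 < ∫ x in Ω, (d x ^ 2 * ‖H1grad w x‖ ^ 2 - b x * H1fun w x ^ 2)

/-- Convergence in `C¹(D)`: the functions are `C¹` on `D`, and they and their first derivatives
converge uniformly on `D`. -/
structure TendstoC1 {V : Type*} [NormedAddCommGroup V] [NormedSpace ℝ V] (D : Set V)
    (Gn : ℕ → V → ℝ) (G : V → ℝ) : Prop where
  contDiffOn_seq : ∀ n, ContDiffOn ℝ 1 (Gn n) D
  contDiffOn : ContDiffOn ℝ 1 G D
  tendsto : TendstoUniformlyOn Gn G atTop D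
  tendsto_fderiv : TendstoUniformlyOn (fun n => fderiv ℝ (Gn n)) (fderiv ℝ G) atTop D

/-- The class of nonnegative segregated states with boundary values `φ`. -/
def segregatedStates {N k : ℕ} (Ω : Set (E N)) (φ : Fin k → L2Boundary Ω) :
    Set (Fin k → H1 Ω) :=
  {U | (∀ i, HasTrace Ω (U i) (φ i)) ∧
    (∀ i, ∀ᵐ x ∂(volume.restrict Ω), 0 ≤ H1fun (U i) x) ∧
    ∀ i j, i ≠ j → ∀ᵐ x ∂(volume.restrict Ω), H1fun (U i) x * H1fun (U j) x = 0}

/-- The internal energy `J(U)`. -/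
def energy {N k : ℕ} (Ω : Set (E N)) (d : Fin k → E N → ℝ) (f : Fin k → E N → ℝ → ℝ)
    (U : Fin k → H1 Ω) : ℝ :=
  ∑ i, ∫ x in Ω,
    (1 / 2 * d i x ^ 2 * ‖H1grad (U i) x‖ ^ 2 - potential (f i) x (H1fun (U i) x))

/-- `U` minimizes `J` among the nonnegative segregated states with boundary values `φ`. -/
def IsSolution {N k : ℕ} (Ω : Set (E N)) (d : Fin k → E N → ℝ) (f : Fin k → E N → ℝ → ℝ)
    (φ : Fin k → L2Boundary Ω) (U : Fin k → H1 Ω) : Prop :=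
  U ∈ segregatedStates Ω φ ∧ ∀ V ∈ segregatedStates Ω φ, energy Ω d f U ≤ energy Ω d f V

end Segregation

end

noncomputable section

namespace Segregation

section Basics

variable {N : ℕ} {Ω : Set (E N)}

theorem Lp_norm_sq {α F : Type*} [MeasurableSpace α] {μ : Measure α} [NormedAddCommGroup F]
    [InnerProductSpace ℝ F] (f : Lp F 2 μ) : ‖f‖ ^ 2 = ∫ x, ‖f x‖ ^ 2 ∂μ := by
  rw [← real_inner_self_eq_norm_sq, L2.inner_def]
  simp only [real_inner_self_eq_norm_sq]

theorem Lp_enorm_sq {α F : Type*} [MeasurableSpace α] {μ : Measure α} [NormedAddCommGroup F]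
    (f : Lp F 2 μ) : ‖f‖ₑ ^ 2 = ∫⁻ x, ‖f x‖ₑ ^ 2 ∂μ := by
  rw [Lp.enorm_def, eLpNorm_eq_lintegral_rpow_enorm_toReal (by simp) (by simp),
    ← ENNReal.rpow_natCast, ← ENNReal.rpow_mul]
  simp

/-- The function underlying an element of `H¹(Ω)`, as a continuous linear map. -/
def H1funL (Ω : Set (E N)) : H1 Ω →L[ℝ] Lp ℝ 2 (volume.restrict Ω) :=
  (WithLp.fstL 2 ℝ _ _).comp (H1 Ω).subtypeL

/-- The weak gradient, as a continuous linear map. -/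
def H1gradL (Ω : Set (E N)) : H1 Ω →L[ℝ] Lp (E N) 2 (volume.restrict Ω) :=
  (WithLp.sndL 2 ℝ _ _).comp (H1 Ω).subtypeL

@[simp] theorem H1funL_apply (u : H1 Ω) : H1funL Ω u = H1fun u := rfl


theorem continuous_H1fun : Continuous (H1fun : H1 Ω → _) := (H1funL Ω).continuous

theorem continuous_H1grad : Continuous (H1grad : H1 Ω → _) := (H1gradL Ω).continuous

theorem H1fun_add (u v : H1 Ω) : H1fun (u + v) = H1fun u + H1fun v := rfl

theorem H1grad_add (u v : H1 Ω) : H1grad (u + v) = H1grad u + H1grad v := rfl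

theorem H1fun_sub (u v : H1 Ω) : H1fun (u - v) = H1fun u - H1fun v := rfl

theorem H1grad_sub (u v : H1 Ω) : H1grad (u - v) = H1grad u - H1grad v := rfl

theorem H1fun_smul (c : ℝ) (v : H1 Ω) : H1fun (c • v) = c • H1fun v := rfl

theorem H1grad_smul (c : ℝ) (v : H1 Ω) : H1grad (c • v) = c • H1grad v := rfl

theorem H1_norm_sq (u : H1 Ω) : ‖u‖ ^ 2 = ‖H1fun u‖ ^ 2 + ‖H1grad u‖ ^ 2 :=
  WithLp.prod_norm_sq_eq_of_L2 _

theorem norm_H1fun_le (u : H1 Ω) : ‖H1fun u‖ ≤ ‖u‖ := by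
  refine le_of_sq_le_sq ?_ (norm_nonneg _)
  rw [H1_norm_sq]; nlinarith [sq_nonneg ‖H1grad u‖]

theorem norm_H1grad_le (u : H1 Ω) : ‖H1grad u‖ ≤ ‖u‖ := by
  refine le_of_sq_le_sq ?_ (norm_nonneg _)
  rw [H1_norm_sq]; nlinarith [sq_nonneg ‖H1fun u‖]

theorem H1_ext {u v : H1 Ω} (h1 : H1fun u = H1fun v) (h2 : H1grad u = H1grad v) : u = v := by
  have : ‖u - v‖ ^ 2 = 0 := by
    rw [H1_norm_sq, H1fun_sub, H1grad_sub, h1, h2]; simp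
  exact sub_eq_zero.1 (norm_eq_zero.1 (pow_eq_zero_iff (by norm_num) |>.1 this))

theorem H1_tendsto_iff {ι : Type*} {l : Filter ι} {u : ι → H1 Ω} {v : H1 Ω} :
    Tendsto u l (𝓝 v) ↔ Tendsto (fun n => H1fun (u n)) l (𝓝 (H1fun v)) ∧
      Tendsto (fun n => H1grad (u n)) l (𝓝 (H1grad v)) := by
  refine ⟨fun h => ⟨(continuous_H1fun.tendsto v).comp h, (continuous_H1grad.tendsto v).comp h⟩,
    fun ⟨h1, h2⟩ => ?_⟩
  rw [tendsto_iff_norm_sub_tendsto_zero] at h1 h2 ⊢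
  have h3 := (h1.pow 2).add (h2.pow 2)
  have h4 : Tendsto (fun n => ‖u n - v‖ ^ 2) l (𝓝 0) := by
    simp only [H1_norm_sq, H1fun_sub, H1grad_sub]
    simpa using h3
  have h5 := (Real.continuous_sqrt.tendsto 0).comp h4
  simpa [Function.comp_def] using h5

theorem inner_gradient_eq_fderiv {w : E N → ℝ} {x : E N} (v : E N) :
    inner ℝ (gradient w x) v = fderiv ℝ w x v := by
  simp [gradient]

theorem norm_gradient (w : E N → ℝ) (x : E N) : ‖gradient w x‖ = ‖fderiv ℝ w x‖ := by
  simp [gradient]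

theorem continuous_gradient_of_contDiff {w : E N → ℝ} (hw : ContDiff ℝ ∞ w) :
    Continuous (gradient w) := by
  have h : Continuous (fderiv ℝ w) := hw.continuous_fderiv (by simp)
  exact (InnerProductSpace.toDual ℝ (E N)).symm.continuous.comp h

theorem IsTestFunction.memLp_inner_gradient {η : E N → ℝ} (hη : IsTestFunction Ω η) (v : E N) :
    MemLp (fun x => inner ℝ (gradient η x) v) 2 (volume.restrict Ω) :=
  (hη.continuous_gradient.memLp_of_hasCompactSupport hη.hasCompactSupport_gradient).inner_const v

theorem IsTestFunction.memLp_smul_const {η : E N → ℝ} (hη : IsTestFunction Ω η) (v : E N) :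
    MemLp (fun x => η x • v) 2 (volume.restrict Ω) :=
  (hη.contDiff.continuous.smul continuous_const).memLp_of_hasCompactSupport
    (hη.hasCompactSupport.smul_right)

theorem mem_H1_iff (p : L2Pair Ω) : p ∈ H1 Ω ↔ ∀ (η : E N → ℝ) (hη : IsTestFunction Ω η) (v : E N),
    inner ℝ (hη.memLp_inner_gradient v).toLp p.fst
      + inner ℝ (hη.memLp_smul_const v).toLp p.snd = 0 := by
  have key : ∀ (η : E N → ℝ) (hη : IsTestFunction Ω η) (v : E N),
      inner ℝ (hη.memLp_inner_gradient v).toLp p.fst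
        + inner ℝ (hη.memLp_smul_const v).toLp p.snd
      = inner ℝ v ((∫ x in Ω, p.fst x • gradient η x) + ∫ x in Ω, η x • p.snd x) := by
    intro η hη v
    rw [inner_add_right, ← integral_inner (hη.integrable_smul_gradient _),
      ← integral_inner (hη.integrable_smul _), L2.inner_def, L2.inner_def]
    congr 1
    · refine integral_congr_ae ?_
      filter_upwards [(hη.memLp_inner_gradient v).coeFn_toLp] with x hx
      rw [hx, inner_smul_right, real_inner_comm v]
      simp
    · refine integral_congr_ae ?_
      filter_upwards [(hη.memLp_smul_const v).coeFn_toLp] with x hx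
      rw [hx, inner_smul_right, inner_smul_left]
      simp
  constructor
  · intro hp η hη v
    rw [key η hη v, hp η hη, neg_add_cancel, inner_zero_right]
  · intro hp η hη
    rw [eq_neg_iff_add_eq_zero]
    refine ext_inner_left ℝ fun v => ?_
    rw [← key η hη v, hp η hη v, inner_zero_right]

theorem isClosed_H1 (Ω : Set (E N)) : IsClosed (H1 Ω : Set (L2Pair Ω)) := by
  have : (H1 Ω : Set (L2Pair Ω)) = ⋂ (η : E N → ℝ) (hη : IsTestFunction Ω η) (v : E N),
      {p | inner ℝ (hη.memLp_inner_gradient v).toLp p.fst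
        + inner ℝ (hη.memLp_smul_const v).toLp p.snd = 0} := by
    ext p; simp only [Set.mem_iInter]; exact mem_H1_iff p
  rw [this]
  refine isClosed_iInter fun η => isClosed_iInter fun hη => isClosed_iInter fun v => ?_
  refine isClosed_eq ?_ continuous_const
  exact (continuous_const.inner (WithLp.fstL 2 ℝ _ _).continuous).add
    (continuous_const.inner (WithLp.sndL 2 ℝ _ _).continuous)

instance completeSpace_H1 : CompleteSpace (H1 Ω) := (isClosed_H1 Ω).completeSpace_coe

theorem memLp_of_continuous (hb : Bornology.IsBounded Ω) {F : Type*} [NormedAddCommGroup F]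
    {w : E N → F} (hw : Continuous w) : MemLp w 2 (volume.restrict Ω) := by
  obtain ⟨C, hC⟩ := (hb.isCompact_closure.bddAbove_image (f := fun x => ‖w x‖)
    hw.norm.continuousOn)
  have : IsFiniteMeasure (volume.restrict Ω) := ⟨by simpa using hb.measure_lt_top⟩
  have h : MemLp w 2 (volume.restrict (closure Ω)) := by
    have : IsFiniteMeasure (volume.restrict (closure Ω)) :=
      ⟨by simpa using hb.isCompact_closure.measure_lt_top⟩
    refine MemLp.of_bound hw.aestronglyMeasurable C ?_
    refine (ae_restrict_iff' isClosed_closure.measurableSet).2 (Eventually.of_forall fun x hx => ?_)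
    exact hC ⟨x, hx, rfl⟩
  exact h.mono_measure (Measure.restrict_mono subset_closure le_rfl)

theorem exists_H1_of_contDiff (hb : Bornology.IsBounded Ω)
    {w : E N → ℝ} (hw : ContDiff ℝ ∞ w) : ∃ p : H1 Ω, H1fun p =ᵐ[volume.restrict Ω] w ∧
      H1grad p =ᵐ[volume.restrict Ω] gradient w := by
  have h1 := memLp_of_continuous hb hw.continuous
  have h2 := memLp_of_continuous hb (continuous_gradient_of_contDiff hw)
  have hmem : (WithLp.toLp 2 (h1.toLp w, h2.toLp (gradient w)) : L2Pair Ω) ∈ H1 Ω := by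
    intro η hη
    have e1 : ∫ x in Ω, h1.toLp w x • gradient η x = ∫ x in Ω, w x • gradient η x := by
      refine integral_congr_ae ?_
      filter_upwards [h1.coeFn_toLp] with x hx
      rw [hx]
    have e2 : ∫ x in Ω, η x • h2.toLp (gradient w) x = ∫ x in Ω, η x • gradient w x := by
      refine integral_congr_ae ?_
      filter_upwards [h2.coeFn_toLp] with x hx
      rw [hx]
    have s1 : Function.support (fun x => w x • gradient η x) ⊆ Ω := by
      refine Set.Subset.trans ?_ hη.tsupport_subset
      intro x hx
      by_contra hx'
      refine hx ?_
      have : fderiv ℝ η x = 0 := by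
        by_contra h0
        exact hx' (support_fderiv_subset ℝ (f := η) h0)
      simp [gradient, this]
    have s2 : Function.support (fun x => η x • gradient w x) ⊆ Ω := by
      refine Set.Subset.trans ?_ (subset_closure.trans hη.tsupport_subset)
      intro x hx
      refine fun h0 => hx ?_
      simp only [h0, zero_smul]
    change ∫ x in Ω, h1.toLp w x • gradient η x = -∫ x in Ω, η x • h2.toLp (gradient w) x
    rw [e1, e2, setIntegral_eq_integral_of_forall_compl_eq_zero
      (fun x hx => by_contra fun h => hx (s1 h)), setIntegral_eq_integral_of_forall_compl_eq_zero
      (fun x hx => by_contra fun h => hx (s2 h))]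
    have i1 : Integrable (fun x => w x • gradient η x) :=
      (hw.continuous.smul hη.continuous_gradient).integrable_of_hasCompactSupport
        (hη.hasCompactSupport_gradient.smul_left)
    have i2 : Integrable (fun x => η x • gradient w x) :=
      (hη.contDiff.continuous.smul (continuous_gradient_of_contDiff hw)).integrable_of_hasCompactSupport
        (hη.hasCompactSupport.smul_right)
    refine ext_inner_left ℝ fun v => ?_
    rw [inner_neg_right, ← integral_inner i1, ← integral_inner i2]
    have e3 : ∀ (c : ℝ) (f : E N → ℝ) (x : E N), inner ℝ v (c • gradient f x) = c * fderiv ℝ f x v :=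
      fun c f x => by rw [inner_smul_right, real_inner_comm, inner_gradient_eq_fderiv]
    simp only [e3]
    have c1 : Continuous (fun x => fderiv ℝ w x v) :=
      (hw.continuous_fderiv (by simp)).clm_apply continuous_const
    have c2 : Continuous (fun x => fderiv ℝ η x v) :=
      (hη.contDiff.continuous_fderiv (by simp)).clm_apply continuous_const
    have hs : HasCompactSupport (fun x => fderiv ℝ η x v) :=
      (hη.hasCompactSupport.fderiv (𝕜 := ℝ)).comp_left (g := fun L : E N →L[ℝ] ℝ => L v) rfl
    rw [integral_mul_fderiv_eq_neg_fderiv_mul_of_integrable]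
    · simp only [mul_comm]
    · exact (c1.mul hη.contDiff.continuous).integrable_of_hasCompactSupport
        (hη.hasCompactSupport.mul_left)
    · exact (hw.continuous.mul c2).integrable_of_hasCompactSupport hs.mul_left
    · exact (hw.continuous.mul hη.contDiff.continuous).integrable_of_hasCompactSupport
        (hη.hasCompactSupport.mul_left)
    · exact fun x _ => (hw.differentiable (by simp)) x
    · exact fun x _ => (hη.contDiff.differentiable (by simp)) x
  exact ⟨⟨_, hmem⟩, h1.coeFn_toLp, h2.coeFn_toLp⟩

/-- The weak gradient is unique. -/
theorem H1grad_eq_of_H1fun_eq (hΩ : IsOpen Ω) {u v : H1 Ω}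
    (h : H1fun u = H1fun v) : H1grad u = H1grad v := by
  have key : ∀ᵐ x ∂(volume : Measure (E N)), x ∈ Ω → (H1grad u - H1grad v) x = 0 := by
    refine hΩ.ae_eq_zero_of_integral_contDiff_smul_eq_zero ?_ ?_
    · exact locallyIntegrableOn_of_locallyIntegrable_restrict
        ((Lp.memLp (H1grad u - H1grad v)).locallyIntegrable (by norm_num))
    · intro η h1 h2 h3
      have hη : IsTestFunction Ω η := ⟨h1, h2, h3⟩
      rw [← setIntegral_eq_integral_of_forall_compl_eq_zero (s := Ω)]
      · have hu := (u - v).2 η hη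
        have h0 : ∫ x in Ω, (u - v : H1 Ω).1.fst x • gradient η x = 0 := by
          have : (u - v : H1 Ω).1.fst = 0 := by
            change H1fun (u - v) = 0
            rw [H1fun_sub, h, sub_self]
          rw [this]
          refine integral_eq_zero_of_ae ?_
          filter_upwards [Lp.coeFn_zero ℝ 2 (volume.restrict Ω)] with x hx
          rw [hx]; simp
        have h1 : ∫ x in Ω, (u - v : H1 Ω).1.fst x • gradient η x
          = -∫ x in Ω, η x • (H1grad u - H1grad v) x := hu
        rw [h0, zero_eq_neg] at h1
        exact h1
      · intro x hx
        have : η x = 0 := image_eq_zero_of_notMem_tsupport fun h => hx (h3 h)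
        simp [this]
  have h0 : H1grad u - H1grad v = 0 := by
    refine Lp.ext ?_
    rw [← ae_restrict_iff' hΩ.measurableSet] at key
    filter_upwards [key, Lp.coeFn_zero (E N) 2 (volume.restrict Ω)] with x h1 h2
    rw [h1, h2]; rfl
  exact sub_eq_zero.1 h0

/-- Bounded sequences in a separable Hilbert space have weakly convergent subsequences. -/
theorem exists_weak_limit {H : Type*} [NormedAddCommGroup H] [InnerProductSpace ℝ H]
    [CompleteSpace H] [TopologicalSpace.SeparableSpace H] (u : ℕ → H) (C : ℝ)
    (hu : ∀ n, ‖u n‖ ≤ C) : ∃ (v : H) (σ : ℕ → ℕ), StrictMono σ ∧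
      ∀ w, Tendsto (fun n => inner ℝ (u (σ n)) w) atTop (𝓝 (inner ℝ v w)) := by
  let x : ℕ → WeakDual ℝ H := fun n => StrongDual.toWeakDual (InnerProductSpace.toDual ℝ H (u n))
  have hx : ∀ n, x n ∈ (WeakDual.toStrongDual ⁻¹' Metric.closedBall (0 : StrongDual ℝ H) C) := by
    intro n
    simp only [Set.mem_preimage, mem_closedBall_zero_iff]
    exact (LinearIsometryEquiv.norm_map (InnerProductSpace.toDual ℝ H) (u n)).le.trans (hu n)
  obtain ⟨φ, -, σ, hσ, hlim⟩ := WeakDual.isSeqCompact_closedBall ℝ H 0 C hx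
  refine ⟨(InnerProductSpace.toDual ℝ H).symm (WeakDual.toStrongDual φ), σ, hσ, fun w => ?_⟩
  have := ((WeakDual.eval_continuous w).tendsto φ).comp hlim
  rw [InnerProductSpace.toDual_symm_apply]
  exact this

instance separableSpace_H1 : TopologicalSpace.SeparableSpace (H1 Ω) := by
  have : Fact ((2 : ℝ≥0∞) ≠ ⊤) := ⟨by simp⟩
  have h1 : SecondCountableTopology (Lp ℝ 2 (volume.restrict Ω)) := Lp.SecondCountableTopology
  have h2 : SecondCountableTopology (Lp (E N) 2 (volume.restrict Ω)) := Lp.SecondCountableTopology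
  have : SecondCountableTopology (L2Pair Ω) := WithLp.secondCountableTopology 2 _ _
  infer_instance

end Basics

section Geometry

open scoped NNReal

theorem ennreal_add_sq_le (a b : ℝ≥0∞) : (a + b) ^ 2 ≤ 2 * a ^ 2 + 2 * b ^ 2 := by
  have := ENNReal.rpow_add_le_mul_rpow_add_rpow a b (p := 2) (by norm_num)
  norm_num at this
  rw [← mul_add]
  exact this

theorem sq_lintegral_le {α : Type*} [MeasurableSpace α] (μ : Measure α) {f : α → ℝ≥0∞}
    (hf : AEMeasurable f μ) : (∫⁻ x, f x ∂μ) ^ 2 ≤ μ Set.univ * ∫⁻ x, f x ^ 2 ∂μ := by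
  have h := ENNReal.lintegral_mul_le_Lp_mul_Lq μ Real.HolderConjugate.two_two hf
    (aemeasurable_const (b := (1 : ℝ≥0∞)))
  simp only [Pi.mul_apply, mul_one, ENNReal.one_rpow, lintegral_const, one_mul] at h
  have h2 := pow_le_pow_left' h 2
  rw [mul_pow, ← ENNReal.rpow_natCast, ← ENNReal.rpow_natCast, ← ENNReal.rpow_natCast,
    ← ENNReal.rpow_mul, ← ENNReal.rpow_mul] at h2
  norm_num at h2
  rw [mul_comm]
  exact h2

/-- One-dimensional estimate: values of a `C¹` function on `[0, T]` are comparable up to the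
`L²`-norm of the derivative. -/
theorem enorm_sq_le_of_deriv {a a' : ℝ → ℝ} (ha : ∀ t, HasDerivAt a (a' t) t)
    (hc : Continuous a') {T s t : ℝ} (hs : s ∈ Set.Icc 0 T) (ht : t ∈ Set.Icc 0 T) :
    ‖a t‖ₑ ^ 2 ≤ 2 * ‖a s‖ₑ ^ 2
      + 2 * (ENNReal.ofReal T * ∫⁻ σ in Set.Ioc 0 T, ‖a' σ‖ₑ ^ 2) := by
  have h1 : a t - a s = ∫ σ in s..t, a' σ :=
    (intervalIntegral.integral_eq_sub_of_hasDerivAt (fun x _ => ha x)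
      (hc.intervalIntegrable _ _)).symm
  have h2 : ‖a t - a s‖ₑ ≤ ∫⁻ σ in Set.Ioc 0 T, ‖a' σ‖ₑ := by
    rw [h1, enorm_eq_nnnorm, ← enorm_eq_nnnorm, ← ofReal_norm,
      intervalIntegral.norm_intervalIntegral_eq, ofReal_norm]
    refine (enorm_integral_le_lintegral_enorm _).trans (lintegral_mono_set ?_)
    exact Set.Ioc_subset_Ioc (le_min hs.1 ht.1) (max_le hs.2 ht.2)
  have h3 : ‖a t‖ₑ ≤ ‖a s‖ₑ + ‖a t - a s‖ₑ := by
    calc ‖a t‖ₑ = ‖a s + (a t - a s)‖ₑ := by congr 1; ring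
      _ ≤ _ := enorm_add_le _ _
  calc ‖a t‖ₑ ^ 2 ≤ (‖a s‖ₑ + ‖a t - a s‖ₑ) ^ 2 := pow_le_pow_left' h3 2
    _ ≤ 2 * ‖a s‖ₑ ^ 2 + 2 * ‖a t - a s‖ₑ ^ 2 := ennreal_add_sq_le _ _
    _ ≤ _ := by
      gcongr
      refine (pow_le_pow_left' h2 2).trans ((sq_lintegral_le _ ?_).trans ?_)
      · exact (hc.enorm).aemeasurable
      · simp

variable {N : ℕ} {Ω : Set (E N)}

/-- The part of `Ω` at distance less than `δ` from the complement. -/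
def layer (Ω : Set (E N)) (δ : ℝ) : Set (E N) := Ω ∩ Metric.thickening δ Ωᶜ

theorem measurableSet_layer (hΩ : IsOpen Ω) (δ : ℝ) : MeasurableSet (layer Ω δ) :=
  hΩ.measurableSet.inter Metric.isOpen_thickening.measurableSet

theorem layer_subset (δ : ℝ) : layer Ω δ ⊆ Ω := Set.inter_subset_left

theorem layer_mono {δ ε : ℝ} (h : δ ≤ ε) : layer Ω δ ⊆ layer Ω ε :=
  Set.inter_subset_inter_right _ (Metric.thickening_mono h _)

/-- A local representation of `Ω` as a strict Lipschitz epigraph. -/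
structure LipChart (Ω : Set (E N)) (x₀ : E N) where
  e : E N
  norm_e : ‖e‖ = 1
  r : ℝ
  r_pos : 0 < r
  γ : (Submodule.span ℝ {e})ᗮ → ℝ
  K : ℝ≥0
  lip : LipschitzWith K γ
  mem_iff : ∀ y ∈ Metric.ball x₀ r,
    (y ∈ Ω ↔ γ ((Submodule.span ℝ {e})ᗮ.orthogonalProjectionOnto y) < inner ℝ e y)

theorem HasLipschitzBoundary.nonempty_lipChart (h : HasLipschitzBoundary Ω) {x₀ : E N}
    (hx : x₀ ∈ frontier Ω) : Nonempty (LipChart Ω x₀) := by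
  obtain ⟨e, he, r, hr, γ, K, hγ, hm⟩ := h x₀ hx
  exact ⟨⟨e, he, r, hr, γ, K, hγ, hm⟩⟩

namespace LipChart

variable {x₀ : E N} (c : LipChart Ω x₀)

/-- The hyperplane of horizontal variables. -/
abbrev F : Submodule ℝ (E N) := (Submodule.span ℝ {c.e})ᗮ

/-- The orthogonal projection to the horizontal hyperplane. -/
def proj (x : E N) : c.F := c.F.orthogonalProjectionOnto x

/-- The point at height `t` above the graph over `y`. -/
def pt (y : c.F) (t : ℝ) : E N := (y : E N) + (c.γ y + t) • c.e

theorem inner_e_e : inner ℝ c.e c.e = (1 : ℝ) := by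
  rw [real_inner_self_eq_norm_sq, c.norm_e]; norm_num

theorem inner_e_coe (y : c.F) : inner ℝ c.e (y : E N) = (0 : ℝ) :=
  (Submodule.mem_orthogonal_singleton_iff_inner_right).1 y.2

theorem decomp (x : E N) : (c.proj x : E N) + (inner ℝ c.e x : ℝ) • c.e = x := by
  have h := Submodule.starProjection_add_starProjection_orthogonal (K := Submodule.span ℝ {c.e}) x
  rw [Submodule.starProjection_unit_singleton ℝ c.norm_e] at h
  rw [add_comm]
  exact h

theorem proj_add_smul (y : c.F) (t : ℝ) : c.proj ((y : E N) + t • c.e) = y := by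
  have h := c.decomp ((y : E N) + t • c.e)
  rw [inner_add_right, inner_e_coe, inner_smul_right, inner_e_e, zero_add, mul_one] at h
  exact Subtype.ext (add_right_cancel h)

theorem inner_pt (y : c.F) (t : ℝ) : inner ℝ c.e (c.pt y t) = c.γ y + t := by
  rw [pt, inner_add_right, inner_e_coe, inner_smul_right, inner_e_e, zero_add, mul_one]

theorem proj_pt (y : c.F) (t : ℝ) : c.proj (c.pt y t) = y := c.proj_add_smul y _

theorem pt_proj (x : E N) : c.pt (c.proj x) (inner ℝ c.e x - c.γ (c.proj x)) = x := by
  rw [pt, add_sub_cancel, decomp]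

theorem dist_pt (y : c.F) (s t : ℝ) : dist (c.pt y s) (c.pt y t) = |s - t| := by
  rw [dist_eq_norm, pt, pt, add_sub_add_left_eq_sub, ← sub_smul, norm_smul, c.norm_e]
  simp

theorem lipschitz_proj : LipschitzWith 1 c.proj :=
  c.F.lipschitzWith_orthogonalProjectionOnto

theorem lipschitz_pt_zero : LipschitzWith (1 + c.K) (fun y => c.pt y 0) := by
  have h1 : LipschitzWith 1 (fun y : c.F => (y : E N)) := LipschitzWith.subtype_val _
  have h2 : LipschitzWith c.K (fun y : c.F => (c.γ y + 0) • c.e) := by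
    refine LipschitzWith.of_dist_le_mul fun y z => ?_
    rw [dist_eq_norm, ← sub_smul, norm_smul, c.norm_e, mul_one]
    simpa [dist_eq_norm] using c.lip.dist_le_mul y z
  exact h1.add h2

theorem continuous_pt : Continuous (fun p : c.F × ℝ => c.pt p.1 p.2) := by
  have := c.lip.continuous
  unfold pt
  fun_prop

theorem pt_mem_ball {y : c.F} (hy : c.pt y 0 ∈ Metric.ball x₀ (c.r / 2)) {t : ℝ}
    (ht : |t| < c.r / 2) : c.pt y t ∈ Metric.ball x₀ c.r := by
  rw [Metric.mem_ball] at *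
  have := dist_triangle (c.pt y t) (c.pt y 0) x₀
  rw [dist_pt, sub_zero] at this
  linarith

theorem mem_iff' {x : E N} (hx : x ∈ Metric.ball x₀ c.r) :
    x ∈ Ω ↔ c.γ (c.proj x) < inner ℝ c.e x := c.mem_iff x hx

theorem pt_mem {y : c.F} {t : ℝ} (hy : c.pt y t ∈ Metric.ball x₀ c.r) :
    c.pt y t ∈ Ω ↔ 0 < t := by
  rw [c.mem_iff' hy, proj_pt, inner_pt]; simp

theorem pt_zero_notMem {y : c.F} (hy : c.pt y 0 ∈ Metric.ball x₀ c.r) : c.pt y 0 ∉ Ω := by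
  rw [c.pt_mem hy]; exact lt_irrefl _

theorem ball_half_subset : Metric.ball x₀ (c.r / 2) ⊆ Metric.ball x₀ c.r :=
  Metric.ball_subset_ball (by linarith [c.r_pos])

theorem pt_zero_mem_frontier (hΩ : IsOpen Ω) {y : c.F}
    (hy : c.pt y 0 ∈ Metric.ball x₀ (c.r / 2)) : c.pt y 0 ∈ frontier Ω := by
  rw [hΩ.frontier_eq]
  refine ⟨?_, c.pt_zero_notMem (c.ball_half_subset hy)⟩
  rw [Metric.mem_closure_iff]
  intro ε hε
  have hr := c.r_pos
  set t := min (ε / 2) (c.r / 4) with ht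
  have ht0 : 0 < t := lt_min (by linarith) (by linarith)
  have ht1 : t ≤ ε / 2 := min_le_left _ _
  have ht2 : t ≤ c.r / 4 := min_le_right _ _
  refine ⟨c.pt y t, (c.pt_mem (c.pt_mem_ball hy ?_)).2 ht0, ?_⟩
  · rw [abs_of_pos ht0]; linarith
  · rw [dist_pt, zero_sub, abs_neg, abs_of_pos ht0]; linarith

theorem pt_proj_zero_of_mem_frontier (hΩ : IsOpen Ω) {x : E N} (hx : x ∈ frontier Ω)
    (hx' : x ∈ Metric.ball x₀ c.r) : c.pt (c.proj x) 0 = x := by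
  rw [hΩ.frontier_eq] at hx
  have h1 : inner ℝ c.e x ≤ c.γ (c.proj x) := not_lt.1 fun h => hx.2 ((c.mem_iff' hx').2 h)
  have h2 : c.γ (c.proj x) ≤ inner ℝ c.e x := by
    have hcl : x ∈ closure (Ω ∩ Metric.ball x₀ c.r) := 
      Metric.isOpen_ball.closure_inter ⟨hx.1, hx'⟩
    have hsub : Ω ∩ Metric.ball x₀ c.r ⊆ {z | c.γ (c.proj z) ≤ inner ℝ c.e z} :=
      fun z hz => ((c.mem_iff' hz.2).1 hz.1).le
    have hclosed : IsClosed {z | c.γ (c.proj z) ≤ inner ℝ c.e z} :=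
      isClosed_le (c.lip.continuous.comp c.lipschitz_proj.continuous)
        (continuous_const.inner continuous_id)
    exact closure_minimal hsub hclosed hcl
  have h3 := c.pt_proj x
  rwa [le_antisymm h1 h2, sub_self] at h3

/-- The horizontal domain of the chart. -/
def base : Set c.F := {y | c.pt y 0 ∈ Metric.ball x₀ (c.r / 2)}

theorem isOpen_base : IsOpen c.base :=
  Metric.isOpen_ball.preimage c.lipschitz_pt_zero.continuous

/-- `(N-1)`-dimensional measure on the horizontal hyperplane. -/
def horiz : Measure c.F := Measure.hausdorffMeasure ((N : ℝ) - 1)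

theorem isAddHaarMeasure_horiz : c.horiz.IsAddHaarMeasure := by
  have h1 : Module.finrank ℝ (Submodule.span ℝ {c.e}) = 1 :=
    finrank_span_singleton (norm_ne_zero_iff.1 (by rw [c.norm_e]; norm_num))
  have h2 := Submodule.finrank_add_finrank_orthogonal (Submodule.span ℝ {c.e})
  rw [h1, finrank_euclideanSpace_fin] at h2
  have h3 : ((N : ℝ) - 1) = (Module.finrank ℝ c.F : ℝ) := by
    have h4 : (1 : ℝ) + (Module.finrank ℝ c.F : ℝ) = N := by exact_mod_cast h2
    linarith
  rw [horiz, h3]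
  infer_instance

/-- Cartesian coordinates adapted to the chart. -/
def lin : (c.F × ℝ) ≃L[ℝ] E N :=
  LinearEquiv.toContinuousLinearEquiv
    { toFun := fun p => (p.1 : E N) + p.2 • c.e
      invFun := fun x => (c.proj x, inner ℝ c.e x)
      map_add' := fun p q => by simp [add_smul]; abel
      map_smul' := fun a p => by simp [smul_smul]
      left_inv := fun p => by
        ext1
        · exact c.proj_add_smul _ _
        · simp [inner_add_right, inner_e_coe, inner_smul_right, c.norm_e]
      right_inv := fun x => c.decomp x }

theorem exists_volume : ∃ k : ℝ≥0, k ≠ 0 ∧ ∀ g : E N → ℝ≥0∞, Measurable g →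
    ∫⁻ y, (∫⁻ t, g (c.pt y t)) ∂c.horiz = k * ∫⁻ x, g x := by
  have := c.isAddHaarMeasure_horiz
  have h1 : (Measure.map c.lin (c.horiz.prod volume)).IsAddHaarMeasure :=
    c.lin.isAddHaarMeasure_map _
  have hk := Measure.isAddLeftInvariant_eq_smul
    (Measure.map c.lin (c.horiz.prod volume)) (volume : Measure (E N))
  refine ⟨_, (Measure.addHaarScalarFactor_pos_of_isAddHaarMeasure
    (Measure.map c.lin (c.horiz.prod volume)) (volume : Measure (E N))).ne', fun g hg => ?_⟩
  have e1 : ∫⁻ x, g x ∂(Measure.map c.lin (c.horiz.prod volume))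
      = (Measure.map c.lin (c.horiz.prod volume)).addHaarScalarFactor (volume : Measure (E N))
        * ∫⁻ x, g x := by
    conv_lhs => rw [hk, lintegral_smul_measure]
    rfl
  rw [← e1, lintegral_map hg c.lin.continuous.measurable,
    lintegral_prod (fun p => g (c.lin p)) (hg.comp c.lin.continuous.measurable).aemeasurable]
  refine lintegral_congr fun y => ?_
  exact lintegral_add_left_eq_self (fun t => g ((y : E N) + t • c.e)) (c.γ y)

/-- The surface measure dominates the measure on the hyperplane. -/
theorem lintegral_base_le (hN : 2 ≤ N) (hΩ : IsOpen Ω) {g : E N → ℝ≥0∞} (hg : Measurable g) :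
    ∫⁻ y in c.base, g (c.pt y 0) ∂c.horiz ≤ ∫⁻ x, g x ∂(surfaceMeasure Ω) := by
  have hm : Measurable (fun y => c.pt y 0) := c.lipschitz_pt_zero.continuous.measurable
  rw [← lintegral_map hg hm]
  refine lintegral_mono' (Measure.le_iff.2 fun s hs => ?_) le_rfl
  rw [Measure.map_apply hm hs, Measure.restrict_apply (hm hs), surfaceMeasure,
    Measure.restrict_apply hs, horiz]
  have hd : (0 : ℝ) ≤ (N : ℝ) - 1 := by
    have : (2 : ℝ) ≤ N := by exact_mod_cast hN
    linarith
  have h1 := c.lipschitz_proj.hausdorffMeasure_image_le hd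
    ((fun y => c.pt y 0) '' ((fun y => c.pt y 0) ⁻¹' s ∩ c.base))
  rw [ENNReal.coe_one, ENNReal.one_rpow, one_mul, Set.image_image] at h1
  simp only [proj_pt, Set.image_id'] at h1
  refine h1.trans (measure_mono ?_)
  rintro _ ⟨y, hy, rfl⟩
  exact ⟨hy.1, c.pt_zero_mem_frontier hΩ hy.2⟩

/-- The measure on the hyperplane dominates the surface measure up to a constant. -/
theorem lintegral_surface_le (hN : 2 ≤ N) (hΩ : IsOpen Ω) {g : E N → ℝ≥0∞} (hg : Measurable g) :
    ∫⁻ x in Metric.ball x₀ (c.r / 2), g x ∂(surfaceMeasure Ω)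
      ≤ ((1 + c.K : ℝ≥0) : ℝ≥0∞) ^ ((N : ℝ) - 1) * ∫⁻ y in c.base, g (c.pt y 0) ∂c.horiz := by
  have hm : Measurable (fun y => c.pt y 0) := c.lipschitz_pt_zero.continuous.measurable
  rw [← lintegral_map hg hm, ← smul_eq_mul, ← lintegral_smul_measure]
  refine lintegral_mono' (Measure.le_iff.2 fun s hs => ?_) le_rfl
  rw [Measure.smul_apply, Measure.map_apply hm hs, Measure.restrict_apply (hm hs), surfaceMeasure,
    Measure.restrict_apply hs, Measure.restrict_apply (hs.inter Metric.isOpen_ball.measurableSet),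
    horiz]
  have hd : (0 : ℝ) ≤ (N : ℝ) - 1 := by
    have : (2 : ℝ) ≤ N := by exact_mod_cast hN
    linarith
  refine le_trans (measure_mono ?_) (c.lipschitz_pt_zero.hausdorffMeasure_image_le hd
    ((fun y => c.pt y 0) ⁻¹' s ∩ c.base))
  rintro x ⟨⟨hx1, hx2⟩, hx3⟩
  have hx4 := c.pt_proj_zero_of_mem_frontier hΩ hx3 (c.ball_half_subset hx2)
  refine ⟨c.proj x, ⟨?_, ?_⟩, hx4⟩
  · simpa [hx4] using hx1
  · simpa [base, hx4] using hx2

theorem pt_mem_layer {y : c.F} (hy : y ∈ c.base) {t T : ℝ} (ht : t ∈ Set.Ioc 0 T)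
    (hT : T ≤ c.r / 4) : c.pt y t ∈ layer Ω (2 * T) := by
  have hr := c.r_pos
  refine ⟨(c.pt_mem (c.pt_mem_ball hy ?_)).2 ht.1, ?_⟩
  · rw [abs_of_pos ht.1]; linarith [ht.2]
  · rw [Metric.mem_thickening_iff]
    refine ⟨c.pt y 0, c.pt_zero_notMem (c.ball_half_subset hy), ?_⟩
    rw [dist_pt, sub_zero, abs_of_pos ht.1]
    linarith [ht.1, ht.2]

theorem lintegral_collar_le (hΩ : IsOpen Ω) {k : ℝ≥0}
    (hk : ∀ g : E N → ℝ≥0∞, Measurable g →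
      ∫⁻ y, (∫⁻ t, g (c.pt y t)) ∂c.horiz = k * ∫⁻ x, g x)
    {g : E N → ℝ≥0∞} (hg : Measurable g) {T : ℝ} (hT : T ≤ c.r / 4) :
    ∫⁻ y in c.base, (∫⁻ t in Set.Ioc 0 T, g (c.pt y t)) ∂c.horiz
      ≤ k * ∫⁻ x in layer Ω (2 * T), g x := by
  rw [← lintegral_indicator (measurableSet_layer hΩ _),
    ← hk _ (hg.indicator (measurableSet_layer hΩ _)),
    ← lintegral_indicator c.isOpen_base.measurableSet]
  refine lintegral_mono fun y => ?_
  by_cases hy : y ∈ c.base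
  · rw [Set.indicator_of_mem hy, ← lintegral_indicator measurableSet_Ioc]
    refine lintegral_mono fun t => ?_
    by_cases ht : t ∈ Set.Ioc 0 T
    · rw [Set.indicator_of_mem ht, Set.indicator_of_mem (c.pt_mem_layer hy ht hT)]
    · rw [Set.indicator_of_notMem ht]; exact zero_le
  · rw [Set.indicator_of_notMem hy]; exact zero_le

theorem le_lintegral_collar (hΩ : IsOpen Ω) {k : ℝ≥0}
    (hk : ∀ g : E N → ℝ≥0∞, Measurable g →
      ∫⁻ y, (∫⁻ t, g (c.pt y t)) ∂c.horiz = k * ∫⁻ x, g x)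
    {g : E N → ℝ≥0∞} (hg : Measurable g) {δ : ℝ} (hδ : 0 < δ)
    (hδ' : (1 + c.K) * δ < c.r / 4) :
    k * ∫⁻ x in layer Ω δ ∩ Metric.ball x₀ (c.r / 4), g x
      ≤ ∫⁻ y in c.base, (∫⁻ t in Set.Ioc 0 ((1 + c.K) * δ), g (c.pt y t)) ∂c.horiz := by
  have hr := c.r_pos
  have hK := c.K.2
  have hms := (measurableSet_layer hΩ δ).inter
    (Metric.isOpen_ball (x := x₀) (ε := c.r / 4)).measurableSet
  rw [← lintegral_indicator hms, ← hk _ (hg.indicator hms),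
    ← lintegral_indicator c.isOpen_base.measurableSet]
  refine lintegral_mono fun y => ?_
  have key : ∀ t, c.pt y t ∈ layer Ω δ ∩ Metric.ball x₀ (c.r / 4) →
      y ∈ c.base ∧ t ∈ Set.Ioc 0 ((1 + c.K) * δ) := by
    rintro t ⟨⟨hx1, hx2⟩, hx3⟩
    rw [Metric.mem_ball] at hx3
    have hδr : δ < c.r / 4 := by
      have : 0 ≤ (c.K : ℝ) * δ := by positivity
      linarith
    have ht0 : 0 < t := (c.pt_mem (by rw [Metric.mem_ball]; linarith)).1 hx1
    obtain ⟨z, hz, hxz⟩ := Metric.mem_thickening_iff.1 hx2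
    have hzb : z ∈ Metric.ball x₀ c.r := by
      rw [Metric.mem_ball]
      have := dist_triangle_left z x₀ (c.pt y t)
      linarith
    have h1 : inner ℝ c.e z ≤ c.γ (c.proj z) := not_lt.1 fun h => hz ((c.mem_iff' hzb).2 h)
    have h2 : c.γ (c.proj z) ≤ c.γ y + c.K * δ := by
      have e1 := c.lip.dist_le_mul (c.proj z) y
      have e2 := c.lipschitz_proj.dist_le_mul z (c.pt y t)
      rw [proj_pt, dist_comm z, NNReal.coe_one, one_mul] at e2
      have e3 := le_abs_self (c.γ (c.proj z) - c.γ y)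
      rw [← Real.dist_eq] at e3
      have e4 : (c.K : ℝ) * dist (c.proj z) y ≤ c.K * δ := by gcongr; linarith
      linarith
    have h3 : c.γ y + t ≤ inner ℝ c.e z + δ := by
      have e1 := real_inner_le_norm c.e (c.pt y t - z)
      rw [inner_sub_right, inner_pt, c.norm_e, one_mul, ← dist_eq_norm] at e1
      linarith
    have ht1 : t ≤ (1 + c.K) * δ := by linarith
    refine ⟨?_, ht0, ht1⟩
    change dist (c.pt y 0) x₀ < c.r / 2
    have := dist_triangle (c.pt y 0) (c.pt y t) x₀
    rw [dist_pt, zero_sub, abs_neg, abs_of_pos ht0] at this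
    linarith
  by_cases hy : y ∈ c.base
  · rw [Set.indicator_of_mem hy, ← lintegral_indicator measurableSet_Ioc]
    refine lintegral_mono fun t => ?_
    by_cases ht : c.pt y t ∈ layer Ω δ ∩ Metric.ball x₀ (c.r / 4)
    · rw [Set.indicator_of_mem ht, Set.indicator_of_mem (key t ht).2]
    · rw [Set.indicator_of_notMem ht]; exact zero_le
  · refine le_of_eq_of_le ?_ zero_le
    rw [← lintegral_zero (μ := volume) (α := ℝ)]
    refine lintegral_congr fun t => ?_
    exact Set.indicator_of_notMem (fun ht => hy (key t ht).1) _

theorem hasDerivAt_comp_pt {w : E N → ℝ} (hw : ContDiff ℝ ∞ w) (y : c.F) (t : ℝ) :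
    HasDerivAt (fun t => w (c.pt y t)) (fderiv ℝ w (c.pt y t) c.e) t := by
  have h1 : HasDerivAt (fun t => c.pt y t) c.e t := by
    have := (((hasDerivAt_id t).const_add (c.γ y)).smul_const c.e).const_add (y : E N)
    simpa [pt] using this
  exact ((hw.differentiable (by simp)) (c.pt y t)).hasFDerivAt.comp_hasDerivAt t h1

theorem enorm_sq_pt_le {w : E N → ℝ} (hw : ContDiff ℝ ∞ w) (y : c.F) {T s t : ℝ}
    (hs : s ∈ Set.Icc 0 T) (ht : t ∈ Set.Icc 0 T) :
    ‖w (c.pt y t)‖ₑ ^ 2 ≤ 2 * ‖w (c.pt y s)‖ₑ ^ 2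
      + 2 * (ENNReal.ofReal T * ∫⁻ σ in Set.Ioc 0 T, ‖gradient w (c.pt y σ)‖ₑ ^ 2) := by
  have hcont : Continuous fun t => fderiv ℝ w (c.pt y t) c.e :=
    ((hw.continuous_fderiv (by simp)).comp
      (c.continuous_pt.comp (by fun_prop : Continuous fun t : ℝ => (y, t)))).clm_apply
      continuous_const
  refine (enorm_sq_le_of_deriv (fun t => c.hasDerivAt_comp_pt hw y t) hcont hs ht).trans ?_
  gcongr with σ
  have h := (fderiv ℝ w (c.pt y σ)).le_opNorm c.e
  rw [c.norm_e, mul_one, ← norm_gradient] at h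
  exact enorm_le_iff_norm_le.2 h

/-- Local version of the boundary layer estimate. -/
theorem lintegral_layer_le (hN : 2 ≤ N) (hΩ : IsOpen Ω) : ∃ C : ℝ≥0, ∃ δ₀ > 0, ∀ δ, 0 < δ → δ < δ₀ →
    ∀ w : E N → ℝ, ContDiff ℝ ∞ w →
    ∫⁻ x in layer Ω δ ∩ Metric.ball x₀ (c.r / 4), ‖w x‖ₑ ^ 2
      ≤ C * ENNReal.ofReal δ * ∫⁻ x, ‖w x‖ₑ ^ 2 ∂(surfaceMeasure Ω)
        + C * ENNReal.ofReal δ ^ 2 * ∫⁻ x in layer Ω (C * δ), ‖gradient w x‖ₑ ^ 2 := by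
  obtain ⟨k, hk0, hk⟩ := c.exists_volume
  have hK : (0 : ℝ) ≤ c.K := c.K.2
  have hr := c.r_pos
  set A : ℝ≥0 := 1 + c.K with hA
  have hA1 : (1 : ℝ) ≤ A := by rw [hA]; push_cast; linarith
  have hAR : (1 + c.K : ℝ) = A := by rw [hA]; push_cast; rfl
  refine ⟨2 * A + k⁻¹ * 2 * A + 2 * A ^ 2, c.r / 4 / A, by positivity, ?_⟩
  intro δ hδ hδ' w hw
  have hT : (1 + c.K) * δ < c.r / 4 := by
    rw [hAR, mul_comm]; exact (lt_div_iff₀ (by positivity)).1 hδ'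
  have hmw : Measurable (fun x => ‖w x‖ₑ ^ 2) := (hw.continuous.measurable.enorm).pow_const 2
  have hmg : Measurable (fun x => ‖gradient w x‖ₑ ^ 2) :=
    ((continuous_gradient_of_contDiff hw).measurable.enorm).pow_const 2
  have h1 := c.le_lintegral_collar hΩ hk hmw hδ hT
  have h2 := c.lintegral_collar_le hΩ hk hmg hT.le
  have h3 := c.lintegral_base_le hN hΩ hmw
  rw [hAR] at h1 h2 hT
  set T : ℝ := A * δ with hTdef
  have hT0 : 0 < T := by positivity
  have hTe : ENNReal.ofReal T = A * ENNReal.ofReal δ := by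
    rw [hTdef, ENNReal.ofReal_mul (by positivity)]; simp
  have hm0 : Measurable fun y => ‖w (c.pt y 0)‖ₑ ^ 2 :=
    hmw.comp c.lipschitz_pt_zero.continuous.measurable
  have h4 : ∫⁻ y in c.base, (∫⁻ t in Set.Ioc 0 T, ‖w (c.pt y t)‖ₑ ^ 2) ∂c.horiz
      ≤ 2 * ENNReal.ofReal T * (∫⁻ y in c.base, ‖w (c.pt y 0)‖ₑ ^ 2 ∂c.horiz)
        + 2 * ENNReal.ofReal T ^ 2 *
          ∫⁻ y in c.base, (∫⁻ t in Set.Ioc 0 T, ‖gradient w (c.pt y t)‖ₑ ^ 2) ∂c.horiz := by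
    rw [← lintegral_const_mul _ hm0, ← lintegral_const_mul' _ _ (by finiteness),
      ← lintegral_add_left (hm0.const_mul _)]
    refine lintegral_mono fun y => ?_
    have : ∀ t ∈ Set.Ioc 0 T, ‖w (c.pt y t)‖ₑ ^ 2 ≤ 2 * ‖w (c.pt y 0)‖ₑ ^ 2
      + 2 * (ENNReal.ofReal T * ∫⁻ σ in Set.Ioc 0 T, ‖gradient w (c.pt y σ)‖ₑ ^ 2) :=
      fun t ht => c.enorm_sq_pt_le hw y ⟨le_rfl, hT0.le⟩ ⟨ht.1.le, ht.2⟩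
    refine (setLIntegral_mono' measurableSet_Ioc this).trans (le_of_eq ?_)
    rw [setLIntegral_const, Real.volume_Ioc, sub_zero]
    ring
  have h5 := h1.trans h4
  have hk0' : (k : ℝ≥0∞) ≠ 0 := by simpa using hk0
  have h6 : (k : ℝ≥0∞) * ∫⁻ x in layer Ω δ ∩ Metric.ball x₀ (c.r / 4), ‖w x‖ₑ ^ 2
      ≤ 2 * ENNReal.ofReal T * (∫⁻ x, ‖w x‖ₑ ^ 2 ∂(surfaceMeasure Ω))
        + 2 * ENNReal.ofReal T ^ 2 * (k * ∫⁻ x in layer Ω (2 * T), ‖gradient w x‖ₑ ^ 2) := by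
    refine h5.trans ?_
    gcongr
  have h7 : ∫⁻ x in layer Ω δ ∩ Metric.ball x₀ (c.r / 4), ‖w x‖ₑ ^ 2
      ≤ (k : ℝ≥0∞)⁻¹ * 2 * A * ENNReal.ofReal δ * (∫⁻ x, ‖w x‖ₑ ^ 2 ∂(surfaceMeasure Ω))
        + 2 * A ^ 2 * ENNReal.ofReal δ ^ 2
          * (∫⁻ x in layer Ω (2 * T), ‖gradient w x‖ₑ ^ 2) := by
    have e : ∀ X : ℝ≥0∞, X = (k : ℝ≥0∞)⁻¹ * (k * X) := fun X => by
      rw [← mul_assoc, ENNReal.inv_mul_cancel hk0' (by simp), one_mul]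
    rw [e (∫⁻ x in layer Ω δ ∩ Metric.ball x₀ (c.r / 4), ‖w x‖ₑ ^ 2)]
    refine (mul_le_mul_right h6 _).trans (le_of_eq ?_)
    rw [hTe, mul_add]
    conv_rhs => rw [e (∫⁻ x in layer Ω (2 * T), ‖gradient w x‖ₑ ^ 2)]
    ring
  refine h7.trans ?_
  have hkc : ((k⁻¹ : ℝ≥0) : ℝ≥0∞) = (k : ℝ≥0∞)⁻¹ := ENNReal.coe_inv hk0
  push_cast [hkc]
  gcongr ?_ * _ * _ + ?_ * _ * ?_
  · exact le_add_right (le_add_left le_rfl)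
  · exact le_add_left le_rfl
  · refine lintegral_mono_set (layer_mono ?_)
    rw [hTdef, ← mul_assoc]
    gcongr
    have : (0 : ℝ) ≤ k := k.2
    have : (0 : ℝ) ≤ (k : ℝ)⁻¹ * 2 * A + 2 * A ^ 2 := by positivity
    linarith

/-- Local version of the trace inequality. -/
theorem lintegral_surface_le_norm (hN : 2 ≤ N) (hΩ : IsOpen Ω) : ∃ C : ℝ≥0,
    ∀ w : E N → ℝ, ContDiff ℝ ∞ w →
    ∫⁻ x in Metric.ball x₀ (c.r / 2), ‖w x‖ₑ ^ 2 ∂(surfaceMeasure Ω)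
      ≤ C * ((∫⁻ x in Ω, ‖w x‖ₑ ^ 2) + ∫⁻ x in Ω, ‖gradient w x‖ₑ ^ 2) := by
  obtain ⟨k, hk0, hk⟩ := c.exists_volume
  have hr := c.r_pos
  have hd : (0 : ℝ) ≤ (N : ℝ) - 1 := by
    have : (2 : ℝ) ≤ N := by exact_mod_cast hN
    linarith
  set B : ℝ≥0 := (1 + c.K) ^ ((N : ℝ) - 1) with hB
  have hB' : ((1 + c.K : ℝ≥0) : ℝ≥0∞) ^ ((N : ℝ) - 1) = B := by
    rw [hB, ENNReal.coe_rpow_of_nonneg _ hd]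
  set T : ℝ≥0 := ⟨c.r / 4, by positivity⟩ with hTdef
  have hTR : (T : ℝ) = c.r / 4 := rfl
  have hT0 : (0 : ℝ) < T := by rw [hTR]; positivity
  have hT0' : (T : ℝ≥0∞) ≠ 0 := by
    have : T ≠ 0 := by intro h; rw [h] at hT0; simp at hT0
    simpa using this
  have hTe : ENNReal.ofReal (T : ℝ) = T := ENNReal.ofReal_coe_nnreal
  refine ⟨B * T⁻¹ * (2 + 2 * T ^ 2) * k, fun w hw => ?_⟩
  have hmw : Measurable (fun x => ‖w x‖ₑ ^ 2) := (hw.continuous.measurable.enorm).pow_const 2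
  have hmg : Measurable (fun x => ‖gradient w x‖ₑ ^ 2) :=
    ((continuous_gradient_of_contDiff hw).measurable.enorm).pow_const 2
  have h1 := c.lintegral_surface_le hN hΩ hmw
  have h2 := c.lintegral_collar_le hΩ hk hmg hTR.le
  have h3 := c.lintegral_collar_le hΩ hk hmw hTR.le
  have hm0 : Measurable fun y => ‖w (c.pt y 0)‖ₑ ^ 2 :=
    hmw.comp c.lipschitz_pt_zero.continuous.measurable
  have h4 : (T : ℝ≥0∞) * ∫⁻ y in c.base, ‖w (c.pt y 0)‖ₑ ^ 2 ∂c.horiz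
      ≤ 2 * (∫⁻ y in c.base, (∫⁻ t in Set.Ioc 0 (T : ℝ), ‖w (c.pt y t)‖ₑ ^ 2) ∂c.horiz)
        + 2 * T ^ 2 *
          ∫⁻ y in c.base, (∫⁻ t in Set.Ioc 0 (T : ℝ), ‖gradient w (c.pt y t)‖ₑ ^ 2) ∂c.horiz := by
    have := c.isAddHaarMeasure_horiz
    have hmm : Measurable fun y => ∫⁻ t in Set.Ioc 0 (T : ℝ), ‖w (c.pt y t)‖ₑ ^ 2 :=
      Measurable.lintegral_prod_right (f := fun y t => ‖w (c.pt y t)‖ₑ ^ 2)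
        (hmw.comp c.continuous_pt.measurable)
    rw [← lintegral_const_mul _ hm0, ← lintegral_const_mul _ hmm,
      ← lintegral_const_mul' _ _ (by finiteness), ← lintegral_add_left (hmm.const_mul _)]
    refine lintegral_mono fun y => ?_
    have : ∀ t ∈ Set.Ioc 0 (T : ℝ), ‖w (c.pt y 0)‖ₑ ^ 2 ≤ 2 * ‖w (c.pt y t)‖ₑ ^ 2
      + 2 * (ENNReal.ofReal T * ∫⁻ σ in Set.Ioc 0 (T : ℝ), ‖gradient w (c.pt y σ)‖ₑ ^ 2) :=
      fun t ht => c.enorm_sq_pt_le hw y ⟨ht.1.le, ht.2⟩ ⟨le_rfl, hT0.le⟩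
    have h5 := setLIntegral_mono' (μ := volume) measurableSet_Ioc this
    rw [setLIntegral_const, Real.volume_Ioc, sub_zero, lintegral_add_right _ measurable_const,
      lintegral_const_mul' _ _ (by finiteness), setLIntegral_const, Real.volume_Ioc,
      sub_zero, hTe] at h5
    calc (T : ℝ≥0∞) * ‖w (c.pt y 0)‖ₑ ^ 2 = ‖w (c.pt y 0)‖ₑ ^ 2 * T := mul_comm _ _
      _ ≤ _ := h5
      _ = _ := by ring
  have hsub : ∀ g : E N → ℝ≥0∞, ∫⁻ x in layer Ω (2 * T), g x ≤ ∫⁻ x in Ω, g x :=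
    fun g => lintegral_mono_set (layer_subset _)
  have h6 : (T : ℝ≥0∞) * ∫⁻ y in c.base, ‖w (c.pt y 0)‖ₑ ^ 2 ∂c.horiz
      ≤ (2 + 2 * T ^ 2) * k * ((∫⁻ x in Ω, ‖w x‖ₑ ^ 2) + ∫⁻ x in Ω, ‖gradient w x‖ₑ ^ 2) := by
    calc _ ≤ _ := h4
      _ ≤ 2 * (k * ∫⁻ x in Ω, ‖w x‖ₑ ^ 2) + 2 * T ^ 2 *
          (k * ∫⁻ x in Ω, ‖gradient w x‖ₑ ^ 2) := by
        gcongr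
        · exact h3.trans (mul_le_mul_right (hsub _) _)
        · exact h2.trans (mul_le_mul_right (hsub _) _)
      _ ≤ (2 + 2 * T ^ 2) * (k * ∫⁻ x in Ω, ‖w x‖ₑ ^ 2) + (2 + 2 * T ^ 2) *
          (k * ∫⁻ x in Ω, ‖gradient w x‖ₑ ^ 2) := by
        gcongr
        · exact le_add_right le_rfl
        · exact le_add_left le_rfl
      _ = _ := by ring
  refine h1.trans ?_
  rw [hB']
  have e : ∀ X : ℝ≥0∞, X = (T : ℝ≥0∞)⁻¹ * (T * X) := fun X => by
    rw [← mul_assoc, ENNReal.inv_mul_cancel hT0' (by simp), one_mul]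
  rw [e (∫⁻ y in c.base, ‖w (c.pt y 0)‖ₑ ^ 2 ∂c.horiz)]
  have hTc : ((T⁻¹ : ℝ≥0) : ℝ≥0∞) = (T : ℝ≥0∞)⁻¹ := ENNReal.coe_inv (by simpa using hT0')
  push_cast [hTc]
  refine (mul_le_mul_right (mul_le_mul_right h6 _) _).trans (le_of_eq ?_)
  ring

end LipChart

theorem isCompact_frontier (hΩ : IsRegularDomain Ω) : IsCompact (frontier Ω) :=
  Metric.isCompact_of_isClosed_isBounded isClosed_frontier
    (hΩ.isBounded.closure.subset frontier_subset_closure)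

/-- Boundary layer estimate: the `L²` norm on the layer of width `δ`. -/
theorem exists_lintegral_layer_le (hN : 2 ≤ N) (hΩ : IsRegularDomain Ω) :
    ∃ C : ℝ≥0, ∃ δ₀ > 0, ∀ δ, 0 < δ → δ < δ₀ → ∀ w : E N → ℝ, ContDiff ℝ ∞ w →
    ∫⁻ x in layer Ω δ, ‖w x‖ₑ ^ 2
      ≤ C * ENNReal.ofReal δ * ∫⁻ x, ‖w x‖ₑ ^ 2 ∂(surfaceMeasure Ω)
        + C * ENNReal.ofReal δ ^ 2 * ∫⁻ x in layer Ω (C * δ), ‖gradient w x‖ₑ ^ 2 := by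
  have key : ∃ U : Set (E N), IsOpen U ∧ frontier Ω ⊆ U ∧ ∃ C : ℝ≥0, ∃ δ₀ > 0, ∀ δ, 0 < δ → δ < δ₀ →
    ∀ w : E N → ℝ, ContDiff ℝ ∞ w → ∫⁻ x in layer Ω δ ∩ U, ‖w x‖ₑ ^ 2
      ≤ C * ENNReal.ofReal δ * ∫⁻ x, ‖w x‖ₑ ^ 2 ∂(surfaceMeasure Ω)
        + C * ENNReal.ofReal δ ^ 2 * ∫⁻ x in layer Ω (C * δ), ‖gradient w x‖ₑ ^ 2 := by
    refine (isCompact_frontier hΩ).induction_on (p := fun s => ∃ U : Set (E N), IsOpen U ∧ s ⊆ U ∧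
      ∃ C : ℝ≥0, ∃ δ₀ > 0, ∀ δ, 0 < δ → δ < δ₀ →
      ∀ w : E N → ℝ, ContDiff ℝ ∞ w → ∫⁻ x in layer Ω δ ∩ U, ‖w x‖ₑ ^ 2
        ≤ C * ENNReal.ofReal δ * ∫⁻ x, ‖w x‖ₑ ^ 2 ∂(surfaceMeasure Ω)
          + C * ENNReal.ofReal δ ^ 2 * ∫⁻ x in layer Ω (C * δ), ‖gradient w x‖ₑ ^ 2) ?_ ?_ ?_ ?_
    · exact ⟨∅, isOpen_empty, le_rfl, 0, 1, one_pos, fun δ _ _ w _ => by simp⟩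
    · rintro s t hst ⟨U, hU, htU, h⟩
      exact ⟨U, hU, hst.trans htU, h⟩
    · rintro s t ⟨U, hU, hsU, C, δ₀, hδ₀, h⟩ ⟨V, hV, htV, D, ε₀, hε₀, h'⟩
      refine ⟨U ∪ V, hU.union hV, Set.union_subset_union hsU htV, C + D, min δ₀ ε₀,
        lt_min hδ₀ hε₀, fun δ hδ hδ' w hw => ?_⟩
      rw [Set.inter_union_distrib_left]
      refine (lintegral_union_le _ _ _).trans ((add_le_add
        (h δ hδ (hδ'.trans_le (min_le_left _ _)) w hw)
        (h' δ hδ (hδ'.trans_le (min_le_right _ _)) w hw)).trans ?_)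
      have e1 : ∫⁻ x in layer Ω (C * δ), ‖gradient w x‖ₑ ^ 2
          ≤ ∫⁻ x in layer Ω ((C + D : ℝ≥0) * δ), ‖gradient w x‖ₑ ^ 2 :=
        lintegral_mono_set (layer_mono (by gcongr; exact le_self_add))
      have e2 : ∫⁻ x in layer Ω (D * δ), ‖gradient w x‖ₑ ^ 2
          ≤ ∫⁻ x in layer Ω ((C + D : ℝ≥0) * δ), ‖gradient w x‖ₑ ^ 2 :=
        lintegral_mono_set (layer_mono (by gcongr; exact le_add_self))
      calc _ ≤ C * ENNReal.ofReal δ * ∫⁻ x, ‖w x‖ₑ ^ 2 ∂(surfaceMeasure Ω)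
          + C * ENNReal.ofReal δ ^ 2 *
              (∫⁻ x in layer Ω ((C + D : ℝ≥0) * δ), ‖gradient w x‖ₑ ^ 2)
          + (D * ENNReal.ofReal δ * ∫⁻ x, ‖w x‖ₑ ^ 2 ∂(surfaceMeasure Ω)
          + D * ENNReal.ofReal δ ^ 2 *
              (∫⁻ x in layer Ω ((C + D : ℝ≥0) * δ), ‖gradient w x‖ₑ ^ 2)) := by gcongr
        _ = _ := by push_cast; ring
    · intro x hx
      obtain ⟨c⟩ := hΩ.lipschitzBoundary.nonempty_lipChart hx
      have hr : 0 < c.r / 4 := by have := c.r_pos; positivity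
      obtain ⟨C, δ₀, hδ₀, h⟩ := c.lintegral_layer_le hN hΩ.isOpen
      exact ⟨Metric.ball x (c.r / 4), mem_nhdsWithin_of_mem_nhds (Metric.ball_mem_nhds x hr),
        Metric.ball x (c.r / 4), Metric.isOpen_ball, le_rfl, C, δ₀, hδ₀, h⟩
  obtain ⟨U, hU, hsub, C, δ₀, hδ₀, h⟩ := key
  have hcomp : IsCompact (closure Ω \ U) := hΩ.isBounded.isCompact_closure.diff hU
  have hsub' : closure Ω \ U ⊆ Ω := by
    rintro x ⟨hx1, hx2⟩
    by_contra hx3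
    exact hx2 (hsub (by rw [hΩ.isOpen.frontier_eq]; exact ⟨hx1, hx3⟩))
  obtain ⟨ε, hε, hε'⟩ := hcomp.exists_thickening_subset_open hΩ.isOpen hsub'
  refine ⟨C, min δ₀ ε, lt_min hδ₀ hε, fun δ hδ hδ' w hw => ?_⟩
  have hl : layer Ω δ ⊆ U := by
    rintro x ⟨hx1, hx2⟩
    by_contra hx3
    obtain ⟨z, hz, hxz⟩ := Metric.mem_thickening_iff.1 hx2
    refine hz (hε' (Metric.mem_thickening_iff.2 ⟨x, ⟨subset_closure hx1, hx3⟩, ?_⟩))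
    rw [dist_comm]
    exact hxz.trans (hδ'.trans_le (min_le_right _ _))
  have := h δ hδ (hδ'.trans_le (min_le_left _ _)) w hw
  rwa [Set.inter_eq_left.2 hl] at this

/-- Trace inequality for smooth functions. -/
theorem exists_lintegral_surface_le (hN : 2 ≤ N) (hΩ : IsRegularDomain Ω) :
    ∃ C : ℝ≥0, ∀ w : E N → ℝ, ContDiff ℝ ∞ w → ∫⁻ x, ‖w x‖ₑ ^ 2 ∂(surfaceMeasure Ω)
      ≤ C * ((∫⁻ x in Ω, ‖w x‖ₑ ^ 2) + ∫⁻ x in Ω, ‖gradient w x‖ₑ ^ 2) := by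
  have key : ∃ C : ℝ≥0, ∀ w : E N → ℝ, ContDiff ℝ ∞ w →
      ∫⁻ x in frontier Ω, ‖w x‖ₑ ^ 2 ∂(surfaceMeasure Ω)
      ≤ C * ((∫⁻ x in Ω, ‖w x‖ₑ ^ 2) + ∫⁻ x in Ω, ‖gradient w x‖ₑ ^ 2) := by
    refine (isCompact_frontier hΩ).induction_on (p := fun s => ∃ C : ℝ≥0,
      ∀ w : E N → ℝ, ContDiff ℝ ∞ w → ∫⁻ x in s, ‖w x‖ₑ ^ 2 ∂(surfaceMeasure Ω)
      ≤ C * ((∫⁻ x in Ω, ‖w x‖ₑ ^ 2) + ∫⁻ x in Ω, ‖gradient w x‖ₑ ^ 2)) ?_ ?_ ?_ ?_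
    · exact ⟨0, fun w _ => by simp⟩
    · rintro s t hst ⟨C, h⟩
      exact ⟨C, fun w hw => (lintegral_mono_set hst).trans (h w hw)⟩
    · rintro s t ⟨C, h⟩ ⟨D, h'⟩
      refine ⟨C + D, fun w hw => ?_⟩
      refine (lintegral_union_le _ _ _).trans ((add_le_add (h w hw) (h' w hw)).trans ?_)
      rw [ENNReal.coe_add, add_mul]
    · intro x hx
      obtain ⟨c⟩ := hΩ.lipschitzBoundary.nonempty_lipChart hx
      have hr : 0 < c.r / 2 := by have := c.r_pos; positivity
      exact ⟨Metric.ball x (c.r / 2), mem_nhdsWithin_of_mem_nhds (Metric.ball_mem_nhds x hr),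
        c.lintegral_surface_le_norm hN hΩ.isOpen⟩
  obtain ⟨C, h⟩ := key
  refine ⟨C, fun w hw => ?_⟩
  have := h w hw
  rwa [surfaceMeasure, Measure.restrict_restrict isClosed_frontier.measurableSet,
    Set.inter_self] at this

end Geometry

section Trace

variable {N : ℕ} {Ω : Set (E N)}

theorem HasTrace.exists_seq {u : H1 Ω} {φ : L2Boundary Ω} (h : HasTrace Ω u φ) :
    ∃ (p : ℕ → H1 Ω) (ψ : ℕ → L2Boundary Ω) (w : ℕ → E N → ℝ), (∀ n, ContDiff ℝ ∞ (w n)) ∧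
      (∀ n, H1fun (p n) =ᵐ[volume.restrict Ω] w n) ∧
      (∀ n, H1grad (p n) =ᵐ[volume.restrict Ω] gradient (w n)) ∧
      (∀ n, ψ n =ᵐ[surfaceMeasure Ω] w n) ∧ Tendsto p atTop (𝓝 u) ∧ Tendsto ψ atTop (𝓝 φ) := by
  obtain ⟨x, hx, hlim⟩ := mem_closure_iff_seq_limit.1 h
  choose w hw using hx
  rw [nhds_prod_eq] at hlim
  exact ⟨fun n => (x n).1, fun n => (x n).2, w, fun n => (hw n).1, fun n => (hw n).2.1,
    fun n => (hw n).2.2.1, fun n => (hw n).2.2.2, tendsto_fst.comp hlim, tendsto_snd.comp hlim⟩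

theorem HasTrace.of_contDiff {u : H1 Ω} {φ : L2Boundary Ω} {w : E N → ℝ} (hw : ContDiff ℝ ∞ w)
    (h1 : H1fun u =ᵐ[volume.restrict Ω] w) (h2 : H1grad u =ᵐ[volume.restrict Ω] gradient w)
    (h3 : φ =ᵐ[surfaceMeasure Ω] w) : HasTrace Ω u φ :=
  subset_closure ⟨w, hw, h1, h2, h3⟩

theorem HasTrace.of_tendsto {ι : Type*} {l : Filter ι} [l.NeBot] {u : ι → H1 Ω} {v : H1 Ω}
    {φ : ι → L2Boundary Ω} {ψ : L2Boundary Ω} (hu : Tendsto u l (𝓝 v)) (hφ : Tendsto φ l (𝓝 ψ))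
    (h : ∀ n, HasTrace Ω (u n) (φ n)) : HasTrace Ω v ψ :=
  isClosed_closure.mem_of_tendsto (hu.prodMk_nhds hφ) (Eventually.of_forall h)

theorem gradient_add_of_contDiff {v w : E N → ℝ} (hv : ContDiff ℝ ∞ v) (hw : ContDiff ℝ ∞ w)
    (x : E N) : gradient (v + w) x = gradient v x + gradient w x := by
  rw [gradient, fderiv_add (hv.differentiable (by simp) x) (hw.differentiable (by simp) x),
    map_add]; rfl

theorem gradient_smul_of_contDiff {v : E N → ℝ} (hv : ContDiff ℝ ∞ v) (a : ℝ)
    (x : E N) : gradient (a • v) x = a • gradient v x := by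
  rw [gradient, fderiv_const_smul (hv.differentiable (by simp) x), map_smul]; rfl

theorem HasTrace.add {u v : H1 Ω} {φ ψ : L2Boundary Ω} (hu : HasTrace Ω u φ)
    (hv : HasTrace Ω v ψ) : HasTrace Ω (u + v) (φ + ψ) := by
  obtain ⟨p, χ, w, a1, a2, a3, a4, a5, a6⟩ := hu.exists_seq
  obtain ⟨p', χ', w', b1, b2, b3, b4, b5, b6⟩ := hv.exists_seq
  refine HasTrace.of_tendsto (a5.add b5) (a6.add b6) fun n => ?_
  refine HasTrace.of_contDiff ((a1 n).add (b1 n)) ?_ ?_ ?_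
  · filter_upwards [a2 n, b2 n, Lp.coeFn_add (H1fun (p n)) (H1fun (p' n))] with x h1 h2 h3
    rw [H1fun_add, h3, Pi.add_apply, h1, h2]
  · filter_upwards [a3 n, b3 n, Lp.coeFn_add (H1grad (p n)) (H1grad (p' n))] with x h1 h2 h3
    rw [H1grad_add, h3, Pi.add_apply, h1, h2]
    exact (gradient_add_of_contDiff (a1 n) (b1 n) x).symm
  · filter_upwards [a4 n, b4 n, Lp.coeFn_add (χ n) (χ' n)] with x h1 h2 h3
    rw [h3, Pi.add_apply, h1, h2]

theorem HasTrace.smul {u : H1 Ω} {φ : L2Boundary Ω} (hu : HasTrace Ω u φ) (c : ℝ) :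
    HasTrace Ω (c • u) (c • φ) := by
  obtain ⟨p, χ, w, a1, a2, a3, a4, a5, a6⟩ := hu.exists_seq
  refine HasTrace.of_tendsto (a5.const_smul c) (a6.const_smul c) fun n => ?_
  refine HasTrace.of_contDiff (w := c • w n) ((a1 n).const_smul c) ?_ ?_ ?_
  · filter_upwards [a2 n, Lp.coeFn_smul c (H1fun (p n))] with x h1 h3
    rw [H1fun_smul, h3, Pi.smul_apply, Pi.smul_apply, h1]
  · filter_upwards [a3 n, Lp.coeFn_smul c (H1grad (p n))] with x h1 h3
    rw [H1grad_smul, h3, Pi.smul_apply, h1, gradient_smul_of_contDiff (a1 n)]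
  · filter_upwards [a4 n, Lp.coeFn_smul c (χ n)] with x h1 h3
    rw [h3, Pi.smul_apply, Pi.smul_apply, h1]

theorem HasTrace.sub {u v : H1 Ω} {φ ψ : L2Boundary Ω} (hu : HasTrace Ω u φ)
    (hv : HasTrace Ω v ψ) : HasTrace Ω (u - v) (φ - ψ) := by
  have := hu.add (hv.smul (-1))
  simpa [sub_eq_add_neg] using this

theorem HasTrace.zero : HasTrace Ω (0 : H1 Ω) 0 := by
  refine HasTrace.of_contDiff (w := 0) contDiff_const ?_ ?_ ?_
  · exact Lp.coeFn_zero ℝ 2 (volume.restrict Ω)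
  · filter_upwards [Lp.coeFn_zero (E N) 2 (volume.restrict Ω)] with x hx
    have : H1grad (0 : H1 Ω) x = 0 := hx
    rw [this]
    simp [gradient]
  · exact Lp.coeFn_zero ℝ 2 (surfaceMeasure Ω)

theorem HasTrace.sum {ι : Type*} (s : Finset ι) {u : ι → H1 Ω} {φ : ι → L2Boundary Ω}
    (h : ∀ i ∈ s, HasTrace Ω (u i) (φ i)) : HasTrace Ω (∑ i ∈ s, u i) (∑ i ∈ s, φ i) := by
  classical
  induction s using Finset.induction_on with
  | empty => simpa using HasTrace.zero
  | insert a s ha ih =>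
    rw [Finset.sum_insert ha, Finset.sum_insert ha]
    exact (h a (Finset.mem_insert_self _ _)).add
      (ih fun i hi => h i (Finset.mem_insert_of_mem hi))

theorem isFiniteMeasure_restrict (hb : Bornology.IsBounded Ω) :
    IsFiniteMeasure ((volume : Measure (E N)).restrict Ω) :=
  ⟨by simpa using hb.measure_lt_top⟩

theorem isFiniteMeasure_surface (hN : 2 ≤ N) (hΩ : IsRegularDomain Ω) :
    IsFiniteMeasure (surfaceMeasure Ω) := by
  obtain ⟨C, hC⟩ := exists_lintegral_surface_le hN hΩ
  have h := hC (fun _ => 1) contDiff_const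
  have := isFiniteMeasure_restrict hΩ.isBounded
  refine ⟨lt_of_le_of_lt ?_ (?_ : (C : ℝ≥0∞) * ((∫⁻ x in Ω, ‖(1 : ℝ)‖ₑ ^ 2) +
    ∫⁻ x in Ω, ‖gradient (fun _ : E N => (1 : ℝ)) x‖ₑ ^ 2) < ⊤)⟩
  · simpa using h
  · have e : ∀ x : E N, gradient (fun _ : E N => (1 : ℝ)) x = 0 := fun x => by simp [gradient]
    simp only [e]
    simp
    exact ENNReal.mul_lt_top ENNReal.coe_lt_top hΩ.isBounded.measure_lt_top

/-- The trace inequality. -/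
theorem exists_norm_trace_le (hN : 2 ≤ N) (hΩ : IsRegularDomain Ω) :
    ∃ C : ℝ, ∀ (u : H1 Ω) (φ : L2Boundary Ω), HasTrace Ω u φ → ‖φ‖ ≤ C * ‖u‖ := by
  obtain ⟨C, hC⟩ := exists_lintegral_surface_le hN hΩ
  refine ⟨Real.sqrt C, fun u φ h => ?_⟩
  obtain ⟨p, ψ, w, a1, a2, a3, a4, a5, a6⟩ := h.exists_seq
  refine le_of_tendsto_of_tendsto' a6.norm (a5.norm.const_mul _) fun n => ?_
  have h1 := hC (w n) (a1 n)
  have e1 : ∫⁻ x, ‖w n x‖ₑ ^ 2 ∂(surfaceMeasure Ω) = ‖ψ n‖ₑ ^ 2 := by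
    rw [Lp_enorm_sq]
    refine lintegral_congr_ae ?_
    filter_upwards [a4 n] with x hx
    rw [hx]
  have e2 : ∫⁻ x in Ω, ‖w n x‖ₑ ^ 2 = ‖H1fun (p n)‖ₑ ^ 2 := by
    rw [Lp_enorm_sq]
    refine lintegral_congr_ae ?_
    filter_upwards [a2 n] with x hx
    rw [hx]
  have e3 : ∫⁻ x in Ω, ‖gradient (w n) x‖ₑ ^ 2 = ‖H1grad (p n)‖ₑ ^ 2 := by
    rw [Lp_enorm_sq]
    refine lintegral_congr_ae ?_
    filter_upwards [a3 n] with x hx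
    rw [hx]
  rw [e1, e2, e3] at h1
  have h2 := ENNReal.toReal_mono (by finiteness) h1
  rw [ENNReal.toReal_mul, ENNReal.toReal_add (by finiteness) (by finiteness)] at h2
  simp only [ENNReal.toReal_pow, toReal_enorm, ENNReal.coe_toReal] at h2
  rw [← H1_norm_sq] at h2
  refine le_of_sq_le_sq ?_ (by positivity)
  rwa [mul_pow, Real.sq_sqrt C.coe_nonneg]

theorem tendsto_Lp_of_dominated {α F : Type*} [MeasurableSpace α] {μ : Measure α}
    [NormedAddCommGroup F] [InnerProductSpace ℝ F] {f : ℕ → Lp F 2 μ} {g : Lp F 2 μ} {b : α → ℝ}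
    (hb : MemLp b 2 μ) (hfb : ∀ n, ∀ᵐ x ∂μ, ‖f n x‖ ≤ b x)
    (hlim : ∀ᵐ x ∂μ, Tendsto (fun n => f n x) atTop (𝓝 (g x))) :
    Tendsto f atTop (𝓝 g) := by
  rw [tendsto_iff_norm_sub_tendsto_zero]
  have h1 : Tendsto (fun n => ∫ x, ‖f n x - g x‖ ^ 2 ∂μ) atTop (𝓝 (∫ _, (0 : ℝ) ∂μ)) := by
    refine tendsto_integral_of_dominated_convergence (fun x => (b x + ‖g x‖) ^ 2) ?_ ?_ ?_ ?_
    · intro n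
      exact (((Lp.aestronglyMeasurable _).sub (Lp.aestronglyMeasurable _)).norm.pow 2)
    · exact (hb.add (Lp.memLp g).norm).integrable_sq
    · intro n
      filter_upwards [hfb n] with x hx
      rw [Real.norm_of_nonneg (by positivity)]
      gcongr
      exact (norm_sub_le _ _).trans (by gcongr)
    · filter_upwards [hlim] with x hx
      have := ((tendsto_iff_norm_sub_tendsto_zero.1 hx).pow 2)
      simpa using this
  have h2 : ∀ n, ‖f n - g‖ = Real.sqrt (∫ x, ‖f n x - g x‖ ^ 2 ∂μ) := by
    intro n
    rw [← Real.sqrt_sq (norm_nonneg (f n - g)), Lp_norm_sq]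
    congr 1
    refine integral_congr_ae ?_
    filter_upwards [Lp.coeFn_sub (f n) g] with x hx
    rw [hx, Pi.sub_apply]
  simp only [h2]
  have h3 := (Real.continuous_sqrt.tendsto _).comp h1
  simpa [Function.comp_def] using h3

theorem tendsto_Lp_smul {α F : Type*} [MeasurableSpace α] {μ : Measure α}
    [NormedAddCommGroup F] [InnerProductSpace ℝ F] {G : ℕ → Lp F 2 μ} {H : Lp F 2 μ}
    {A : ℕ → Lp F 2 μ} {B : Lp F 2 μ} {c : ℕ → α → ℝ} {d : α → ℝ}
    (hG : Tendsto G atTop (𝓝 H)) (hA : ∀ n, A n =ᵐ[μ] fun x => c n x • G n x)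
    (hB : B =ᵐ[μ] fun x => d x • H x) (hc : ∀ n, AEStronglyMeasurable (c n) μ)
    (hc1 : ∀ n x, |c n x| ≤ 1)
    (hlim : ∀ᵐ x ∂μ, Tendsto (fun n => c n x • H x) atTop (𝓝 (d x • H x))) :
    Tendsto A atTop (𝓝 B) := by
  have hle : ∀ n, ∀ᵐ x ∂μ, ‖c n x • H x‖ ≤ ‖H x‖ := fun n => Eventually.of_forall fun x => by
    rw [norm_smul]; exact mul_le_of_le_one_left (norm_nonneg _) (hc1 n x)
  have hm : ∀ n, MemLp (fun x => c n x • H x) 2 μ := fun n =>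
    (Lp.memLp H).of_le ((hc n).smul (Lp.aestronglyMeasurable H)) (hle n)
  have h1 : Tendsto (fun n => (hm n).toLp) atTop (𝓝 B) := by
    refine tendsto_Lp_of_dominated (Lp.memLp H).norm (fun n => ?_) ?_
    · filter_upwards [(hm n).coeFn_toLp, hle n] with x h1 h2
      rwa [h1]
    · filter_upwards [ae_all_iff.2 fun n => (hm n).coeFn_toLp, hB, hlim] with x h1 h2 h3
      simpa only [h1, h2] using h3
  have h2 : Tendsto (fun n => A n - (hm n).toLp) atTop (𝓝 0) := by
    rw [tendsto_zero_iff_norm_tendsto_zero]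
    refine squeeze_zero (fun n => norm_nonneg _) (fun n => ?_)
      (tendsto_iff_norm_sub_tendsto_zero.1 hG)
    refine Lp.norm_le_norm_of_ae_le ?_
    filter_upwards [Lp.coeFn_sub (A n) (hm n).toLp, (hm n).coeFn_toLp, hA n,
      Lp.coeFn_sub (G n) H] with x e1 e2 e3 e4
    rw [e1, Pi.sub_apply, e2, e3, e4, Pi.sub_apply, ← smul_sub, norm_smul]
    exact mul_le_of_le_one_left (norm_nonneg _) (hc1 n x)
  simpa using h2.add h1

theorem exists_subseq_tendsto_ae {α F : Type*} [MeasurableSpace α] {μ : Measure α}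
    [NormedAddCommGroup F] {f : ℕ → Lp F 2 μ} {g : Lp F 2 μ} (h : Tendsto f atTop (𝓝 g)) :
    ∃ σ : ℕ → ℕ, StrictMono σ ∧ ∀ᵐ x ∂μ, Tendsto (fun n => f (σ n) x) atTop (𝓝 (g x)) :=
  (tendstoInMeasure_of_tendsto_Lp h).exists_seq_tendsto_ae

theorem exists_H1_of_tendsto {v : ℕ → H1 Ω} {f : Lp ℝ 2 (volume.restrict Ω)}
    {g : Lp (E N) 2 (volume.restrict Ω)} (hf : Tendsto (fun n => H1fun (v n)) atTop (𝓝 f))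
    (hg : Tendsto (fun n => H1grad (v n)) atTop (𝓝 g)) :
    ∃ u : H1 Ω, H1fun u = f ∧ H1grad u = g ∧ Tendsto v atTop (𝓝 u) := by
  have h : Tendsto (fun n => ((v n : H1 Ω) : L2Pair Ω)) atTop (𝓝 (WithLp.toLp 2 (f, g))) :=
    ((WithLp.prod_continuous_toLp 2 _ _).tendsto (f, g)).comp (hf.prodMk_nhds hg)
  have hmem : (WithLp.toLp 2 (f, g) : L2Pair Ω) ∈ H1 Ω :=
    (isClosed_H1 Ω).mem_of_tendsto h (Eventually.of_forall fun n => (v n).2)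
  exact ⟨⟨_, hmem⟩, rfl, rfl, H1_tendsto_iff.2 ⟨hf, hg⟩⟩

theorem abs_le_of_deriv_le_one {β : ℝ → ℝ} (hβ : ContDiff ℝ ∞ β) (hβ' : ∀ t, |deriv β t| ≤ 1)
    (s t : ℝ) : |β s - β t| ≤ |s - t| := by
  have := Convex.norm_image_sub_le_of_norm_deriv_le (f := β) (C := 1) (s := Set.univ) (x := t)
    (y := s) (fun x _ => hβ.differentiable (by simp) x) (fun x _ => hβ' x) convex_univ
    trivial trivial
  simpa using this

theorem memLp_comp_of_abs_le {α : Type*} [MeasurableSpace α] {μ : Measure α} [IsFiniteMeasure μ]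
    {β : ℝ → ℝ} {C : ℝ} (hβ : Measurable β) (hC : ∀ t, |β t| ≤ C + |t|) (u : Lp ℝ 2 μ) :
    MemLp (fun x => β (u x)) 2 μ := by
  refine MemLp.of_le ((memLp_const (μ := μ) (p := 2) C).add (Lp.memLp u).norm)
    (hβ.comp_aemeasurable (Lp.aestronglyMeasurable u).aemeasurable).aestronglyMeasurable
    (Eventually.of_forall fun x => ?_)
  exact (hC _).trans (le_abs_self _)

theorem memLp_smul_of_abs_le_one {α F : Type*} [MeasurableSpace α] {μ : Measure α}
    [NormedAddCommGroup F] [NormedSpace ℝ F]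
    {b : ℝ → ℝ} (hb : Measurable b) (hC : ∀ t, |b t| ≤ 1) (u : Lp ℝ 2 μ) (G : Lp F 2 μ) :
    MemLp (fun x => b (u x) • G x) 2 μ := by
  refine MemLp.of_le (Lp.memLp G) ((hb.comp_aemeasurable
    (Lp.aestronglyMeasurable u).aemeasurable).aestronglyMeasurable.smul
    (Lp.aestronglyMeasurable G)) (Eventually.of_forall fun x => ?_)
  rw [norm_smul]
  exact mul_le_of_le_one_left (norm_nonneg _) (hC _)

theorem gradient_comp {β : ℝ → ℝ} {w : E N → ℝ} (hβ : ContDiff ℝ ∞ β) (hw : ContDiff ℝ ∞ w)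
    (x : E N) : gradient (β ∘ w) x = deriv β (w x) • gradient w x := by
  have h1 : HasFDerivAt (β ∘ w) (deriv β (w x) • fderiv ℝ w x) x :=
    ((hβ.differentiable (by simp) (w x)).hasDerivAt).comp_hasFDerivAt x
      ((hw.differentiable (by simp) x).hasFDerivAt)
  rw [gradient, h1.fderiv, map_smul]; rfl

/-- Chain rule for smooth functions with derivative bounded by `1`. -/
theorem HasTrace.comp_smooth (hN : 2 ≤ N) (hΩ : IsRegularDomain Ω) {u : H1 Ω} {φ : L2Boundary Ω}
    (h : HasTrace Ω u φ) {β : ℝ → ℝ} (hβ : ContDiff ℝ ∞ β) (hβ' : ∀ t, |deriv β t| ≤ 1) :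
    ∃ (v : H1 Ω) (ψ : L2Boundary Ω), HasTrace Ω v ψ ∧
      (H1fun v =ᵐ[volume.restrict Ω] fun x => β (H1fun u x)) ∧
      (H1grad v =ᵐ[volume.restrict Ω] fun x => deriv β (H1fun u x) • H1grad u x) ∧
      (ψ =ᵐ[surfaceMeasure Ω] fun x => β (φ x)) := by
  have := isFiniteMeasure_restrict hΩ.isBounded
  have := isFiniteMeasure_surface hN hΩ
  obtain ⟨p, χ, w, a1, a2, a3, a4, a5, a6⟩ := h.exists_seq
  obtain ⟨σ, hσ, hae⟩ := exists_subseq_tendsto_ae ((continuous_H1fun.tendsto u).comp a5)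
  have hbd : ∀ t, |β t| ≤ |β 0| + |t| := fun t => by
    have h1 := abs_le_of_deriv_le_one hβ hβ' t 0
    rw [sub_zero] at h1
    have h2 := abs_add_le (β 0) (β t - β 0)
    rw [add_sub_cancel] at h2
    linarith
  have hβm := hβ.continuous.measurable
  have hdm : Measurable (deriv β) := (hβ.continuous_deriv (by simp)).measurable
  have m1 := memLp_comp_of_abs_le hβm hbd (H1fun u)
  have m2 := memLp_smul_of_abs_le_one hdm hβ' (H1fun u) (H1grad u)
  have m3 := memLp_comp_of_abs_le hβm hbd φ
  have m4 := fun n => memLp_comp_of_abs_le hβm hbd (χ n)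
  choose v hv1 hv2 using fun n => exists_H1_of_contDiff hΩ.isBounded (hβ.comp (a1 n))
  have l1 : Tendsto (fun n => H1fun (v (σ n))) atTop (𝓝 m1.toLp) := by
    rw [tendsto_iff_norm_sub_tendsto_zero]
    refine squeeze_zero (fun n => norm_nonneg _) (fun n => ?_) (tendsto_iff_norm_sub_tendsto_zero.1
      (((continuous_H1fun.tendsto u).comp a5).comp hσ.tendsto_atTop))
    refine Lp.norm_le_norm_of_ae_le ?_
    filter_upwards [Lp.coeFn_sub (H1fun (v (σ n))) m1.toLp, m1.coeFn_toLp, hv1 (σ n), a2 (σ n),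
      Lp.coeFn_sub (H1fun (p (σ n))) (H1fun u)] with x e1 e2 e3 e4 e5
    simp only [Function.comp_apply]
    rw [e1, Pi.sub_apply, e2, e3, e5, Pi.sub_apply, e4]
    exact abs_le_of_deriv_le_one hβ hβ' _ _
  have l2 : Tendsto (fun n => H1grad (v (σ n))) atTop (𝓝 m2.toLp) := by
    refine tendsto_Lp_smul (c := fun n x => deriv β (H1fun (p (σ n)) x))
      (((continuous_H1grad.tendsto u).comp a5).comp hσ.tendsto_atTop) (fun n => ?_)
      m2.coeFn_toLp (fun n => ?_) (fun n x => hβ' _) ?_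
    · filter_upwards [hv2 (σ n), a2 (σ n), a3 (σ n)] with x e1 e2 e3
      simp only [Function.comp_apply]
      rw [e1, gradient_comp hβ (a1 _), e2, e3]
    · exact (hdm.comp_aemeasurable (Lp.aestronglyMeasurable _).aemeasurable).aestronglyMeasurable
    · filter_upwards [hae] with x hx
      exact (((hβ.continuous_deriv (by simp)).tendsto _).comp hx).smul_const _
  have l3 : Tendsto (fun n => (m4 (σ n)).toLp) atTop (𝓝 m3.toLp) := by
    rw [tendsto_iff_norm_sub_tendsto_zero]
    refine squeeze_zero (fun n => norm_nonneg _) (fun n => ?_) (tendsto_iff_norm_sub_tendsto_zero.1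
      (a6.comp hσ.tendsto_atTop))
    refine Lp.norm_le_norm_of_ae_le ?_
    filter_upwards [Lp.coeFn_sub (m4 (σ n)).toLp m3.toLp, m3.coeFn_toLp, (m4 (σ n)).coeFn_toLp,
      Lp.coeFn_sub (χ (σ n)) φ] with x e1 e2 e3 e5
    simp only [Function.comp_apply]
    rw [e1, Pi.sub_apply, e2, e3, e5, Pi.sub_apply]
    exact abs_le_of_deriv_le_one hβ hβ' _ _
  obtain ⟨V, hV1, hV2, hV3⟩ := exists_H1_of_tendsto l1 l2
  refine ⟨V, m3.toLp, HasTrace.of_tendsto hV3 l3 fun n => ?_, hV1 ▸ m1.coeFn_toLp,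
    hV2 ▸ m2.coeFn_toLp, m3.coeFn_toLp⟩
  refine HasTrace.of_contDiff (hβ.comp (a1 (σ n))) (hv1 _) (hv2 _) ?_
  filter_upwards [(m4 (σ n)).coeFn_toLp, a4 (σ n)] with x e1 e2
  rw [e1, e2]; rfl

/-- Chain rule for pointwise limits of smooth functions with derivative bounded by `1`. -/
theorem HasTrace.comp_limit (hN : 2 ≤ N) (hΩ : IsRegularDomain Ω) {u : H1 Ω} {φ : L2Boundary Ω}
    (h : HasTrace Ω u φ) {β : ℕ → ℝ → ℝ} {α b : ℝ → ℝ} {C : ℝ} (hβ : ∀ n, ContDiff ℝ ∞ (β n))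
    (hβ' : ∀ n t, |deriv (β n) t| ≤ 1) (hC : ∀ n t, |β n t| ≤ C + |t|)
    (hα : ∀ t, Tendsto (fun n => β n t) atTop (𝓝 (α t)))
    (hb : ∀ t, Tendsto (fun n => deriv (β n) t) atTop (𝓝 (b t))) :
    ∃ (v : H1 Ω) (ψ : L2Boundary Ω), HasTrace Ω v ψ ∧
      (H1fun v =ᵐ[volume.restrict Ω] fun x => α (H1fun u x)) ∧
      (H1grad v =ᵐ[volume.restrict Ω] fun x => b (H1fun u x) • H1grad u x) ∧
      (ψ =ᵐ[surfaceMeasure Ω] fun x => α (φ x)) := by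
  have := isFiniteMeasure_restrict hΩ.isBounded
  have := isFiniteMeasure_surface hN hΩ
  have hαm : Measurable α := measurable_of_tendsto_metrizable (fun n => (hβ n).continuous.measurable)
    (tendsto_pi_nhds.2 hα)
  have hdm : ∀ n, Measurable (deriv (β n)) :=
    fun n => ((hβ n).continuous_deriv (by simp)).measurable
  have hbm : Measurable b := measurable_of_tendsto_metrizable hdm (tendsto_pi_nhds.2 hb)
  have hαC : ∀ t, |α t| ≤ C + |t| := fun t =>
    le_of_tendsto (hα t).abs (Eventually.of_forall fun n => hC n t)
  have hb1 : ∀ t, |b t| ≤ 1 := fun t =>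
    le_of_tendsto (hb t).abs (Eventually.of_forall fun n => hβ' n t)
  have m1 := memLp_comp_of_abs_le hαm hαC (H1fun u)
  have m2 := memLp_smul_of_abs_le_one hbm hb1 (H1fun u) (H1grad u)
  have m3 := memLp_comp_of_abs_le hαm hαC φ
  choose v ψ hv0 hv1 hv2 hv3 using fun n => h.comp_smooth hN hΩ (hβ n) (hβ' n)
  have l1 : Tendsto (fun n => H1fun (v n)) atTop (𝓝 m1.toLp) := by
    refine tendsto_Lp_of_dominated ((memLp_const C).add (Lp.memLp (H1fun u)).norm) (fun n => ?_) ?_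
    · filter_upwards [hv1 n] with x e1
      rw [e1]; exact hC n _
    · filter_upwards [ae_all_iff.2 hv1, m1.coeFn_toLp] with x e1 e2
      simp only [e1, e2]
      exact hα _
  have l2 : Tendsto (fun n => H1grad (v n)) atTop (𝓝 m2.toLp) := by
    refine tendsto_Lp_smul (c := fun n x => deriv (β n) (H1fun u x)) tendsto_const_nhds hv2
      m2.coeFn_toLp (fun n => ?_) (fun n x => hβ' n _) ?_
    · exact ((hdm n).comp_aemeasurable
        (Lp.aestronglyMeasurable _).aemeasurable).aestronglyMeasurable
    · exact Eventually.of_forall fun x => (hb _).smul_const _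
  have l3 : Tendsto ψ atTop (𝓝 m3.toLp) := by
    refine tendsto_Lp_of_dominated ((memLp_const C).add (Lp.memLp φ).norm) (fun n => ?_) ?_
    · filter_upwards [hv3 n] with x e1
      rw [e1]; exact hC n _
    · filter_upwards [ae_all_iff.2 hv3, m3.coeFn_toLp] with x e1 e2
      simp only [e1, e2]
      exact hα _
  obtain ⟨V, hV1, hV2, hV3⟩ := exists_H1_of_tendsto l1 l2
  exact ⟨V, m3.toLp, HasTrace.of_tendsto hV3 l3 hv0, hV1 ▸ m1.coeFn_toLp,
    hV2 ▸ m2.coeFn_toLp, m3.coeFn_toLp⟩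

end Trace

section Abs

variable {N : ℕ} {Ω : Set (E N)}

/-- Smooth approximation of the absolute value. -/
def smoothAbs (a e t : ℝ) : ℝ := Real.sqrt ((t + a) ^ 2 + e ^ 2)

theorem smoothAbs_arg_pos {a e t : ℝ} (he : 0 < e) : 0 < (t + a) ^ 2 + e ^ 2 := by positivity

theorem contDiff_smoothAbs {a e : ℝ} (he : 0 < e) : ContDiff ℝ ∞ (smoothAbs a e) := by
  refine ContDiff.sqrt ?_ fun t => (smoothAbs_arg_pos he).ne'
  fun_prop

theorem deriv_smoothAbs {a e : ℝ} (he : 0 < e) (t : ℝ) :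
    deriv (smoothAbs a e) t = (t + a) / Real.sqrt ((t + a) ^ 2 + e ^ 2) := by
  have h1 : HasDerivAt (fun t : ℝ => (t + a) ^ 2 + e ^ 2) (2 * (t + a)) t := by
    have := (((hasDerivAt_id t).add_const a).pow 2).add_const (e ^ 2)
    simpa using this
  have h2 := h1.sqrt (smoothAbs_arg_pos he).ne'
  have h3 : deriv (smoothAbs a e) t = 2 * (t + a) / (2 * Real.sqrt ((t + a) ^ 2 + e ^ 2)) :=
    h2.deriv
  rw [h3, mul_div_mul_left _ _ (by norm_num)]

theorem abs_deriv_smoothAbs_le {a e : ℝ} (he : 0 < e) (t : ℝ) :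
    |deriv (smoothAbs a e) t| ≤ 1 := by
  rw [deriv_smoothAbs he, abs_div, abs_of_nonneg (Real.sqrt_nonneg _)]
  refine div_le_one_of_le₀ ?_ (Real.sqrt_nonneg _)
  rw [← Real.sqrt_sq_eq_abs]
  exact Real.sqrt_le_sqrt (by nlinarith)

theorem abs_smoothAbs_le {a e : ℝ} (ha : 0 ≤ a) (he : 0 ≤ e) (t : ℝ) :
    |smoothAbs a e t| ≤ a + e + |t| := by
  rw [smoothAbs, abs_of_nonneg (Real.sqrt_nonneg _)]
  refine Real.sqrt_le_iff.2 ⟨by positivity, ?_⟩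
  have h1 : (t + a) ^ 2 ≤ (|t| + a) ^ 2 := by
    refine sq_le_sq' ?_ ?_
    · linarith [neg_abs_le t]
    · linarith [le_abs_self t]
  nlinarith [abs_nonneg t, mul_nonneg (add_nonneg (abs_nonneg t) ha) he]

theorem tendsto_smoothAbs {a e : ℕ → ℝ} (ha : Tendsto a atTop (𝓝 0)) (he : Tendsto e atTop (𝓝 0))
    (t : ℝ) : Tendsto (fun n => smoothAbs (a n) (e n) t) atTop (𝓝 |t|) := by
  have h : Tendsto (fun n => (t + a n) ^ 2 + (e n) ^ 2) atTop (𝓝 ((t + 0) ^ 2 + 0 ^ 2)) :=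
    ((ha.const_add t).pow 2).add (he.pow 2)
  have h2 := (Real.continuous_sqrt.tendsto _).comp h
  simp only [add_zero, ne_eq, OfNat.ofNat_ne_zero, not_false_eq_true, zero_pow,
    Real.sqrt_sq_eq_abs] at h2
  exact h2

theorem tendsto_deriv_smoothAbs {a e : ℕ → ℝ} (ha : Tendsto a atTop (𝓝 0))
    (he : Tendsto e atTop (𝓝 0)) (he0 : ∀ n, 0 < e n) {t : ℝ} (ht : t ≠ 0) :
    Tendsto (fun n => deriv (smoothAbs (a n) (e n)) t) atTop (𝓝 (t / |t|)) := by
  simp only [deriv_smoothAbs (he0 _)]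
  have h1 := ha.const_add t
  rw [add_zero] at h1
  exact h1.div (tendsto_smoothAbs ha he t) (by simpa using ht)

/-- The sign function with value `c` at `0`. -/
def sgnWith (c t : ℝ) : ℝ := if t = 0 then c else t / |t|

theorem HasTrace.abs_aux (hN : 2 ≤ N) (hΩ : IsRegularDomain Ω) {u : H1 Ω} {φ : L2Boundary Ω}
    (h : HasTrace Ω u φ) {c : ℝ} (hc : c = 0 ∨ c = 1) :
    ∃ (v : H1 Ω) (ψ : L2Boundary Ω), HasTrace Ω v ψ ∧
      (H1fun v =ᵐ[volume.restrict Ω] fun x => |H1fun u x|) ∧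
      (H1grad v =ᵐ[volume.restrict Ω] fun x => sgnWith c (H1fun u x) • H1grad u x) ∧
      (ψ =ᵐ[surfaceMeasure Ω] fun x => |φ x|) := by
  have hε : Tendsto (fun n : ℕ => 1 / ((n : ℝ) + 1)) atTop (𝓝 0) :=
    tendsto_one_div_add_atTop_nhds_zero_nat
  have hε0 : ∀ n : ℕ, 0 < 1 / ((n : ℝ) + 1) := fun n => by positivity
  have hε1 : ∀ n : ℕ, 1 / ((n : ℝ) + 1) ≤ 1 := fun n => by
    rw [div_le_one (by positivity)]; linarith [n.cast_nonneg (α := ℝ)]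
  set ε : ℕ → ℝ := fun n => 1 / ((n : ℝ) + 1) with hεdef
  have hc0 : 0 ≤ c := by rcases hc with rfl | rfl <;> norm_num
  have hc1 : c ≤ 1 := by rcases hc with rfl | rfl <;> norm_num
  have ha : Tendsto (fun n => c * ε n) atTop (𝓝 0) := by simpa using hε.const_mul c
  have he : Tendsto (fun n => ε n ^ 2) atTop (𝓝 0) := by simpa using hε.pow 2
  have he0 : ∀ n, 0 < ε n ^ 2 := fun n => pow_pos (hε0 n) 2
  refine h.comp_limit hN hΩ (β := fun n => smoothAbs (c * ε n) (ε n ^ 2)) (C := 2)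
    (fun n => contDiff_smoothAbs (he0 n)) (fun n t => abs_deriv_smoothAbs_le (he0 n) t)
    (fun n t => ?_) (fun t => tendsto_smoothAbs ha he t) (fun t => ?_)
  · refine (abs_smoothAbs_le (mul_nonneg hc0 (hε0 n).le) (he0 n).le t).trans ?_
    have h1 : c * ε n ≤ 1 := mul_le_one₀ hc1 (hε0 n).le (hε1 n)
    have h2 : ε n ^ 2 ≤ 1 := pow_le_one₀ (hε0 n).le (hε1 n)
    linarith
  · by_cases ht : t = 0
    · rw [sgnWith, if_pos ht]
      subst ht
      rcases hc with rfl | rfl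
      · simp [deriv_smoothAbs (he0 _)]
      · have e1 : ∀ n, deriv (smoothAbs (1 * ε n) (ε n ^ 2)) 0 = 1 / Real.sqrt (1 + ε n ^ 2) := by
          intro n
          rw [deriv_smoothAbs (he0 n)]
          have : (0 + 1 * ε n) ^ 2 + (ε n ^ 2) ^ 2 = ε n ^ 2 * (1 + ε n ^ 2) := by ring
          rw [this, Real.sqrt_mul (he0 n).le, Real.sqrt_sq (hε0 n).le, zero_add, one_mul,
            ← div_div, div_self (hε0 n).ne']
        simp only [e1]
        have h1 := (Real.continuous_sqrt.tendsto _).comp (he.const_add 1)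
        simp only [add_zero, Real.sqrt_one] at h1
        have h2 := (tendsto_const_nhds (x := (1 : ℝ)) (f := atTop (α := ℕ))).div h1 one_ne_zero
        rw [div_one] at h2
        exact h2
    · rw [sgnWith, if_neg ht]
      exact tendsto_deriv_smoothAbs ha he he0 ht

theorem H1_ext_fun (hΩ : IsOpen Ω) {u v : H1 Ω} (h : H1fun u = H1fun v) : u = v :=
  H1_ext h (H1grad_eq_of_H1fun_eq hΩ h)

/-- The weak gradient vanishes a.e. on the zero set. -/
theorem HasTrace.gradient_eq_zero (hN : 2 ≤ N) (hΩ : IsRegularDomain Ω) {u : H1 Ω}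
    {φ : L2Boundary Ω} (h : HasTrace Ω u φ) :
    ∀ᵐ x ∂(volume.restrict Ω), H1fun u x = 0 → H1grad u x = 0 := by
  obtain ⟨v, ψ, -, h1, h2, -⟩ := h.abs_aux hN hΩ (Or.inl rfl)
  obtain ⟨v', ψ', -, h1', h2', -⟩ := h.abs_aux hN hΩ (Or.inr rfl)
  have hv : v = v' := H1_ext_fun hΩ.isOpen (Lp.ext (h1.trans h1'.symm))
  subst hv
  filter_upwards [h2, h2'] with x e1 e2 hx
  rw [e1, hx] at e2
  simpa [sgnWith] using e2.symm

/-- The absolute value of an element of `H¹(Ω)`. -/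
def absH (u : H1 Ω) : H1 Ω :=
  open Classical in if h : ∃ v : H1 Ω, H1fun v = |H1fun u| then h.choose else 0

theorem HasTrace.absH_spec (hN : 2 ≤ N) (hΩ : IsRegularDomain Ω) {u : H1 Ω}
    {φ : L2Boundary Ω} (h : HasTrace Ω u φ) : HasTrace Ω (absH u) |φ| ∧
      H1fun (absH u) = |H1fun u| ∧
      (H1grad (absH u) =ᵐ[volume.restrict Ω] fun x => sgnWith 0 (H1fun u x) • H1grad u x) := by
  obtain ⟨v, ψ, h0, h1, h2, h3⟩ := h.abs_aux hN hΩ (Or.inl rfl)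
  have e1 : H1fun v = |H1fun u| := Lp.ext (h1.trans (Lp.coeFn_abs _).symm)
  have e2 : ψ = |φ| := Lp.ext (h3.trans (Lp.coeFn_abs _).symm)
  have hex : ∃ v : H1 Ω, H1fun v = |H1fun u| := ⟨v, e1⟩
  have e3 : absH u = v := by
    refine H1_ext_fun hΩ.isOpen ?_
    rw [absH, dif_pos hex, hex.choose_spec, e1]
  rw [e3, ← e2]
  exact ⟨h0, e1, h2⟩

theorem abs_sgnWith_zero_le (t : ℝ) : |sgnWith 0 t| ≤ 1 := by
  rw [sgnWith]
  split_ifs with h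
  · simp
  · rw [abs_div, abs_abs, div_self (by simpa using h)]

theorem measurable_sgnWith (c : ℝ) : Measurable (sgnWith c) :=
  Measurable.ite (measurableSet_singleton 0) measurable_const
    (measurable_id.div continuous_abs.measurable)

theorem tendsto_sgnWith {s : ℕ → ℝ} {t : ℝ} (ht : t ≠ 0) (hs : Tendsto s atTop (𝓝 t)) :
    Tendsto (fun n => sgnWith 0 (s n)) atTop (𝓝 (sgnWith 0 t)) := by
  have h1 : Tendsto (fun n => s n / |s n|) atTop (𝓝 (sgnWith 0 t)) := by
    rw [sgnWith, if_neg ht]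
    exact hs.div hs.abs (by simpa using ht)
  refine h1.congr' ?_
  filter_upwards [hs.eventually_ne ht] with n hn
  rw [sgnWith, if_neg hn]

/-- The absolute value is continuous on `H¹(Ω)`. -/
theorem tendsto_absH (hN : 2 ≤ N) (hΩ : IsRegularDomain Ω) {u : ℕ → H1 Ω} {v : H1 Ω}
    {φ : ℕ → L2Boundary Ω} {ψ : L2Boundary Ω} (hu : ∀ n, HasTrace Ω (u n) (φ n))
    (hv : HasTrace Ω v ψ) (hlim : Tendsto u atTop (𝓝 v)) :
    Tendsto (fun n => absH (u n)) atTop (𝓝 (absH v)) := by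
  refine tendsto_of_subseq_tendsto fun ns hns => ?_
  have hlim' := hlim.comp hns
  obtain ⟨σ, hσ, hae⟩ := exists_subseq_tendsto_ae ((continuous_H1fun.tendsto v).comp hlim')
  refine ⟨σ, H1_tendsto_iff.2 ⟨?_, ?_⟩⟩
  · simp only [((hu _).absH_spec hN hΩ).2.1, (hv.absH_spec hN hΩ).2.1]
    rw [tendsto_iff_norm_sub_tendsto_zero]
    exact squeeze_zero (fun n => norm_nonneg _) (fun n => norm_abs_sub_abs _ _)
      (tendsto_iff_norm_sub_tendsto_zero.1
        (((continuous_H1fun.tendsto v).comp hlim').comp hσ.tendsto_atTop))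
  · refine tendsto_Lp_smul (c := fun n x => sgnWith 0 (H1fun (u (ns (σ n))) x))
      (((continuous_H1grad.tendsto v).comp hlim').comp hσ.tendsto_atTop)
      (fun n => ((hu _).absH_spec hN hΩ).2.2) (hv.absH_spec hN hΩ).2.2 (fun n => ?_)
      (fun n x => abs_sgnWith_zero_le _) ?_
    · exact ((measurable_sgnWith 0).comp_aemeasurable
        (Lp.aestronglyMeasurable _).aemeasurable).aestronglyMeasurable
    · filter_upwards [hae, hv.gradient_eq_zero hN hΩ] with x h1 h2
      by_cases hx : H1fun v x = 0
      · simp [h2 hx]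
      · exact (tendsto_sgnWith hx h1).smul_const _

/-- The positive part of an element of `H¹(Ω)`. -/
def posH (u : H1 Ω) : H1 Ω := (1 / 2 : ℝ) • (u + absH u)

/-- The positive part of an element of `L²(∂Ω)`. -/
def posB (φ : L2Boundary Ω) : L2Boundary Ω := (1 / 2 : ℝ) • (φ + |φ|)

theorem half_smul_add_abs_coeFn {α : Type*} [MeasurableSpace α] {μ : Measure α} (f : Lp ℝ 2 μ) :
    ((1 / 2 : ℝ) • (f + |f|) : Lp ℝ 2 μ) =ᵐ[μ] fun x => max (f x) 0 := by
  filter_upwards [Lp.coeFn_smul (1 / 2 : ℝ) (f + |f|), Lp.coeFn_add f |f|, Lp.coeFn_abs f] with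
    x h1 h2 h3
  rw [h1, Pi.smul_apply, h2, Pi.add_apply, h3, smul_eq_mul]
  rcases le_total 0 (f x) with h | h
  · rw [abs_of_nonneg h, max_eq_left h]; ring
  · rw [abs_of_nonpos h, max_eq_right h]; ring

theorem posB_coeFn (φ : L2Boundary Ω) :
    posB φ =ᵐ[surfaceMeasure Ω] fun x => max (φ x) 0 := half_smul_add_abs_coeFn φ

theorem HasTrace.posH (hN : 2 ≤ N) (hΩ : IsRegularDomain Ω) {u : H1 Ω} {φ : L2Boundary Ω}
    (h : HasTrace Ω u φ) : HasTrace Ω (posH u) (posB φ) :=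
  (h.add (h.absH_spec hN hΩ).1).smul _

theorem HasTrace.posH_coeFn (hN : 2 ≤ N) (hΩ : IsRegularDomain Ω) {u : H1 Ω} {φ : L2Boundary Ω}
    (h : HasTrace Ω u φ) :
    H1fun (Segregation.posH u) =ᵐ[volume.restrict Ω] fun x => max (H1fun u x) 0 := by
  have e : H1fun (Segregation.posH u) = (1 / 2 : ℝ) • (H1fun u + |H1fun u|) := by
    rw [Segregation.posH, H1fun_smul, H1fun_add, (h.absH_spec hN hΩ).2.1]
  rw [e]
  exact half_smul_add_abs_coeFn _

theorem tendsto_posH (hN : 2 ≤ N) (hΩ : IsRegularDomain Ω) {u : ℕ → H1 Ω} {v : H1 Ω}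
    {φ : ℕ → L2Boundary Ω} {ψ : L2Boundary Ω} (hu : ∀ n, HasTrace Ω (u n) (φ n))
    (hv : HasTrace Ω v ψ) (hlim : Tendsto u atTop (𝓝 v)) :
    Tendsto (fun n => posH (u n)) atTop (𝓝 (posH v)) :=
  (hlim.add (tendsto_absH hN hΩ hu hv hlim)).const_smul _

theorem Lp_coeFn_sum {α ι : Type*} [MeasurableSpace α] {μ : Measure α} (s : Finset ι)
    (f : ι → Lp ℝ 2 μ) : (∑ i ∈ s, f i : Lp ℝ 2 μ) =ᵐ[μ] fun x => ∑ i ∈ s, f i x := by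
  classical
  induction s using Finset.induction_on with
  | empty =>
    filter_upwards [Lp.coeFn_zero ℝ 2 μ] with x hx
    simpa using hx
  | insert a s ha ih =>
    rw [Finset.sum_insert ha]
    filter_upwards [Lp.coeFn_add (f a) (∑ i ∈ s, f i), ih] with x h1 h2
    rw [h1, Pi.add_apply, h2, Finset.sum_insert ha]

variable {k : ℕ}

/-- The segregating map `(vᵢ) ↦ ((vᵢ⁺ - ∑_{j ≠ i} vⱼ⁺)⁺)ᵢ`. -/
def segH (v : Fin k → H1 Ω) (i : Fin k) : H1 Ω :=
  posH (posH (v i) - ∑ j ∈ Finset.univ.erase i, posH (v j))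

/-- The segregating map on boundary data. -/
def segB (φ : Fin k → L2Boundary Ω) (i : Fin k) : L2Boundary Ω :=
  posB (posB (φ i) - ∑ j ∈ Finset.univ.erase i, posB (φ j))

/-- The segregating map on real numbers. -/
def segR (t : Fin k → ℝ) (i : Fin k) : ℝ :=
  max (max (t i) 0 - ∑ j ∈ Finset.univ.erase i, max (t j) 0) 0

theorem segR_nonneg (t : Fin k → ℝ) (i : Fin k) : 0 ≤ segR t i := le_max_right _ _

theorem segR_mul (t : Fin k → ℝ) {i j : Fin k} (hij : i ≠ j) : segR t i * segR t j = 0 := by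
  have key : ∀ {i j : Fin k}, i ≠ j → segR t i ≠ 0 → max (t j) 0 < max (t i) 0 := by
    intro i j hij h
    have h1 : 0 < max (t i) 0 - ∑ l ∈ Finset.univ.erase i, max (t l) 0 := by
      by_contra h2
      exact h (max_eq_right (not_lt.1 h2))
    have h2 : max (t j) 0 ≤ ∑ l ∈ Finset.univ.erase i, max (t l) 0 :=
      Finset.single_le_sum (f := fun l => max (t l) 0) (fun l _ => le_max_right _ _)
        (Finset.mem_erase.2 ⟨hij.symm, Finset.mem_univ _⟩)
    linarith
  by_contra h
  rw [mul_eq_zero, not_or] at h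
  exact lt_asymm (key hij h.1) (key hij.symm h.2)

theorem segR_eq_self {t : Fin k → ℝ} (h0 : ∀ i, 0 ≤ t i) (h : ∀ i j, i ≠ j → t i * t j = 0)
    (i : Fin k) : segR t i = t i := by
  have e : ∀ j, max (t j) 0 = t j := fun j => max_eq_left (h0 j)
  simp only [segR, e]
  rcases eq_or_ne (t i) 0 with h1 | h1
  · rw [h1, zero_sub]
    exact max_eq_right (neg_nonpos.2 (Finset.sum_nonneg fun j _ => h0 j))
  · rw [Finset.sum_eq_zero, sub_zero, e]
    intro j hj
    exact (mul_eq_zero.1 (h i j (Finset.ne_of_mem_erase hj).symm)).resolve_left h1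

theorem HasTrace.segH (hN : 2 ≤ N) (hΩ : IsRegularDomain Ω) {v : Fin k → H1 Ω}
    {φ : Fin k → L2Boundary Ω} (h : ∀ i, HasTrace Ω (v i) (φ i)) (i : Fin k) :
    HasTrace Ω (segH v i) (segB φ i) :=
  (((h i).posH hN hΩ).sub (HasTrace.sum _ fun j _ => (h j).posH hN hΩ)).posH hN hΩ

theorem segH_coeFn (hN : 2 ≤ N) (hΩ : IsRegularDomain Ω) {v : Fin k → H1 Ω}
    {φ : Fin k → L2Boundary Ω} (h : ∀ i, HasTrace Ω (v i) (φ i)) (i : Fin k) :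
    H1fun (segH v i) =ᵐ[volume.restrict Ω] fun x => segR (fun j => H1fun (v j) x) i := by
  have h1 := (((h i).posH hN hΩ).sub
    (HasTrace.sum (Finset.univ.erase i) fun j _ => (h j).posH hN hΩ)).posH_coeFn hN hΩ
  have e : H1fun (posH (v i) - ∑ j ∈ Finset.univ.erase i, posH (v j))
      = H1fun (posH (v i)) - ∑ j ∈ Finset.univ.erase i, H1fun (posH (v j)) := by
    rw [← H1funL_apply, map_sub, map_sum]; rfl
  rw [e] at h1
  filter_upwards [h1, Lp.coeFn_sub (H1fun (posH (v i)))
    (∑ j ∈ Finset.univ.erase i, H1fun (posH (v j))),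
    Lp_coeFn_sum (Finset.univ.erase i) fun j => H1fun (posH (v j)),
    ae_all_iff.2 fun j => (h j).posH_coeFn hN hΩ] with x e1 e2 e3 e4
  rw [Segregation.segH, e1, e2, Pi.sub_apply, e3, segR]
  simp only [e4]

theorem segB_coeFn (φ : Fin k → L2Boundary Ω) (i : Fin k) :
    segB φ i =ᵐ[surfaceMeasure Ω] fun x => segR (fun j => φ j x) i := by
  filter_upwards [posB_coeFn (posB (φ i) - ∑ j ∈ Finset.univ.erase i, posB (φ j)),
    Lp.coeFn_sub (posB (φ i)) (∑ j ∈ Finset.univ.erase i, posB (φ j)),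
    Lp_coeFn_sum (Finset.univ.erase i) fun j => posB (φ j),
    ae_all_iff.2 fun j => posB_coeFn (φ j)] with x e1 e2 e3 e4
  rw [segB, e1, e2, Pi.sub_apply, e3, segR]
  simp only [e4]

theorem IsAdmissible.segB_eq {φ : Fin k → L2Boundary Ω} (h : IsAdmissible Ω φ) :
    segB φ = φ := by
  funext i
  refine Lp.ext ?_
  filter_upwards [segB_coeFn φ i, ae_all_iff.2 h.nonneg,
    ae_all_iff.2 fun i => ae_all_iff.2 fun j => eventually_imp_distrib_left.2 (h.disjoint i j)]
    with x e1 e2 e3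
  rw [e1, segR_eq_self e2 e3]

theorem segH_eq_self (hN : 2 ≤ N) (hΩ : IsRegularDomain Ω) {φ : Fin k → L2Boundary Ω}
    {v : Fin k → H1 Ω} (h : v ∈ segregatedStates Ω φ) : segH v = v := by
  funext i
  refine H1_ext_fun hΩ.isOpen (Lp.ext ?_)
  filter_upwards [segH_coeFn hN hΩ h.1 i, ae_all_iff.2 h.2.1,
    ae_all_iff.2 fun i => ae_all_iff.2 fun j => eventually_imp_distrib_left.2 (h.2.2 i j)]
    with x e1 e2 e3
  rw [e1, segR_eq_self (t := fun j => H1fun (v j) x) e2 e3]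

theorem segH_mem (hN : 2 ≤ N) (hΩ : IsRegularDomain Ω) {φ : Fin k → L2Boundary Ω}
    (hφ : IsAdmissible Ω φ) {v : Fin k → H1 Ω} (h : ∀ i, HasTrace Ω (v i) (φ i)) :
    segH v ∈ segregatedStates Ω φ := by
  refine ⟨fun i => ?_, fun i => ?_, fun i j hij => ?_⟩
  · have := HasTrace.segH hN hΩ h i
    rwa [hφ.segB_eq] at this
  · filter_upwards [segH_coeFn hN hΩ h i] with x hx
    rw [hx]; exact segR_nonneg _ _
  · filter_upwards [segH_coeFn hN hΩ h i, segH_coeFn hN hΩ h j] with x hx hx'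
    rw [hx, hx']; exact segR_mul _ hij

theorem tendsto_segH (hN : 2 ≤ N) (hΩ : IsRegularDomain Ω) {u : ℕ → Fin k → H1 Ω}
    {v : Fin k → H1 Ω} {φ : ℕ → Fin k → L2Boundary Ω} {ψ : Fin k → L2Boundary Ω}
    (hu : ∀ n i, HasTrace Ω (u n i) (φ n i)) (hv : ∀ i, HasTrace Ω (v i) (ψ i))
    (hlim : ∀ i, Tendsto (fun n => u n i) atTop (𝓝 (v i))) (i : Fin k) :
    Tendsto (fun n => segH (u n) i) atTop (𝓝 (segH v i)) := by
  have h1 := fun j => tendsto_posH hN hΩ (fun n => hu n j) (hv j) (hlim j)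
  refine tendsto_posH hN hΩ (fun n => ((hu n i).posH hN hΩ).sub
    (HasTrace.sum _ fun j _ => (hu n j).posH hN hΩ)) (((hv i).posH hN hΩ).sub
    (HasTrace.sum _ fun j _ => (hv j).posH hN hΩ)) ?_
  exact (h1 i).sub (tendsto_finsetSum _ fun j _ => h1 j)

end Abs

section Cutoff

open scoped NNReal Convolution

variable {N : ℕ} {Ω : Set (E N)}

theorem compl_nonempty_of_isBounded (hN : 2 ≤ N) (hb : Bornology.IsBounded Ω) : Ωᶜ.Nonempty := by
  rw [Set.nonempty_compl]
  rintro rfl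
  have : Nonempty (Fin N) := ⟨⟨0, by omega⟩⟩
  have : Nontrivial (E N) := inferInstance
  have h1 : NoncompactSpace (E N) := NormedSpace.noncompactSpace ℝ (E N)
  exact h1.noncompact_univ (Metric.isCompact_of_isClosed_isBounded isClosed_univ hb)

/-- A Lipschitz cutoff function. -/
def lipCutoff (Ω : Set (E N)) (δ : ℝ) (x : E N) : ℝ :=
  max 0 (min 1 (Metric.infDist x Ωᶜ / δ - 1))

theorem lipCutoff_mem (δ : ℝ) (x : E N) : lipCutoff Ω δ x ∈ Set.Icc (0 : ℝ) 1 :=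
  ⟨le_max_left _ _, max_le zero_le_one (min_le_left _ _)⟩

theorem abs_lipCutoff_sub_le {δ : ℝ} (hδ : 0 < δ) (x y : E N) :
    |lipCutoff Ω δ x - lipCutoff Ω δ y| ≤ δ⁻¹ * ‖x - y‖ := by
  have h1 : |Metric.infDist x Ωᶜ - Metric.infDist y Ωᶜ| ≤ ‖x - y‖ := by
    rw [← dist_eq_norm, ← Real.dist_eq]
    simpa using (Metric.lipschitz_infDist_pt (Ωᶜ)).dist_le_mul x y
  calc _ ≤ |min 1 (Metric.infDist x Ωᶜ / δ - 1) - min 1 (Metric.infDist y Ωᶜ / δ - 1)| := by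
        rw [lipCutoff, lipCutoff, max_comm 0, max_comm 0]
        exact abs_max_sub_max_le_abs _ _ _
    _ ≤ |(Metric.infDist x Ωᶜ / δ - 1) - (Metric.infDist y Ωᶜ / δ - 1)| := by
        rw [min_comm 1, min_comm 1]
        have := abs_min_sub_min_le_max (Metric.infDist x Ωᶜ / δ - 1) 1
          (Metric.infDist y Ωᶜ / δ - 1) 1
        simpa using this
    _ = δ⁻¹ * |Metric.infDist x Ωᶜ - Metric.infDist y Ωᶜ| := by
        rw [sub_sub_sub_cancel_right, ← sub_div, abs_div, abs_of_pos hδ, div_eq_inv_mul]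
    _ ≤ _ := by gcongr

theorem continuous_lipCutoff (δ : ℝ) : Continuous (lipCutoff Ω δ) := by
  have := Metric.continuous_infDist_pt (Ωᶜ)
  unfold lipCutoff
  fun_prop

/-- Smooth cutoff functions with controlled gradient. -/
theorem exists_cutoff (hN : 2 ≤ N) (hΩ : IsRegularDomain Ω) {δ : ℝ} (hδ : 0 < δ) :
    ∃ χ : E N → ℝ, IsTestFunction Ω χ ∧ (∀ x, |1 - χ x| ≤ 2) ∧ (∀ x, ‖gradient χ x‖ ≤ δ⁻¹) ∧
      ∀ x, x ∉ Metric.thickening (3 * δ) Ωᶜ → χ x = 1 ∧ gradient χ x = 0 := by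
  have hne := compl_nonempty_of_isBounded hN hΩ.isBounded
  let ρ : ContDiffBump (0 : E N) := ⟨δ / 8, δ / 4, by positivity, by linarith⟩
  have hρ : ρ.rOut = δ / 4 := rfl
  set g := lipCutoff Ω δ with hg
  have hgc : Continuous g := continuous_lipCutoff δ
  set χ : E N → ℝ := (ρ.normed volume ⋆[ContinuousLinearMap.lsmul ℝ ℝ, volume] g) with hχ
  have hsmooth : ContDiff ℝ ∞ χ :=
    ρ.hasCompactSupport_normed.contDiff_convolution_left _ ρ.contDiff_normed
      hgc.locallyIntegrable
  have hinf : ∀ x y : E N, Metric.infDist x Ωᶜ ≤ Metric.infDist y Ωᶜ + dist x y :=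
    fun x y => Metric.infDist_le_infDist_add_dist
  have h0 : ∀ x, Metric.infDist x Ωᶜ < 3 / 4 * δ → χ x = 0 := by
    intro x hx
    have h1 : ∀ y ∈ Metric.ball x ρ.rOut, g y = 0 := by
      intro y hy
      rw [hρ, Metric.mem_ball] at hy
      have : Metric.infDist y Ωᶜ / δ - 1 ≤ 0 := by
        rw [sub_nonpos, div_le_one hδ]
        linarith [hinf y x]
      exact max_eq_left ((min_le_right _ _).trans this)
    have h2 : g x = 0 := h1 x (Metric.mem_ball_self ρ.rOut_pos)
    rw [hχ, ρ.normed_convolution_eq_right (fun y hy => (h1 y hy).trans h2.symm), h2]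
  have hone : ∀ x, 5 / 2 * δ ≤ Metric.infDist x Ωᶜ → χ x = 1 := by
    intro x hx
    have h1 : ∀ y ∈ Metric.ball x ρ.rOut, g y = 1 := by
      intro y hy
      rw [hρ, Metric.mem_ball, dist_comm] at hy
      have : 1 ≤ Metric.infDist y Ωᶜ / δ - 1 := by
        rw [le_sub_iff_add_le, le_div_iff₀ hδ]
        linarith [hinf x y]
      rw [hg, lipCutoff, min_eq_left this]
      exact max_eq_right zero_le_one
    have h2 : g x = 1 := h1 x (Metric.mem_ball_self ρ.rOut_pos)
    rw [hχ, ρ.normed_convolution_eq_right (fun y hy => (h1 y hy).trans h2.symm), h2]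
  have h1 : ∀ x, x ∉ Metric.thickening (3 * δ) Ωᶜ → χ x = 1 ∧ gradient χ x = 0 := by
    intro x hx
    rw [Metric.mem_thickening_iff_infDist_lt hne, not_lt] at hx
    refine ⟨hone x (by linarith), ?_⟩
    have hev : χ =ᶠ[𝓝 x] fun _ => (1 : ℝ) := by
      have ho : ∀ᶠ y in 𝓝 x, 5 / 2 * δ < Metric.infDist y Ωᶜ :=
        (Metric.continuous_infDist_pt _).continuousAt.eventually_const_lt (by linarith)
      filter_upwards [ho] with y hy using hone y hy.le
    rw [hev.gradient_eq]
    simp [gradient]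
  have hts : tsupport χ ⊆ {x | 3 / 4 * δ ≤ Metric.infDist x Ωᶜ} := by
    refine closure_minimal (fun x hx => ?_) (isClosed_le continuous_const
      (Metric.continuous_infDist_pt _))
    by_contra h
    exact hx (h0 x (not_le.1 h))
  have hsub : {x | 3 / 4 * δ ≤ Metric.infDist x Ωᶜ} ⊆ Ω := by
    intro x hx
    by_contra h
    have : Metric.infDist x Ωᶜ = 0 := Metric.infDist_zero_of_mem h
    have h' : 3 / 4 * δ ≤ Metric.infDist x Ωᶜ := hx
    rw [this] at h'
    linarith
  refine ⟨χ, ⟨hsmooth, ?_, hts.trans hsub⟩, fun x => ?_, fun x => ?_, h1⟩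
  · exact Metric.isCompact_of_isClosed_isBounded (isClosed_tsupport _)
      (hΩ.isBounded.subset (hts.trans hsub))
  · have h3 : dist (χ x) (g x) ≤ 1 := by
      refine ρ.dist_normed_convolution_le hgc.aestronglyMeasurable fun y _ => ?_
      have a := lipCutoff_mem (Ω := Ω) δ x
      have b := lipCutoff_mem (Ω := Ω) δ y
      rw [Real.dist_eq, abs_le]
      constructor <;> linarith [a.1, a.2, b.1, b.2]
    have a := lipCutoff_mem (Ω := Ω) δ x
    rw [Real.dist_eq, abs_le] at h3
    rw [abs_le]
    constructor <;> linarith [a.1, a.2, h3.1, h3.2]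
  · rw [norm_gradient]
    refine norm_fderiv_le_of_lip' ℝ (by positivity) (Eventually.of_forall fun y => ?_)
    have hint : ∀ z : E N, Integrable (fun t => ρ.normed volume t * g (z - t)) := fun z =>
      (ρ.continuous_normed.mul (hgc.comp (by fun_prop))).integrable_of_hasCompactSupport
        ρ.hasCompactSupport_normed.mul_right
    have e : ∀ z, χ z = ∫ t, ρ.normed volume t * g (z - t) := fun z => rfl
    rw [e, e, ← integral_sub (hint _) (hint _)]
    calc ‖∫ t, (ρ.normed volume t * g (y - t) - ρ.normed volume t * g (x - t))‖
        ≤ ∫ t, ρ.normed volume t * (δ⁻¹ * ‖y - x‖) := by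
          refine norm_integral_le_of_norm_le (ρ.integrable_normed.mul_const _)
            (Eventually.of_forall fun t => ?_)
          rw [← mul_sub, norm_mul, Real.norm_of_nonneg (ρ.nonneg_normed t)]
          refine mul_le_mul_of_nonneg_left ?_ (ρ.nonneg_normed t)
          have := abs_lipCutoff_sub_le (Ω := Ω) hδ (y - t) (x - t)
          rwa [sub_sub_sub_cancel_right] at this
      _ = δ⁻¹ * ‖y - x‖ := by
          rw [integral_mul_const, ρ.integral_normed, one_mul]

theorem tendsto_lintegral_layer (hΩ : IsRegularDomain Ω) {f : E N → ℝ≥0∞}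
    (hf : ∫⁻ x in Ω, f x ≠ ⊤) :
    Tendsto (fun δ => ∫⁻ x in layer Ω δ, f x) (𝓝[>] 0) (𝓝 0) := by
  have := isFiniteMeasure_restrict hΩ.isBounded
  have h1 : Tendsto (fun δ => (volume.restrict Ω) (Metric.thickening δ Ωᶜ)) (𝓝[>] 0) (𝓝 0) := by
    have := tendsto_measure_thickening (μ := volume.restrict Ω) (s := Ωᶜ)
      ⟨1, one_pos, measure_ne_top _ _⟩
    rwa [hΩ.isOpen.isClosed_compl.closure_eq, Measure.restrict_apply
      hΩ.isOpen.measurableSet.compl, Set.compl_inter_self, measure_empty] at this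
  have h2 := tendsto_setLIntegral_zero hf h1
  refine h2.congr fun δ => ?_
  rw [Measure.restrict_restrict Metric.isOpen_thickening.measurableSet, layer, Set.inter_comm]

/-- Approximation of smooth functions by test functions, in terms of boundary values. -/
theorem exists_test_approx (hN : 2 ≤ N) (hΩ : IsRegularDomain Ω) :
    ∃ K A : ℝ≥0, 0 < A ∧ ∃ δ₀ > 0, ∀ δ, 0 < δ → δ < δ₀ → ∃ D : ℝ≥0, ∀ w : E N → ℝ, ContDiff ℝ ∞ w →
      ∃ η, IsTestFunction Ω η ∧
        (∫⁻ x in Ω, ‖w x - η x‖ₑ ^ 2) + ∫⁻ x in Ω, ‖gradient w x - gradient η x‖ₑ ^ 2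
        ≤ D * (∫⁻ x, ‖w x‖ₑ ^ 2 ∂(surfaceMeasure Ω))
          + K * ∫⁻ x in layer Ω (A * δ), ‖gradient w x‖ₑ ^ 2 := by
  obtain ⟨C, δ₀, hδ₀, hC⟩ := exists_lintegral_layer_le hN hΩ
  refine ⟨54 * C + 8, 3 * C + 3, by positivity, min 1 (δ₀ / 3), by positivity,
    fun δ hδ hδ' => ?_⟩
  have hδ1 : δ < 1 := hδ'.trans_le (min_le_left _ _)
  have hδ2 : 3 * δ < δ₀ := by
    have := hδ'.trans_le (min_le_right _ _); linarith
  obtain ⟨χ, hχ, hχ1, hχ2, hχ3⟩ := exists_cutoff hN hΩ hδ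
  set d : ℝ≥0 := ⟨δ, hδ.le⟩ with hd
  have hd0 : d ≠ 0 := fun h => hδ.ne' (congrArg NNReal.toReal h)
  have hdR : ENNReal.ofReal δ = d := by rw [← ENNReal.ofReal_coe_nnreal]; rfl
  have hd1 : d ≤ 1 := by rw [← NNReal.coe_le_coe]; exact hδ1.le
  refine ⟨(4 + 2 * d⁻¹ ^ 2) * (C * (3 * d)), fun w hw => ⟨fun x => χ x * w x, ?_, ?_⟩⟩
  · refine ⟨hχ.contDiff.mul hw, hχ.hasCompactSupport.mul_right, ?_⟩
    exact (closure_mono (Function.support_mul_subset_left _ _)).trans hχ.tsupport_subset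
  have hgrad : ∀ x, gradient (fun x => χ x * w x) x = χ x • gradient w x + w x • gradient χ x := by
    intro x
    have := fderiv_fun_mul (hχ.contDiff.differentiable (by simp) x) (hw.differentiable (by simp) x)
    rw [gradient, this, map_add, map_smul, map_smul]; rfl
  have hlm := measurableSet_layer hΩ.isOpen (3 * δ)
  have hcwm : Measurable (fun x => ‖w x‖ₑ ^ 2) := (hw.continuous.measurable.enorm).pow_const 2
  have hcgm : Measurable (fun x => ‖gradient w x‖ₑ ^ 2) :=
    ((continuous_gradient_of_contDiff hw).measurable.enorm).pow_const 2
  have two_e : ‖(2 : ℝ)‖ₑ = 2 := by simp [Real.enorm_eq_ofReal]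
  have hχe : ∀ x, ‖1 - χ x‖ₑ ≤ 2 := fun x => by
    rw [← two_e]; exact enorm_le_iff_norm_le.2 ((hχ1 x).trans (by simp))
  have hχg : ∀ x, ‖gradient χ x‖ₑ ≤ (d⁻¹ : ℝ≥0) := fun x => by
    rw [← ofReal_norm, ← ENNReal.ofReal_coe_nnreal]
    exact ENNReal.ofReal_le_ofReal (hχ2 x)
  have hoff : ∀ x ∈ Ω, x ∉ layer Ω (3 * δ) → χ x = 1 ∧ gradient χ x = 0 := by
    intro x hx hx'
    have hx2 : x ∉ Metric.thickening (3 * δ) Ωᶜ := fun h => hx' ⟨hx, h⟩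
    exact hχ3 x hx2
  have hpt : ∀ x ∈ Ω, ‖w x - χ x * w x‖ₑ ^ 2
      + ‖gradient w x - gradient (fun x => χ x * w x) x‖ₑ ^ 2
      ≤ (layer Ω (3 * δ)).indicator (fun x => (4 + 2 * (d⁻¹ : ℝ≥0) ^ 2) * ‖w x‖ₑ ^ 2
        + 8 * ‖gradient w x‖ₑ ^ 2) x := by
    intro x hx
    by_cases hxl : x ∈ layer Ω (3 * δ)
    · rw [Set.indicator_of_mem hxl, hgrad]
      have e1 : ‖w x - χ x * w x‖ₑ ^ 2 ≤ 4 * ‖w x‖ₑ ^ 2 := by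
        have : w x - χ x * w x = (1 - χ x) * w x := by ring
        rw [this, enorm_mul, mul_pow]
        gcongr
        calc ‖1 - χ x‖ₑ ^ 2 ≤ 2 ^ 2 := pow_le_pow_left' (hχe x) 2
          _ = 4 := by norm_num
      have e2 : ‖gradient w x - (χ x • gradient w x + w x • gradient χ x)‖ₑ ^ 2
          ≤ 8 * ‖gradient w x‖ₑ ^ 2 + 2 * (d⁻¹ : ℝ≥0) ^ 2 * ‖w x‖ₑ ^ 2 := by
        have : gradient w x - (χ x • gradient w x + w x • gradient χ x)
            = (1 - χ x) • gradient w x + (-w x) • gradient χ x := by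
          rw [sub_smul, one_smul, neg_smul]; abel
        rw [this]
        calc _ ≤ (2 * ‖gradient w x‖ₑ + ‖w x‖ₑ * (d⁻¹ : ℝ≥0)) ^ 2 := by
              refine pow_le_pow_left' ((enorm_add_le _ _).trans ?_) 2
              rw [enorm_smul, enorm_smul, enorm_neg]
              gcongr
              · exact hχe x
              · exact hχg x
          _ ≤ 2 * (2 * ‖gradient w x‖ₑ) ^ 2 + 2 * (‖w x‖ₑ * (d⁻¹ : ℝ≥0)) ^ 2 :=
              ennreal_add_sq_le _ _
          _ = _ := by ring
      refine (add_le_add e1 e2).trans (le_of_eq ?_)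
      ring
    · rw [Set.indicator_of_notMem hxl, hgrad, (hoff x hx hxl).1, (hoff x hx hxl).2]
      simp
  have hη : ContDiff ℝ ∞ (fun x => χ x * w x) := hχ.contDiff.mul hw
  have hmd : Measurable (fun x => ‖w x - χ x * w x‖ₑ ^ 2) :=
    ((hw.continuous.sub hη.continuous).measurable.enorm).pow_const 2
  rw [← lintegral_add_left hmd]
  refine (setLIntegral_mono' hΩ.isOpen.measurableSet hpt).trans ?_
  rw [lintegral_indicator hlm, Measure.restrict_restrict hlm,
    Set.inter_eq_left.2 (layer_subset _), lintegral_add_left (hcwm.const_mul _),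
    lintegral_const_mul _ hcwm, lintegral_const_mul _ hcgm]
  have h1 := hC (3 * δ) (by positivity) hδ2 w hw
  rw [ENNReal.ofReal_mul (by norm_num), hdR] at h1
  have h3 : ENNReal.ofReal 3 = 3 := by simp
  rw [h3] at h1
  set M := ∫⁻ x, ‖w x‖ₑ ^ 2 ∂(surfaceMeasure Ω) with hM
  have hG1 : ∫⁻ x in layer Ω (C * (3 * δ)), ‖gradient w x‖ₑ ^ 2
      ≤ ∫⁻ x in layer Ω ((3 * C + 3 : ℝ≥0) * δ), ‖gradient w x‖ₑ ^ 2 := by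
    refine lintegral_mono_set (layer_mono ?_)
    push_cast
    nlinarith
  have hG2 : ∫⁻ x in layer Ω (3 * δ), ‖gradient w x‖ₑ ^ 2
      ≤ ∫⁻ x in layer Ω ((3 * C + 3 : ℝ≥0) * δ), ‖gradient w x‖ₑ ^ 2 := by
    refine lintegral_mono_set (layer_mono ?_)
    push_cast
    nlinarith [mul_nonneg C.coe_nonneg hδ.le]
  set G := ∫⁻ x in layer Ω ((3 * C + 3 : ℝ≥0) * δ), ‖gradient w x‖ₑ ^ 2 with hG
  have hcoef : (4 + 2 * d⁻¹ ^ 2) * (C * (3 * d) ^ 2) ≤ 54 * C := by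
    have hd' : d⁻¹ ^ 2 * d ^ 2 = 1 := by rw [← mul_pow, inv_mul_cancel₀ hd0, one_pow]
    have hd2 : d ^ 2 ≤ 1 := pow_le_one₀ (by positivity) hd1
    calc (4 + 2 * d⁻¹ ^ 2) * (C * (3 * d) ^ 2) = 36 * C * d ^ 2 + 18 * C * (d⁻¹ ^ 2 * d ^ 2) := by
          ring
      _ ≤ 36 * C * 1 + 18 * C * 1 := by rw [hd']; gcongr
      _ = 54 * C := by ring
  have hcoef' : (4 + 2 * ((d⁻¹ : ℝ≥0) : ℝ≥0∞) ^ 2) * (C * (3 * d) ^ 2) ≤ 54 * C := by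
    exact_mod_cast hcoef
  calc _ ≤ (4 + 2 * ((d⁻¹ : ℝ≥0) : ℝ≥0∞) ^ 2) * (C * (3 * d) * M + C * (3 * d) ^ 2 * G) + 8 * G := by
        gcongr
        exact h1.trans (by gcongr)
    _ = (4 + 2 * ((d⁻¹ : ℝ≥0) : ℝ≥0∞) ^ 2) * (C * (3 * d)) * M
        + ((4 + 2 * ((d⁻¹ : ℝ≥0) : ℝ≥0∞) ^ 2) * (C * (3 * d) ^ 2)) * G + 8 * G := by ring
    _ ≤ (4 + 2 * ((d⁻¹ : ℝ≥0) : ℝ≥0∞) ^ 2) * (C * (3 * d)) * M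
        + (54 * C) * G + 8 * G := by gcongr
    _ = _ := by push_cast; ring

theorem H1_enorm_sq (u : H1 Ω) : ‖u‖ₑ ^ 2 = ‖H1fun u‖ₑ ^ 2 + ‖H1grad u‖ₑ ^ 2 := by
  have h := H1_norm_sq u
  rw [← ofReal_norm, ← ofReal_norm, ← ofReal_norm, ← ENNReal.ofReal_pow (norm_nonneg _),
    ← ENNReal.ofReal_pow (norm_nonneg _), ← ENNReal.ofReal_pow (norm_nonneg _),
    ← ENNReal.ofReal_add (by positivity) (by positivity), h]

theorem Lp_enorm_sub_sq {α F : Type*} [MeasurableSpace α] {μ : Measure α} [NormedAddCommGroup F]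
    {f g : Lp F 2 μ} {a b : α → F} (hf : f =ᵐ[μ] a) (hg : g =ᵐ[μ] b) :
    ‖f - g‖ₑ ^ 2 = ∫⁻ x, ‖a x - b x‖ₑ ^ 2 ∂μ := by
  rw [Lp_enorm_sq]
  refine lintegral_congr_ae ?_
  filter_upwards [Lp.coeFn_sub f g, hf, hg] with x h1 h2 h3
  rw [h1, Pi.sub_apply, h2, h3]

/-- Functions with zero trace belong to `H¹₀(Ω)`. -/
theorem HasTrace.mem_H10 (hN : 2 ≤ N) (hΩ : IsRegularDomain Ω) {u : H1 Ω}
    (h : HasTrace Ω u 0) : u ∈ H10 Ω := by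
  obtain ⟨p, ψ, w, a1, a2, a3, a4, a5, a6⟩ := h.exists_seq
  obtain ⟨K, A, hA, δ₀, hδ₀, hK⟩ := exists_test_approx hN hΩ
  rw [H10, Metric.mem_closure_iff]
  intro ε hε
  have hgfin : ∫⁻ x in Ω, ‖H1grad u x‖ₑ ^ 2 ≠ ⊤ := by rw [← Lp_enorm_sq]; finiteness
  have hlay : Tendsto (fun δ : ℝ => 2 * K * ∫⁻ x in layer Ω (A * δ), ‖H1grad u x‖ₑ ^ 2)
      (𝓝[>] 0) (𝓝 (2 * K * 0)) := by
    refine ENNReal.Tendsto.const_mul ((tendsto_lintegral_layer hΩ hgfin).comp ?_)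
      (Or.inr (by finiteness))
    refine tendsto_nhdsWithin_iff.2 ⟨?_, ?_⟩
    · have : Tendsto (fun δ : ℝ => (A : ℝ) * δ) (𝓝 0) (𝓝 (A * 0)) := tendsto_id.const_mul _
      rw [mul_zero] at this
      exact this.mono_left nhdsWithin_le_nhds
    · filter_upwards [self_mem_nhdsWithin] with δ hδ
      exact mul_pos (NNReal.coe_pos.2 hA) (Set.mem_Ioi.1 hδ)
  rw [mul_zero] at hlay
  have hε2 : (0 : ℝ≥0∞) < ENNReal.ofReal (ε / 2) ^ 2 := by
    refine ENNReal.pow_pos (ENNReal.ofReal_pos.2 (by positivity)) 2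
  obtain ⟨δ, hδ1, hδ0, hδ2⟩ := ((hlay.eventually_lt_const hε2).and
    (Ioo_mem_nhdsGT hδ₀)).exists
  obtain ⟨D, hD⟩ := hK δ hδ0 hδ2
  have hlim : Tendsto (fun n => D * ‖ψ n‖ₑ ^ 2 + (2 * K * ‖H1grad (p n) - H1grad u‖ₑ ^ 2
      + 2 * K * ∫⁻ x in layer Ω (A * δ), ‖H1grad u x‖ₑ ^ 2)) atTop
      (𝓝 (D * 0 + (2 * K * 0 + 2 * K * ∫⁻ x in layer Ω (A * δ), ‖H1grad u x‖ₑ ^ 2))) := by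
    have t1 : Tendsto (fun n => ‖ψ n‖ₑ ^ 2) atTop (𝓝 0) := by
      have := ENNReal.Tendsto.pow (n := 2) ((continuous_enorm.tendsto (0 : L2Boundary Ω)).comp a6)
      simpa [Function.comp_def] using this
    have t2 : Tendsto (fun n => ‖H1grad (p n) - H1grad u‖ₑ ^ 2) atTop (𝓝 0) := by
      have h1 := ((continuous_H1grad.tendsto u).comp a5).sub_const (H1grad u)
      rw [sub_self] at h1
      have := ENNReal.Tendsto.pow (n := 2)
        ((continuous_enorm.tendsto (0 : Lp (E N) 2 (volume.restrict Ω))).comp h1)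
      simpa [Function.comp_def] using this
    exact (ENNReal.Tendsto.const_mul t1 (Or.inr (by finiteness))).add
      ((ENNReal.Tendsto.const_mul t2 (Or.inr (by finiteness))).add tendsto_const_nhds)
  rw [mul_zero, mul_zero, zero_add, zero_add] at hlim
  obtain ⟨n, hn1, hn2⟩ := ((hlim.eventually_lt_const hδ1).and
    (Metric.tendsto_nhds.1 a5 (ε / 2) (by positivity))).exists
  obtain ⟨η, hη, hle⟩ := hD (w n) (a1 n)
  obtain ⟨q, hq1, hq2⟩ := exists_H1_of_contDiff hΩ.isBounded hη.contDiff
  refine ⟨q, ⟨η, hη, hq1, hq2⟩, ?_⟩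
  have e1 : ‖p n - q‖ₑ ^ 2 ≤ D * ‖ψ n‖ₑ ^ 2 + (2 * K * ‖H1grad (p n) - H1grad u‖ₑ ^ 2
      + 2 * K * ∫⁻ x in layer Ω (A * δ), ‖H1grad u x‖ₑ ^ 2) := by
    rw [H1_enorm_sq, H1fun_sub, H1grad_sub, Lp_enorm_sub_sq (a2 n) hq1,
      Lp_enorm_sub_sq (a3 n) hq2]
    refine hle.trans ?_
    have e2 : ∫⁻ x, ‖w n x‖ₑ ^ 2 ∂(surfaceMeasure Ω) = ‖ψ n‖ₑ ^ 2 := by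
      rw [Lp_enorm_sq]
      refine lintegral_congr_ae ?_
      filter_upwards [a4 n] with x hx
      rw [hx]
    rw [e2]
    gcongr
    have e3 : ∫⁻ x in layer Ω (A * δ), ‖gradient (w n) x‖ₑ ^ 2
        ≤ ∫⁻ x in layer Ω (A * δ), (2 * ‖gradient (w n) x - H1grad u x‖ₑ ^ 2
          + 2 * ‖H1grad u x‖ₑ ^ 2) := by
      refine lintegral_mono fun x => ?_
      refine le_trans (pow_le_pow_left' ?_ 2) (ennreal_add_sq_le _ _)
      calc ‖gradient (w n) x‖ₑ = ‖(gradient (w n) x - H1grad u x) + H1grad u x‖ₑ := by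
            rw [sub_add_cancel]
        _ ≤ _ := enorm_add_le _ _
    have hmu : AEMeasurable (fun x => 2 * ‖H1grad u x‖ₑ ^ 2)
        (volume.restrict (layer Ω (A * δ))) :=
      ((((Lp.aestronglyMeasurable (H1grad u)).mono_measure
        (Measure.restrict_mono (layer_subset _) le_rfl)).enorm).pow_const 2).const_mul 2
    rw [lintegral_add_right' _ hmu, lintegral_const_mul' _ _ (by finiteness),
      lintegral_const_mul' _ _ (by finiteness)] at e3
    have e4 : ∫⁻ x in layer Ω (A * δ), ‖gradient (w n) x - H1grad u x‖ₑ ^ 2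
        ≤ ‖H1grad (p n) - H1grad u‖ₑ ^ 2 := by
      rw [Lp_enorm_sub_sq (a3 n) (EventuallyEq.refl _ (H1grad u))]
      exact lintegral_mono_set (layer_subset _)
    calc _ ≤ K * (2 * ‖H1grad (p n) - H1grad u‖ₑ ^ 2
          + 2 * ∫⁻ x in layer Ω (A * δ), ‖H1grad u x‖ₑ ^ 2) := by
            gcongr
            exact e3.trans (by gcongr)
      _ = _ := by ring
  have e5 : ‖p n - q‖ₑ < ENNReal.ofReal (ε / 2) :=
    lt_of_not_ge fun h => (e1.trans_lt hn1).not_ge (pow_le_pow_left' h 2)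
  have e6 : dist (p n) q < ε / 2 := by
    rw [dist_eq_norm]
    rw [← ofReal_norm] at e5
    exact (ENNReal.ofReal_lt_ofReal_iff (by positivity)).1 e5
  calc dist u q ≤ dist (p n) u + dist (p n) q := dist_triangle_left _ _ _
    _ < ε := by linarith

end Cutoff

section Rellich

open scoped NNReal

variable {N : ℕ} {Ω : Set (E N)}

theorem ball_subset_of_notMem_layer {δ : ℝ} {x : E N} (hx : x ∈ Ω) (hx' : x ∉ layer Ω δ) :
    Metric.ball x δ ⊆ Ω := by
  intro y hy
  by_contra h
  refine hx' ⟨hx, Metric.mem_thickening_iff.2 ⟨y, h, ?_⟩⟩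
  rw [dist_comm]; exact hy

/-- Smooth functions vary little over small translations, in the mean. -/
theorem lintegral_translate_sub_le (hΩ : IsOpen Ω) {w : E N → ℝ} (hw : ContDiff ℝ ∞ w) {δ : ℝ}
    {z : E N} (hz : ‖z‖ < δ) :
    ∫⁻ x in Ω \ layer Ω δ, ‖w (x + z) - w x‖ₑ ^ 2
      ≤ ENNReal.ofReal δ ^ 2 * ∫⁻ x in Ω, ‖gradient w x‖ₑ ^ 2 := by
  have hgc := continuous_gradient_of_contDiff hw
  have hpt : ∀ x, ‖w (x + z) - w x‖ₑ ^ 2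
      ≤ ENNReal.ofReal δ ^ 2 * ∫⁻ t in Set.Ioc (0 : ℝ) 1, ‖gradient w (x + t • z)‖ₑ ^ 2 := by
    intro x
    have hd : ∀ t : ℝ, HasDerivAt (fun t : ℝ => w (x + t • z)) (fderiv ℝ w (x + t • z) z) t := by
      intro t
      have h1 : HasDerivAt (fun t : ℝ => x + t • z) z t := by
        simpa using ((hasDerivAt_id t).smul_const z).const_add x
      exact ((hw.differentiable (by simp)) (x + t • z)).hasFDerivAt.comp_hasDerivAt t h1
    have hcont : Continuous fun t : ℝ => fderiv ℝ w (x + t • z) z :=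
      ((hw.continuous_fderiv (by simp)).comp (by fun_prop)).clm_apply continuous_const
    have h1 := intervalIntegral.integral_eq_sub_of_hasDerivAt (a := 0) (b := 1)
      (fun t _ => hd t) (hcont.intervalIntegrable _ _)
    rw [one_smul, zero_smul, add_zero, intervalIntegral.integral_of_le zero_le_one] at h1
    rw [← h1]
    have h2 : ‖∫ t in Set.Ioc (0 : ℝ) 1, fderiv ℝ w (x + t • z) z‖ₑ
        ≤ ∫⁻ t in Set.Ioc (0 : ℝ) 1, ENNReal.ofReal δ * ‖gradient w (x + t • z)‖ₑ := by
      refine (enorm_integral_le_lintegral_enorm _).trans (lintegral_mono fun t => ?_)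
      rw [← ofReal_norm, ← ofReal_norm, ← ENNReal.ofReal_mul ((norm_nonneg z).trans hz.le)]
      refine ENNReal.ofReal_le_ofReal ?_
      rw [norm_gradient, mul_comm]
      exact ((fderiv ℝ w (x + t • z)).le_opNorm z).trans (by gcongr)
    rw [lintegral_const_mul' _ _ (by finiteness)] at h2
    refine (pow_le_pow_left' h2 2).trans ?_
    rw [mul_pow]
    gcongr
    refine (sq_lintegral_le _ ?_).trans (by simp)
    exact ((hgc.comp (by fun_prop : Continuous fun t : ℝ => x + t • z)).enorm).aemeasurable
  have hmeas : Measurable (Function.uncurry fun (x : E N) (t : ℝ) =>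
      ‖gradient w (x + t • z)‖ₑ ^ 2) :=
    ((hgc.comp (by fun_prop : Continuous fun p : E N × ℝ => p.1 + p.2 • z)).measurable.enorm).pow_const 2
  have hms : MeasurableSet (Ω \ layer Ω δ) := hΩ.measurableSet.diff (measurableSet_layer hΩ δ)
  calc _ ≤ ∫⁻ x in Ω \ layer Ω δ, ENNReal.ofReal δ ^ 2 *
        ∫⁻ t in Set.Ioc (0 : ℝ) 1, ‖gradient w (x + t • z)‖ₑ ^ 2 := lintegral_mono hpt
    _ = ENNReal.ofReal δ ^ 2 * ∫⁻ t in Set.Ioc (0 : ℝ) 1, (∫⁻ x in Ω \ layer Ω δ,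
        ‖gradient w (x + t • z)‖ₑ ^ 2) := by
      rw [lintegral_const_mul' _ _ (by finiteness), lintegral_lintegral_swap hmeas.aemeasurable]
    _ ≤ ENNReal.ofReal δ ^ 2 * ∫⁻ t in Set.Ioc (0 : ℝ) 1, (∫⁻ x in Ω, ‖gradient w x‖ₑ ^ 2) := by
      refine mul_le_mul_right ?_ _
      refine setLIntegral_mono' (μ := volume) measurableSet_Ioc fun t ht => ?_
      rw [← lintegral_indicator hms, ← lintegral_indicator hΩ.measurableSet,
        ← lintegral_add_right_eq_self (fun x => Ω.indicator (fun x => ‖gradient w x‖ₑ ^ 2) x)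
          (t • z)]
      refine lintegral_mono fun x => ?_
      by_cases hx : x ∈ Ω \ layer Ω δ
      · rw [Set.indicator_of_mem hx, Set.indicator_of_mem]
        refine ball_subset_of_notMem_layer hx.1 hx.2 ?_
        rw [Metric.mem_ball, dist_self_add_left, norm_smul, Real.norm_of_nonneg ht.1.le]
        exact (mul_le_of_le_one_left (norm_nonneg _) ht.2).trans_lt hz
      · rw [Set.indicator_of_notMem hx]; exact zero_le
    _ = _ := by simp

theorem tendsto_lintegral_sq_of_average (hN : 2 ≤ N) (hΩ : IsRegularDomain Ω) {w : ℕ → E N → ℝ}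
    (hw : ∀ n, ContDiff ℝ ∞ (w n)) {M : ℝ≥0}
    (hM : ∀ n, (∫⁻ x in Ω, ‖w n x‖ₑ ^ 2) + ∫⁻ x in Ω, ‖gradient (w n) x‖ₑ ^ 2 ≤ M)
    (hav : ∀ x r, 0 < r → Metric.ball x r ⊆ Ω →
      Tendsto (fun n => ∫ y in Metric.ball x r, w n y) atTop (𝓝 0)) :
    Tendsto (fun n => ∫⁻ x in Ω, ‖w n x‖ₑ ^ 2) atTop (𝓝 0) := by
  have := isFiniteMeasure_restrict hΩ.isBounded
  obtain ⟨C, δ₀, hδ₀, hC⟩ := exists_lintegral_layer_le hN hΩ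
  obtain ⟨B, hB⟩ := exists_lintegral_surface_le hN hΩ
  have hlayer : ∀ δ, 0 < δ → δ < min δ₀ 1 → ∀ n, ∫⁻ x in layer Ω δ, ‖w n x‖ₑ ^ 2
      ≤ C * (B + 1) * M * ENNReal.ofReal δ := by
    intro δ hδ hδ' n
    have h1 := hC δ hδ (hδ'.trans_le (min_le_left _ _)) (w n) (hw n)
    have h2 : ENNReal.ofReal δ ≤ 1 := ENNReal.ofReal_le_one.2 (hδ'.trans_le (min_le_right _ _)).le
    have h3 : ∫⁻ x in layer Ω (C * δ), ‖gradient (w n) x‖ₑ ^ 2 ≤ M :=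
      (lintegral_mono_set (layer_subset _)).trans (le_add_self.trans (hM n))
    have h4 : ∫⁻ x, ‖w n x‖ₑ ^ 2 ∂(surfaceMeasure Ω) ≤ B * M :=
      (hB (w n) (hw n)).trans (by gcongr; exact hM n)
    calc _ ≤ _ := h1
      _ ≤ C * ENNReal.ofReal δ * (B * M) + C * (ENNReal.ofReal δ * 1) * M := by
        gcongr
        rw [sq]; gcongr
      _ = _ := by ring
  have hint : ∀ δ, 0 < δ → ∃ V : ℝ≥0∞, V ≠ 0 ∧ V ≠ ⊤ ∧ ∀ n, ∫⁻ x in Ω \ layer Ω δ, ‖w n x‖ₑ ^ 2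
      ≤ V⁻¹ ^ 2 * 2 * (∫⁻ x in Ω \ layer Ω δ, ‖∫ y in Metric.ball x δ, w n y‖ₑ ^ 2)
        + 2 * M * ENNReal.ofReal δ ^ 2 := by
    intro δ hδ
    set V : ℝ≥0∞ := volume (Metric.ball (0 : E N) δ) with hV
    have hV0 : V ≠ 0 := (Metric.measure_ball_pos _ _ hδ).ne'
    have hVt : V ≠ ⊤ := measure_ball_lt_top.ne
    have hVx : ∀ x : E N, volume (Metric.ball x δ) = V := fun x => Measure.addHaar_ball_center _ _ _
    refine ⟨V, hV0, hVt, fun n => ?_⟩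
    have hc := (hw n).continuous
    have hpt : ∀ x, V ^ 2 * ‖w n x‖ₑ ^ 2 ≤ 2 * ‖∫ y in Metric.ball x δ, w n y‖ₑ ^ 2
        + 2 * (V * ∫⁻ z in Metric.ball (0 : E N) δ, ‖w n (x + z) - w n x‖ₑ ^ 2) := by
      intro x
      have hfin : volume (Metric.ball x δ) ≠ ⊤ := measure_ball_lt_top.ne
      have hi : IntegrableOn (w n) (Metric.ball x δ) :=
        (hc.continuousOn.integrableOn_compact (isCompact_closedBall x δ)).mono_set
          Metric.ball_subset_closedBall
      have h1 : (∫ y in Metric.ball x δ, w n y) - (∫ y in Metric.ball x δ, (w n y - w n x))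
          = (volume.real (Metric.ball x δ)) * w n x := by
        rw [integral_sub hi (integrableOn_const hfin), setIntegral_const, smul_eq_mul]
        ring
      have h2 : V * ‖w n x‖ₑ ≤ ‖∫ y in Metric.ball x δ, w n y‖ₑ
          + ∫⁻ z in Metric.ball (0 : E N) δ, ‖w n (x + z) - w n x‖ₑ := by
        have e1 : V * ‖w n x‖ₑ = ‖(volume.real (Metric.ball x δ)) * w n x‖ₑ := by
          rw [enorm_mul, Real.enorm_of_nonneg measureReal_nonneg, ofReal_measureReal hfin, hVx]
        rw [e1, ← h1]
        refine (enorm_sub_le).trans ?_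
        gcongr
        refine (enorm_integral_le_lintegral_enorm _).trans (le_of_eq ?_)
        rw [← lintegral_indicator measurableSet_ball, ← lintegral_indicator measurableSet_ball,
          ← lintegral_add_left_eq_self _ x]
        refine lintegral_congr fun z => ?_
        by_cases hz : z ∈ Metric.ball (0 : E N) δ
        · rw [Set.indicator_of_mem hz, Set.indicator_of_mem (by simpa using hz)]
        · rw [Set.indicator_of_notMem hz, Set.indicator_of_notMem (by simpa using hz)]
      calc V ^ 2 * ‖w n x‖ₑ ^ 2 = (V * ‖w n x‖ₑ) ^ 2 := (mul_pow _ _ _).symm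
        _ ≤ _ := pow_le_pow_left' h2 2
        _ ≤ _ := ennreal_add_sq_le _ _
        _ ≤ _ := by
          gcongr
          refine (sq_lintegral_le _ ?_).trans (by rw [Measure.restrict_apply_univ])
          exact (((hc.comp (by fun_prop : Continuous fun z => x + z)).sub
            continuous_const).enorm).aemeasurable
    have hmeas : Measurable (Function.uncurry fun (x z : E N) => ‖w n (x + z) - w n x‖ₑ ^ 2) :=
      ((((hc.comp (by fun_prop : Continuous fun p : E N × E N => p.1 + p.2)).sub
        (hc.comp continuous_fst)).measurable).enorm).pow_const 2
    have hmeas2 : Measurable fun x => ∫⁻ z in Metric.ball (0 : E N) δ, ‖w n (x + z) - w n x‖ₑ ^ 2 :=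
      hmeas.lintegral_prod_right
    have h3 : V ^ 2 * ∫⁻ x in Ω \ layer Ω δ, ‖w n x‖ₑ ^ 2
        ≤ 2 * (∫⁻ x in Ω \ layer Ω δ, ‖∫ y in Metric.ball x δ, w n y‖ₑ ^ 2)
          + 2 * (V * (V * (ENNReal.ofReal δ ^ 2 * M))) := by
      rw [← lintegral_const_mul' _ _ (by finiteness)]
      refine (lintegral_mono hpt).trans ?_
      rw [lintegral_add_right _ ((hmeas2.const_mul _).const_mul _),
        lintegral_const_mul' _ _ (by finiteness), lintegral_const_mul' _ _ (by finiteness),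
        lintegral_const_mul' _ _ hVt]
      gcongr
      rw [lintegral_lintegral_swap hmeas.aemeasurable]
      calc _ ≤ ∫⁻ z in Metric.ball (0 : E N) δ, (ENNReal.ofReal δ ^ 2 * M) := by
            refine setLIntegral_mono' measurableSet_ball fun z hz => ?_
            refine (lintegral_translate_sub_le hΩ.isOpen (hw n) (by simpa using hz)).trans ?_
            gcongr
            exact le_add_self.trans (hM n)
        _ = _ := by rw [setLIntegral_const, mul_comm]
    have e : ∀ X : ℝ≥0∞, V⁻¹ ^ 2 * (V ^ 2 * X) = X := fun X => by
      rw [← mul_assoc, ← mul_pow, ENNReal.inv_mul_cancel hV0 hVt, one_pow, one_mul]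
    rw [← e (∫⁻ x in Ω \ layer Ω δ, ‖w n x‖ₑ ^ 2)]
    refine (mul_le_mul_right h3 _).trans (le_of_eq ?_)
    rw [mul_add]
    have e2 : (2 : ℝ≥0∞) * (V * (V * (ENNReal.ofReal δ ^ 2 * M)))
      = V ^ 2 * (2 * M * ENNReal.ofReal δ ^ 2) := by ring
    rw [e2, e]
    ring
  have hdct : ∀ δ, 0 < δ → Tendsto (fun n => ∫⁻ x in Ω \ layer Ω δ,
      ‖∫ y in Metric.ball x δ, w n y‖ₑ ^ 2) atTop (𝓝 0) := by
    intro δ hδ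
    have hms : MeasurableSet (Ω \ layer Ω δ) :=
      hΩ.isOpen.measurableSet.diff (measurableSet_layer hΩ.isOpen δ)
    have hVx : ∀ x : E N, volume (Metric.ball x δ) = volume (Metric.ball (0 : E N) δ) :=
      fun x => Measure.addHaar_ball_center _ _ _
    set V : ℝ≥0∞ := volume (Metric.ball (0 : E N) δ) with hV
    have hVt : V ≠ ⊤ := measure_ball_lt_top.ne
    have h0 : (0 : ℝ≥0∞) = ∫⁻ x in Ω \ layer Ω δ, 0 := by simp
    rw [h0]
    refine tendsto_lintegral_filter_of_dominated_convergence (fun _ => V * M) ?_ ?_ ?_ ?_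
    · refine Eventually.of_forall fun n => ?_
      have e1 : ∀ x, ∫ y in Metric.ball x δ, w n y
          = ∫ z, (Metric.ball (0 : E N) δ).indicator (fun _ => (1 : ℝ)) z * w n (x + z) := by
        intro x
        rw [← integral_indicator measurableSet_ball,
          ← integral_add_left_eq_self _ x]
        refine integral_congr_ae (Eventually.of_forall fun z => ?_)
        by_cases hz : z ∈ Metric.ball (0 : E N) δ
        · simp only
          rw [Set.indicator_of_mem hz, Set.indicator_of_mem (by simpa using hz), one_mul]
        · simp only
          rw [Set.indicator_of_notMem hz, Set.indicator_of_notMem (by simpa using hz), zero_mul]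
      have hsm : StronglyMeasurable fun x => ∫ y in Metric.ball x δ, w n y := by
        simp only [e1]
        refine StronglyMeasurable.integral_prod_right (f := fun x z =>
          (Metric.ball (0 : E N) δ).indicator (fun _ => (1 : ℝ)) z * w n (x + z)) ?_
        refine Measurable.stronglyMeasurable (Measurable.mul ?_ ?_)
        · exact ((measurable_const.indicator measurableSet_ball)).comp measurable_snd
        · exact ((hw n).continuous.comp
            (by fun_prop : Continuous fun p : E N × E N => p.1 + p.2)).measurable
      exact (hsm.measurable.enorm).pow_const 2
    · refine Eventually.of_forall fun n => ?_
      refine (ae_restrict_iff' hms).2 (Eventually.of_forall fun x hx => ?_)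
      refine (pow_le_pow_left' (enorm_integral_le_lintegral_enorm _) 2).trans
        ((sq_lintegral_le _ ((hw n).continuous.enorm).aemeasurable).trans ?_)
      rw [Measure.restrict_apply_univ, hVx]
      gcongr
      exact (lintegral_mono_set (ball_subset_of_notMem_layer hx.1 hx.2)).trans
        (le_self_add.trans (hM n))
    · rw [lintegral_const]
      refine ENNReal.mul_ne_top (by finiteness) ?_
      rw [Measure.restrict_apply_univ]
      exact (hΩ.isBounded.subset Set.sdiff_subset).measure_lt_top.ne
    · refine (ae_restrict_iff' hms).2 (Eventually.of_forall fun x hx => ?_)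
      have h1 := hav x δ hδ (ball_subset_of_notMem_layer hx.1 hx.2)
      have h2 := ENNReal.Tendsto.pow (n := 2) ((continuous_enorm.tendsto (0 : ℝ)).comp h1)
      simpa [Function.comp_def] using h2
  rw [ENNReal.tendsto_nhds_zero]
  intro ε hε
  have hsmall : Tendsto (fun δ : ℝ => C * (B + 1) * M * ENNReal.ofReal δ
      + 2 * M * ENNReal.ofReal δ ^ 2) (𝓝[>] 0) (𝓝 0) := by
    have h1 : Tendsto (fun δ : ℝ => ENNReal.ofReal δ) (𝓝[>] 0) (𝓝 0) := by
      have := (ENNReal.continuous_ofReal.tendsto 0)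
      rw [ENNReal.ofReal_zero] at this
      exact this.mono_left nhdsWithin_le_nhds
    have h2 := (ENNReal.Tendsto.const_mul (a := (C * (B + 1) * M : ℝ≥0∞)) h1
      (Or.inr (by finiteness))).add
      (ENNReal.Tendsto.const_mul (a := (2 * M : ℝ≥0∞)) (ENNReal.Tendsto.pow (n := 2) h1)
        (Or.inr (by finiteness)))
    simpa using h2
  obtain ⟨δ, hδε, hδ0, hδ1⟩ := ((hsmall.eventually_lt_const hε).and
    (Ioo_mem_nhdsGT (by positivity : (0 : ℝ) < min δ₀ 1))).exists
  obtain ⟨V, hV0, hVt, hVn⟩ := hint δ hδ0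
  have hlim : Tendsto (fun n => V⁻¹ ^ 2 * 2 * (∫⁻ x in Ω \ layer Ω δ,
      ‖∫ y in Metric.ball x δ, w n y‖ₑ ^ 2) + (C * (B + 1) * M * ENNReal.ofReal δ
      + 2 * M * ENNReal.ofReal δ ^ 2)) atTop (𝓝 (0 + (C * (B + 1) * M * ENNReal.ofReal δ
      + 2 * M * ENNReal.ofReal δ ^ 2))) := by
    refine Tendsto.add ?_ tendsto_const_nhds
    have hVi : V⁻¹ ≠ ⊤ := ENNReal.inv_ne_top.2 hV0
    have := ENNReal.Tendsto.const_mul (a := V⁻¹ ^ 2 * 2) (hdct δ hδ0) (Or.inr (by finiteness))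
    simpa using this
  rw [zero_add] at hlim
  filter_upwards [hlim.eventually_lt_const hδε] with n hn
  refine le_trans ?_ hn.le
  have hsplit : ∫⁻ x in Ω, ‖w n x‖ₑ ^ 2 ≤ (∫⁻ x in Ω \ layer Ω δ, ‖w n x‖ₑ ^ 2)
      + ∫⁻ x in layer Ω δ, ‖w n x‖ₑ ^ 2 := by
    refine le_trans (lintegral_mono_set ?_) (lintegral_union_le _ _ _)
    rw [Set.sdiff_union_self]; exact Set.subset_union_left
  refine hsplit.trans ((add_le_add (hVn n) (hlayer δ hδ0 hδ1 n)).trans (le_of_eq ?_))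
  ring

/-- Compact embedding of `H¹(Ω)` into `L²(Ω)`, for functions with a trace. -/
theorem tendsto_H1fun_of_weak (hN : 2 ≤ N) (hΩ : IsRegularDomain Ω) {u : ℕ → H1 Ω}
    {φ : ℕ → L2Boundary Ω} (hu : ∀ n, HasTrace Ω (u n) (φ n)) {M : ℝ} (hM : ∀ n, ‖u n‖ ≤ M)
    (hweak : ∀ g, Tendsto (fun n => inner ℝ (u n) g) atTop (𝓝 0)) :
    Tendsto (fun n => H1fun (u n)) atTop (𝓝 0) := by
  have hfin := isFiniteMeasure_restrict hΩ.isBounded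
  have hex : ∀ n : ℕ, ∃ (p : H1 Ω) (w : E N → ℝ), ContDiff ℝ ∞ w ∧
      H1fun p =ᵐ[volume.restrict Ω] w ∧ H1grad p =ᵐ[volume.restrict Ω] gradient w ∧
      ‖u n - p‖ < 1 / ((n : ℝ) + 1) := by
    intro n
    obtain ⟨p, ψ, w, a1, a2, a3, -, a5, -⟩ := (hu n).exists_seq
    obtain ⟨m, hm⟩ := (Metric.tendsto_nhds.1 a5 (1 / ((n : ℝ) + 1)) (by positivity)).exists
    refine ⟨p m, w m, a1 m, a2 m, a3 m, ?_⟩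
    rwa [dist_comm, dist_eq_norm] at hm
  choose p w hw h1 h2 h3 using hex
  have hdiff : Tendsto (fun n => u n - p n) atTop (𝓝 0) := by
    rw [tendsto_zero_iff_norm_tendsto_zero]
    exact squeeze_zero (fun n => norm_nonneg _) (fun n => (h3 n).le)
      tendsto_one_div_add_atTop_nhds_zero_nat
  have hpM : ∀ n, ‖p n‖ ≤ M + 1 := by
    intro n
    have e1 : ‖p n‖ ≤ ‖u n‖ + ‖u n - p n‖ := by
      have := norm_sub_le (u n) (u n - p n)
      rwa [sub_sub_cancel] at this
    have e2 : 1 / ((n : ℝ) + 1) ≤ 1 := by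
      rw [div_le_one (by positivity)]; linarith [n.cast_nonneg (α := ℝ)]
    linarith [hM n, h3 n]
  have hpweak : ∀ g, Tendsto (fun n => inner ℝ (p n) g) atTop (𝓝 0) := by
    intro g
    have e1 : Tendsto (fun n => inner ℝ (u n - p n) g) atTop (𝓝 (inner ℝ (0 : H1 Ω) g)) :=
      hdiff.inner tendsto_const_nhds
    have e2 := (hweak g).sub e1
    rw [inner_zero_left, sub_zero] at e2
    refine e2.congr fun n => ?_
    rw [← inner_sub_left, sub_sub_cancel]
  have hel : ∀ n, ∫⁻ x in Ω, ‖w n x‖ₑ ^ 2 = ‖H1fun (p n)‖ₑ ^ 2 := by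
    intro n
    rw [Lp_enorm_sq]
    refine lintegral_congr_ae ?_
    filter_upwards [h1 n] with x hx
    rw [hx]
  have heg : ∀ n, ∫⁻ x in Ω, ‖gradient (w n) x‖ₑ ^ 2 = ‖H1grad (p n)‖ₑ ^ 2 := by
    intro n
    rw [Lp_enorm_sq]
    refine lintegral_congr_ae ?_
    filter_upwards [h2 n] with x hx
    rw [hx]
  have hM0 : 0 ≤ M + 1 := (norm_nonneg _).trans (hpM 0)
  have key := tendsto_lintegral_sq_of_average hN hΩ hw (M := Real.toNNReal ((M + 1) ^ 2))
    (fun n => ?_) (fun x r hr hsub => ?_)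
  · have e1 : Tendsto (fun n => H1fun (p n)) atTop (𝓝 0) := by
      rw [tendsto_zero_iff_norm_tendsto_zero]
      simp only [hel] at key
      have := (ENNReal.tendsto_toReal ENNReal.zero_ne_top).comp key
      simp only [Function.comp_def, ENNReal.toReal_pow, toReal_enorm, ENNReal.toReal_zero] at this
      have h5 := (Real.continuous_sqrt.tendsto 0).comp this
      simpa [Function.comp_def] using h5
    have e2 := ((continuous_H1fun.tendsto (0 : H1 Ω)).comp hdiff).add e1
    have e3 : H1fun (0 : H1 Ω) + 0 = 0 := by rw [add_zero]; rfl
    rw [e3] at e2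
    refine e2.congr fun n => ?_
    simp only [Function.comp_apply]
    rw [H1fun_sub, sub_add_cancel]
  · rw [hel, heg, ← H1_enorm_sq]
    have : ‖p n‖ₑ ≤ ENNReal.ofReal (M + 1) := by
      rw [← ofReal_norm]; exact ENNReal.ofReal_le_ofReal (hpM n)
    refine (pow_le_pow_left' this 2).trans (le_of_eq ?_)
    rw [← ENNReal.ofReal_pow hM0]
    rfl
  · have hfinr : (volume.restrict Ω) (Metric.ball x r) ≠ ⊤ := measure_ne_top _ _
    set b : Lp ℝ 2 (volume.restrict Ω) := indicatorConstLp 2 measurableSet_ball hfinr (1 : ℝ)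
      with hb
    set ℓ : H1 Ω →L[ℝ] ℝ := (innerSL ℝ b).comp (H1funL Ω) with hℓ
    have e1 := hpweak ((InnerProductSpace.toDual ℝ (H1 Ω)).symm ℓ)
    refine e1.congr fun n => ?_
    rw [real_inner_comm, InnerProductSpace.toDual_symm_apply]
    change inner ℝ b (H1fun (p n)) = _
    rw [hb, L2.inner_indicatorConstLp_one,
      Measure.restrict_restrict measurableSet_ball, Set.inter_eq_left.2 hsub]
    refine integral_congr_ae ?_
    exact ae_restrict_of_ae_restrict_of_subset hsub (h1 n)

end Rellich

section Forms

variable {N : ℕ} {Ω : Set (E N)}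

/-- Multiplication by an essentially bounded function on `L²`. -/
def mulL {α : Type*} (F : Type*) [MeasurableSpace α] {μ : Measure α} [NormedAddCommGroup F]
    [InnerProductSpace ℝ F] {a : α → ℝ} (ha : MemLp a ∞ μ) : Lp F 2 μ →L[ℝ] Lp F 2 μ :=
  (ContinuousLinearMap.lsmul ℝ ℝ : ℝ →L[ℝ] F →L[ℝ] F).holderL μ ∞ 2 2 ha.toLp

theorem mulL_coeFn {α F : Type*} [MeasurableSpace α] {μ : Measure α} [NormedAddCommGroup F]
    [InnerProductSpace ℝ F] {a : α → ℝ} (ha : MemLp a ∞ μ) (f : Lp F 2 μ) :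
    mulL F ha f =ᵐ[μ] fun x => a x • f x := by
  filter_upwards [(ContinuousLinearMap.lsmul ℝ ℝ : ℝ →L[ℝ] F →L[ℝ] F).coeFn_holder
    (r := 2) ha.toLp f, ha.coeFn_toLp] with x h1 h2
  have h3 : mulL F ha f x = ((ContinuousLinearMap.lsmul ℝ ℝ : ℝ →L[ℝ] F →L[ℝ] F)
    (ha.toLp a x)) (f x) := h1
  rw [h3, h2]; rfl

theorem inner_mulL {α F : Type*} [MeasurableSpace α] {μ : Measure α} [NormedAddCommGroup F]
    [InnerProductSpace ℝ F] {a : α → ℝ} (ha : MemLp a ∞ μ) (f g : Lp F 2 μ) :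
    inner ℝ (mulL F ha f) g = ∫ x, a x * inner ℝ (f x) (g x) ∂μ := by
  rw [L2.inner_def]
  refine integral_congr_ae ?_
  filter_upwards [mulL_coeFn ha f] with x hx
  rw [hx, real_inner_smul_left]

theorem integrable_mul_inner {α F : Type*} [MeasurableSpace α] {μ : Measure α}
    [NormedAddCommGroup F] [InnerProductSpace ℝ F] {a : α → ℝ} (ha : MemLp a ∞ μ)
    (f g : Lp F 2 μ) : Integrable (fun x => a x * inner ℝ (f x) (g x)) μ := by
  refine (L2.integrable_inner (𝕜 := ℝ) (mulL F ha f) g).congr ?_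
  filter_upwards [mulL_coeFn ha f] with x hx
  rw [hx, real_inner_smul_left]

/-- The bilinear form `∫ a ∇u·∇v - b u v` on `H¹(Ω)`. -/
def form {a b : E N → ℝ} (ha : MemLp a ∞ (volume.restrict Ω)) (hb : MemLp b ∞ (volume.restrict Ω))
    (u v : H1 Ω) : ℝ :=
  inner ℝ (mulL (E N) ha (H1grad u)) (H1grad v) - inner ℝ (mulL ℝ hb (H1fun u)) (H1fun v)

section

variable {a b : E N → ℝ} (ha : MemLp a ∞ (volume.restrict Ω))
  (hb : MemLp b ∞ (volume.restrict Ω))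

theorem form_add_left (u u' v : H1 Ω) :
    form ha hb (u + u') v = form ha hb u v + form ha hb u' v := by
  simp only [form, H1grad_add, H1fun_add, map_add, inner_add_left]; ring

theorem form_smul_left (c : ℝ) (u v : H1 Ω) : form ha hb (c • u) v = c * form ha hb u v := by
  simp only [form, H1grad_smul, H1fun_smul, map_smul, real_inner_smul_left]; ring

theorem form_comm (u v : H1 Ω) : form ha hb u v = form ha hb v u := by
  rw [form, form, inner_mulL, inner_mulL, inner_mulL, inner_mulL]
  congr 1 <;> exact integral_congr_ae (Eventually.of_forall fun x => by
    simp only; rw [real_inner_comm])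

theorem form_add_right (u v v' : H1 Ω) :
    form ha hb u (v + v') = form ha hb u v + form ha hb u v' := by
  rw [form_comm, form_add_left, form_comm _ _ v, form_comm _ _ v']

theorem form_smul_right (c : ℝ) (u v : H1 Ω) : form ha hb u (c • v) = c * form ha hb u v := by
  rw [form_comm, form_smul_left, form_comm]

theorem form_sub_left (u u' v : H1 Ω) :
    form ha hb (u - u') v = form ha hb u v - form ha hb u' v := by
  simp only [form, H1grad_sub, H1fun_sub, map_sub, inner_sub_left]; ring

theorem form_sub_right (u v v' : H1 Ω) :
    form ha hb u (v - v') = form ha hb u v - form ha hb u v' := by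
  rw [form_comm, form_sub_left, form_comm _ _ v, form_comm _ _ v']

theorem continuous_form : Continuous fun p : H1 Ω × H1 Ω => form ha hb p.1 p.2 := by
  unfold form
  have h1 := (mulL (E N) ha).continuous
  have h2 := (mulL ℝ hb).continuous
  have h3 : Continuous (H1fun : H1 Ω → _) := continuous_H1fun
  have h4 : Continuous (H1grad : H1 Ω → _) := continuous_H1grad
  exact ((h1.comp (h4.comp continuous_fst)).inner (h4.comp continuous_snd)).sub
    ((h2.comp (h3.comp continuous_fst)).inner (h3.comp continuous_snd))

theorem exists_abs_form_le : ∃ Λ : ℝ, 0 ≤ Λ ∧ ∀ u v, |form ha hb u v| ≤ Λ * ‖u‖ * ‖v‖ := by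
  refine ⟨‖mulL (E N) ha‖ + ‖mulL ℝ hb‖, by positivity, fun u v => ?_⟩
  have h1 : |inner ℝ (mulL (E N) ha (H1grad u)) (H1grad v)| ≤ ‖mulL (E N) ha‖ * ‖u‖ * ‖v‖ := by
    refine (abs_real_inner_le_norm _ _).trans ?_
    gcongr
    · exact ((mulL (E N) ha).le_opNorm _).trans (by gcongr; exact norm_H1grad_le u)
    · exact norm_H1grad_le v
  have h2 : |inner ℝ (mulL ℝ hb (H1fun u)) (H1fun v)| ≤ ‖mulL ℝ hb‖ * ‖u‖ * ‖v‖ := by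
    refine (abs_real_inner_le_norm _ _).trans ?_
    gcongr
    · exact ((mulL ℝ hb).le_opNorm _).trans (by gcongr; exact norm_H1fun_le u)
    · exact norm_H1fun_le v
  calc _ ≤ _ := abs_sub _ _
    _ ≤ _ := add_le_add h1 h2
    _ = _ := by ring

/-- Bilinear forms are weakly continuous in each argument. -/
theorem tendsto_form_of_weak {ι : Type*} {l : Filter ι} {u : ι → H1 Ω} {v : H1 Ω}
    (hw : ∀ g, Tendsto (fun n => inner ℝ (u n) g) l (𝓝 (inner ℝ v g))) (w : H1 Ω) :
    Tendsto (fun n => form ha hb w (u n)) l (𝓝 (form ha hb w v)) := by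
  set ℓ : H1 Ω →L[ℝ] ℝ := (innerSL ℝ (mulL (E N) ha (H1grad w))).comp (H1gradL Ω)
    - (innerSL ℝ (mulL ℝ hb (H1fun w))).comp (H1funL Ω) with hℓ
  have e : ∀ z, form ha hb w z = inner ℝ z ((InnerProductSpace.toDual ℝ (H1 Ω)).symm ℓ) := by
    intro z
    rw [real_inner_comm, InnerProductSpace.toDual_symm_apply]
    rfl
  simp only [e]
  exact hw _

theorem form_self (u : H1 Ω) : form ha hb u u
    = ∫ x in Ω, (a x * ‖H1grad u x‖ ^ 2 - b x * H1fun u x ^ 2) := by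
  rw [form, inner_mulL, inner_mulL, ← integral_sub (integrable_mul_inner ha _ _)
    (integrable_mul_inner hb _ _)]
  refine integral_congr_ae (Eventually.of_forall fun x => ?_)
  simp only [real_inner_self_eq_norm_sq, Real.norm_eq_abs, sq_abs]

end

/-- The subspace of functions with zero trace. -/
def traceZero (Ω : Set (E N)) : Submodule ℝ (H1 Ω) where
  carrier := {u | HasTrace Ω u 0}
  zero_mem' := HasTrace.zero
  add_mem' := fun {u v} hu hv => by simpa using HasTrace.add hu hv
  smul_mem' := fun c u hu => by simpa using HasTrace.smul hu c

theorem mem_traceZero {u : H1 Ω} : u ∈ traceZero Ω ↔ HasTrace Ω u 0 := Iff.rfl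

theorem isClosed_traceZero : IsClosed (traceZero Ω : Set (H1 Ω)) := by
  refine isClosed_of_closure_subset fun u hu => ?_
  obtain ⟨x, hx, hlim⟩ := mem_closure_iff_seq_limit.1 hu
  exact HasTrace.of_tendsto hlim tendsto_const_nhds hx

theorem HasTrace.of_weak_zero {u : ℕ → H1 Ω} {v : H1 Ω} (hu : ∀ n, HasTrace Ω (u n) 0)
    (hw : ∀ g, Tendsto (fun n => inner ℝ (u n) g) atTop (𝓝 (inner ℝ v g))) :
    HasTrace Ω v 0 := by
  have : CompleteSpace (traceZero Ω) := isClosed_traceZero.completeSpace_coe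
  rw [← mem_traceZero, ← Submodule.orthogonal_orthogonal (traceZero Ω),
    Submodule.mem_orthogonal']
  intro g hg
  refine tendsto_nhds_unique (hw g) ?_
  have e : ∀ n, inner ℝ (u n) g = 0 := fun n =>
    (Submodule.mem_orthogonal _ _).1 hg (u n) (hu n)
  simp only [e]
  exact tendsto_const_nhds

theorem tendsto_sub_inner_zero {H : Type*} [NormedAddCommGroup H] [InnerProductSpace ℝ H]
    {u : ℕ → H} {v : H}
    (hw : ∀ g, Tendsto (fun n => inner ℝ (u n) g) atTop (𝓝 (inner ℝ v g))) (g : H) :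
    Tendsto (fun n => inner ℝ (u n - v) g) atTop (𝓝 0) := by
  have := (hw g).sub_const (inner ℝ v g)
  rw [sub_self] at this
  exact this.congr fun n => (inner_sub_left _ _ _).symm

theorem memLp_top_of_sq {d : E N → ℝ} (hΩ : IsRegularDomain Ω) (hd : ContinuousOn d (closure Ω)) :
    MemLp (fun x => d x ^ 2) ∞ (volume.restrict Ω) := by
  obtain ⟨C, hC⟩ := hΩ.isBounded.isCompact_closure.exists_bound_of_continuousOn (hd.pow 2)
  refine memLp_top_of_bound (((hd.mono subset_closure).pow 2).aestronglyMeasurable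
    hΩ.isOpen.measurableSet) C ?_
  exact (ae_restrict_iff' hΩ.isOpen.measurableSet).2
    (Eventually.of_forall fun x hx => hC x (subset_closure hx))

theorem exists_sq_lower_bound {d : E N → ℝ} (hΩ : IsRegularDomain Ω)
    (hd : ContinuousOn d (closure Ω)) (hd_pos : ∀ x ∈ closure Ω, 0 < d x) :
    ∃ m > 0, ∀ x ∈ Ω, m ≤ d x ^ 2 := by
  obtain ⟨x₀, hx₀, hmin⟩ := hΩ.isBounded.isCompact_closure.exists_isMinOn
    (hΩ.isConnected.nonempty.mono subset_closure) hd
  refine ⟨d x₀ ^ 2, pow_pos (hd_pos _ hx₀) 2, fun x hx => ?_⟩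
  exact pow_le_pow_left₀ (hd_pos _ hx₀).le (hmin (subset_closure hx)) 2

theorem memLp_zero_top : MemLp (fun _ : E N => (0 : ℝ)) ∞ (volume.restrict Ω) :=
  memLp_top_const 0

/-- The Dirichlet form `∫ a ∇u·∇v`. -/
abbrev gform {a : E N → ℝ} (ha : MemLp a ∞ (volume.restrict Ω)) : H1 Ω → H1 Ω → ℝ :=
  form ha memLp_zero_top

theorem mul_norm_grad_sq_le_gform (hΩ : IsOpen Ω) {a : E N → ℝ}
    (ha : MemLp a ∞ (volume.restrict Ω)) {m : ℝ} (hm : ∀ x ∈ Ω, m ≤ a x) (u : H1 Ω) :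
    m * ‖H1grad u‖ ^ 2 ≤ gform ha u u := by
  have h0 := memLp_zero_top (Ω := Ω)
  rw [gform, form_self, Lp_norm_sq, ← integral_const_mul]
  have h1 : Integrable (fun x => ‖H1grad u x‖ ^ 2) (volume.restrict Ω) :=
    (Lp.memLp (H1grad u)).norm.integrable_sq
  have h2 : Integrable (fun x => a x * ‖H1grad u x‖ ^ 2) (volume.restrict Ω) := by
    simpa only [real_inner_self_eq_norm_sq] using integrable_mul_inner ha (H1grad u) (H1grad u)
  refine setIntegral_mono_on (h1.const_mul _) (by simpa [IntegrableOn] using h2) hΩ.measurableSet fun x hx => ?_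
  have := mul_le_mul_of_nonneg_right (hm x hx) (sq_nonneg ‖H1grad u x‖)
  simpa using this

theorem form_eq_gform_sub {a b : E N → ℝ} (ha : MemLp a ∞ (volume.restrict Ω))
    (hb : MemLp b ∞ (volume.restrict Ω)) (u v : H1 Ω) :
    form ha hb u v = gform ha u v - inner ℝ (mulL ℝ hb (H1fun u)) (H1fun v) := by
  have : inner ℝ (mulL ℝ (memLp_zero_top (Ω := Ω)) (H1fun u)) (H1fun v) = 0 := by
    rw [inner_mulL]; simp
  rw [gform, form, form, this, sub_zero]

/-- Coercivity on functions with zero trace. -/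
theorem exists_coercive (hN : 2 ≤ N) (hΩ : IsRegularDomain Ω) {a b : E N → ℝ}
    (ha : MemLp a ∞ (volume.restrict Ω)) (hb : MemLp b ∞ (volume.restrict Ω)) {m : ℝ}
    (hm0 : 0 < m) (hm : ∀ x ∈ Ω, m ≤ a x)
    (hpos : ∀ w ∈ H10 Ω, w ≠ 0 →
      0 < ∫ x in Ω, (a x * ‖H1grad w x‖ ^ 2 - b x * H1fun w x ^ 2)) :
    ∃ c > 0, ∀ w, HasTrace Ω w 0 → c * ‖w‖ ^ 2 ≤ form ha hb w w := by
  by_contra hcon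
  push Not at hcon
  choose w hw0 hw1 using fun n : ℕ => hcon (1 / ((n : ℝ) + 1)) (by positivity)
  have hwne : ∀ n, ‖w n‖ ≠ 0 := by
    intro n h0
    have h1 := hw1 n
    have : w n = 0 := norm_eq_zero.1 h0
    rw [this, ← zero_smul ℝ (0 : H1 Ω), form_smul_left] at h1
    simp at h1
  set v : ℕ → H1 Ω := fun n => ‖w n‖⁻¹ • w n with hv
  have hv1 : ∀ n, ‖v n‖ = 1 := fun n => by
    rw [hv]; simp only; rw [norm_smul, norm_inv, norm_norm, inv_mul_cancel₀ (hwne n)]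
  have hv0 : ∀ n, HasTrace Ω (v n) 0 := fun n => by
    have := (hw0 n).smul (‖w n‖⁻¹)
    rw [smul_zero] at this
    exact this
  have hvQ : ∀ n : ℕ, form ha hb (v n) (v n) ≤ 1 / ((n : ℝ) + 1) := by
    intro n
    rw [hv]; simp only
    rw [form_smul_left, form_smul_right]
    have h1 := (hw1 n).le
    have h2 : (0 : ℝ) ≤ ‖w n‖⁻¹ * ‖w n‖⁻¹ := by positivity
    have h3 := mul_le_mul_of_nonneg_left h1 h2
    have h4 : ‖w n‖⁻¹ * ‖w n‖⁻¹ * (1 / ((n : ℝ) + 1) * ‖w n‖ ^ 2) = 1 / ((n : ℝ) + 1) := by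
      have := hwne n
      field_simp
    rw [h4] at h3
    linarith
  obtain ⟨V, σ, hσ, hweak⟩ := exists_weak_limit v 1 fun n => (hv1 n).le
  have hV0 : HasTrace Ω V 0 := HasTrace.of_weak_zero (fun n => hv0 (σ n)) hweak
  have hstrong : Tendsto (fun n => H1fun (v (σ n) - V)) atTop (𝓝 0) := by
    refine tendsto_H1fun_of_weak hN hΩ (φ := fun _ => 0) (fun n => ?_) (M := 1 + ‖V‖) (fun n => ?_)
      (tendsto_sub_inner_zero hweak)
    · simpa using (hv0 (σ n)).sub hV0
    · exact (norm_sub_le _ _).trans (by rw [hv1])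
  have hstrong' : Tendsto (fun n => H1fun (v (σ n))) atTop (𝓝 (H1fun V)) := by
    have := hstrong.add_const (H1fun V)
    rw [zero_add] at this
    exact this.congr fun n => by rw [H1fun_sub, sub_add_cancel]
  have hB : Tendsto (fun n => inner ℝ (mulL ℝ hb (H1fun (v (σ n)))) (H1fun (v (σ n)))) atTop
      (𝓝 (inner ℝ (mulL ℝ hb (H1fun V)) (H1fun V))) :=
    (((mulL ℝ hb).continuous.tendsto _).comp hstrong').inner hstrong'
  have hε : Tendsto (fun n => 1 / ((σ n : ℝ) + 1)) atTop (𝓝 0) :=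
    tendsto_one_div_add_atTop_nhds_zero_nat.comp hσ.tendsto_atTop
  have hglow : ∀ u, 0 ≤ gform ha u u := fun u =>
    le_trans (by positivity) (mul_norm_grad_sq_le_gform hΩ.isOpen ha hm u)
  have hQV : form ha hb V V ≤ 0 := by
    have h1 : Tendsto (fun n => 2 * gform ha V (v (σ n)) - gform ha V V
        - inner ℝ (mulL ℝ hb (H1fun (v (σ n)))) (H1fun (v (σ n)))) atTop
        (𝓝 (2 * gform ha V V - gform ha V V - inner ℝ (mulL ℝ hb (H1fun V)) (H1fun V))) :=
      (((tendsto_form_of_weak ha memLp_zero_top hweak V).const_mul 2).sub_const _).sub hB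
    have h2 : ∀ n, 2 * gform ha V (v (σ n)) - gform ha V V
        - inner ℝ (mulL ℝ hb (H1fun (v (σ n)))) (H1fun (v (σ n))) ≤ 1 / ((σ n : ℝ) + 1) := by
      intro n
      refine le_trans ?_ (hvQ (σ n))
      rw [form_eq_gform_sub]
      have h3 := hglow (v (σ n) - V)
      rw [gform, form_sub_left, form_sub_right, form_sub_right, form_comm _ _ (v (σ n)) V] at h3
      rw [gform]
      linarith
    have h4 := le_of_tendsto_of_tendsto' h1 hε h2
    rw [form_eq_gform_sub]
    linarith
  have hVz : V = 0 := by
    by_contra hne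
    have := hpos V (hV0.mem_H10 hN hΩ) hne
    rw [← form_self ha hb] at this
    linarith
  have hfz : H1fun V = 0 := by rw [hVz]; rfl
  have hg : Tendsto (fun n => m * ‖H1grad (v (σ n))‖ ^ 2) atTop (𝓝 0) := by
    rw [hfz] at hB
    have h1 := hε.add hB
    rw [inner_zero_right, add_zero] at h1
    refine squeeze_zero (fun n => by positivity) (fun n => ?_) h1
    refine (mul_norm_grad_sq_le_gform hΩ.isOpen ha hm _).trans ?_
    have h2 := hvQ (σ n)
    rw [form_eq_gform_sub] at h2
    linarith
  have hg' : Tendsto (fun n => ‖H1grad (v (σ n))‖ ^ 2) atTop (𝓝 0) := by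
    have := hg.const_mul m⁻¹
    rw [mul_zero] at this
    refine this.congr fun n => ?_
    rw [← mul_assoc, inv_mul_cancel₀ hm0.ne', one_mul]
  have hf' : Tendsto (fun n => ‖H1fun (v (σ n))‖ ^ 2) atTop (𝓝 0) := by
    rw [hfz] at hstrong'
    have := hstrong'.norm.pow 2
    simpa using this
  have hone := hf'.add hg'
  simp only [← H1_norm_sq, hv1, one_pow, add_zero] at hone
  exact one_ne_zero (tendsto_nhds_unique tendsto_const_nhds hone)

end Forms

section Potential

variable {N : ℕ} {Ω : Set (E N)}

theorem IsReaction.continuousOn_oddExt {d : E N → ℝ} {f : E N → ℝ → ℝ} (h : IsReaction Ω d f)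
    {x : E N} (hx : x ∈ Ω) : ContinuousOn (oddExt f x) (Set.Ici 0) := by
  obtain ⟨L, hL⟩ := h.lipschitz
  have h1 : LipschitzOnWith (Real.toNNReal L) (f x) (Set.Ici 0) :=
    LipschitzOnWith.of_dist_le_mul fun s hs t ht => by
      rw [Real.dist_eq, Real.dist_eq]
      exact (hL x hx s t hs ht).trans (by gcongr; exact Real.le_coe_toNNReal L)
  exact h1.continuousOn.congr fun s hs => if_pos hs

theorem IsReaction.intervalIntegrable {d : E N → ℝ} {f : E N → ℝ → ℝ} (h : IsReaction Ω d f)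
    {x : E N} (hx : x ∈ Ω) {s t : ℝ} (hs : 0 ≤ s) (ht : 0 ≤ t) :
    IntervalIntegrable (oddExt f x) volume s t :=
  ((h.continuousOn_oddExt hx).mono fun _ hr => (le_min hs ht).trans hr.1).intervalIntegrable

theorem IsReaction.potential_sub {d : E N → ℝ} {f : E N → ℝ → ℝ} (h : IsReaction Ω d f)
    {x : E N} (hx : x ∈ Ω) {s t : ℝ} (hs : 0 ≤ s) (ht : 0 ≤ t) :
    potential f x s - potential f x t = ∫ r in t..s, oddExt f x r :=
  intervalIntegral.integral_interval_sub_left (h.intervalIntegrable hx le_rfl hs)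
    (h.intervalIntegrable hx le_rfl ht)

/-- Quadratic growth of the increments of the potential. -/
theorem IsReaction.exists_abs_potential_sub_le {d : E N → ℝ} {f : E N → ℝ → ℝ}
    (h : IsReaction Ω d f) : ∃ L : ℝ, 0 ≤ L ∧ ∀ x ∈ Ω, ∀ s t : ℝ, 0 ≤ s → 0 ≤ t →
      |potential f x s - potential f x t| ≤ L * ((s + t) * |s - t|) := by
  obtain ⟨L, hL⟩ := h.lipschitz
  refine ⟨|L|, abs_nonneg _, fun x hx s t hs ht => ?_⟩
  rw [h.potential_sub hx hs ht]
  have h1 := intervalIntegral.norm_integral_le_of_norm_le_const (a := t) (b := s)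
    (f := oddExt f x) (C := |L| * (s + t)) fun r hr => ?_
  · rw [← mul_assoc]; exact h1
  · have hr0 : 0 ≤ r := (le_min ht hs).trans hr.1.le
    have hr1 : r ≤ s + t := hr.2.trans (max_le (by linarith) (by linarith))
    rw [oddExt, if_pos hr0]
    have h2 := hL x hx r 0 hr0 le_rfl
    rw [h.zero x hx, sub_zero, sub_zero, abs_of_nonneg hr0] at h2
    refine h2.trans ?_
    exact mul_le_mul (le_abs_self L) hr1 hr0 (abs_nonneg _)

theorem potential_zero (f : E N → ℝ → ℝ) (x : E N) : potential f x 0 = 0 := by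
  rw [potential, intervalIntegral.integral_same]

/-- Upper bound of the potential from the growth assumption. -/
theorem IsReaction.exists_potential_le {d : E N → ℝ} {f : E N → ℝ → ℝ} (h : IsReaction Ω d f)
    (hΩ : IsOpen Ω) {b : E N → ℝ} {s₀ : ℝ} (hs₀ : 1 < s₀)
    (hb : ∀ᵐ x ∂(volume.restrict Ω), ∀ s : ℝ, s₀ ≤ s → |f x s| ≤ b x * s) :
    ∃ C : ℝ, ∀ᵐ x ∂(volume.restrict Ω), ∀ s : ℝ, 0 ≤ s →
      potential f x s ≤ C + 1 / 2 * (b x * s ^ 2) := by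
  obtain ⟨L, hL0, hL⟩ := h.exists_abs_potential_sub_le
  refine ⟨L * (s₀ * s₀), ?_⟩
  filter_upwards [hb, ae_restrict_mem hΩ.measurableSet] with x hx hxΩ s hs
  have hs₀' : 0 ≤ s₀ := by linarith
  have hsmall : ∀ s, 0 ≤ s → s ≤ s₀ → potential f x s ≤ L * (s₀ * s₀) := by
    intro s hs hss
    have h1 := hL x hxΩ s 0 hs le_rfl
    rw [potential_zero, sub_zero, sub_zero, add_zero, abs_of_nonneg hs] at h1
    refine (le_abs_self _).trans (h1.trans ?_)
    gcongr
  have hb0 : 0 ≤ b x := by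
    have h1 := (abs_nonneg _).trans (hx s₀ le_rfl)
    exact nonneg_of_mul_nonneg_left h1 (by linarith)
  rcases le_total s s₀ with hss | hss
  · have := hsmall s hs hss
    have h2 : 0 ≤ 1 / 2 * (b x * s ^ 2) := by positivity
    linarith
  · have h1 := hsmall s₀ hs₀' le_rfl
    have h2 := h.potential_sub hxΩ hs hs₀'
    have h3 : ∫ r in s₀..s, oddExt f x r ≤ ∫ r in s₀..s, b x * r := by
      refine intervalIntegral.integral_mono_on hss (h.intervalIntegrable hxΩ hs₀' hs)
        ((continuous_const.mul continuous_id).intervalIntegrable _ _) fun r hr => ?_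
      rw [oddExt, if_pos (hs₀'.trans hr.1)]
      exact (le_abs_self _).trans (hx r hr.1)
    rw [intervalIntegral.integral_const_mul, integral_id] at h3
    have h4 : 0 ≤ b x * s₀ ^ 2 := by positivity
    nlinarith

/-- The potential part of the energy. -/
def potEnergy (Ω : Set (E N)) (f : E N → ℝ → ℝ) (u : H1 Ω) : ℝ :=
  ∫ x in Ω, potential f x (H1fun u x)

theorem aestronglyMeasurable_potential (hΩ : IsOpen Ω) {f : E N → ℝ → ℝ}
    (hf : ContinuousOn (fun p : E N × ℝ => potential f p.1 p.2) (Ω ×ˢ Set.univ)) (u : H1 Ω) :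
    AEStronglyMeasurable (fun x => potential f x (H1fun u x)) (volume.restrict Ω) := by
  classical
  have h1 : Measurable ((Ω ×ˢ (Set.univ : Set ℝ)).piecewise
      (fun p : E N × ℝ => potential f p.1 p.2) (fun _ => 0)) :=
    hf.measurable_piecewise continuousOn_const (hΩ.measurableSet.prod MeasurableSet.univ)
  have h2 : Measurable fun x => (x, H1fun u x) :=
    measurable_id.prodMk (Lp.stronglyMeasurable (H1fun u)).measurable
  refine (h1.comp h2).aestronglyMeasurable.congr ?_
  filter_upwards [ae_restrict_mem hΩ.measurableSet] with x hx
  exact Set.piecewise_eq_of_mem _ _ _ ⟨hx, trivial⟩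

theorem integrable_potential (hΩ : IsOpen Ω) {d : E N → ℝ} {f : E N → ℝ → ℝ}
    (h : IsReaction Ω d f)
    (hf : ContinuousOn (fun p : E N × ℝ => potential f p.1 p.2) (Ω ×ˢ Set.univ)) {u : H1 Ω}
    (hu : ∀ᵐ x ∂(volume.restrict Ω), 0 ≤ H1fun u x) :
    Integrable (fun x => potential f x (H1fun u x)) (volume.restrict Ω) := by
  obtain ⟨L, hL0, hL⟩ := h.exists_abs_potential_sub_le
  refine Integrable.mono' ((Lp.memLp (H1fun u)).integrable_sq.const_mul L)
    (aestronglyMeasurable_potential hΩ hf u) ?_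
  filter_upwards [hu, ae_restrict_mem hΩ.measurableSet] with x h0 hx
  have h1 := hL x hx _ 0 h0 le_rfl
  rwa [potential_zero, sub_zero, sub_zero, add_zero, abs_of_nonneg h0, ← sq] at h1

theorem abs_potEnergy_sub_le (hΩ : IsOpen Ω) {d : E N → ℝ} {f : E N → ℝ → ℝ}
    (h : IsReaction Ω d f)
    (hf : ContinuousOn (fun p : E N × ℝ => potential f p.1 p.2) (Ω ×ˢ Set.univ)) :
    ∃ L : ℝ, ∀ u v : H1 Ω, (∀ᵐ x ∂(volume.restrict Ω), 0 ≤ H1fun u x) →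
      (∀ᵐ x ∂(volume.restrict Ω), 0 ≤ H1fun v x) →
      |potEnergy Ω f u - potEnergy Ω f v|
        ≤ L * (‖H1fun u + H1fun v‖ * ‖H1fun u - H1fun v‖) := by
  obtain ⟨L, hL0, hL⟩ := h.exists_abs_potential_sub_le
  refine ⟨L, fun u v hu hv => ?_⟩
  rw [potEnergy, potEnergy, ← integral_sub (integrable_potential hΩ h hf hu)
    (integrable_potential hΩ h hf hv)]
  have h1 : ‖∫ x in Ω, (potential f x (H1fun u x) - potential f x (H1fun v x))‖
      ≤ ∫ x in Ω, L * inner ℝ ((H1fun u + H1fun v) x) (|H1fun u - H1fun v| x) := by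
    refine norm_integral_le_of_norm_le ((L2.integrable_inner (𝕜 := ℝ) _ _).const_mul L) ?_
    filter_upwards [hu, hv, ae_restrict_mem hΩ.measurableSet, Lp.coeFn_add (H1fun u) (H1fun v),
      Lp.coeFn_sub (H1fun u) (H1fun v), Lp.coeFn_abs (H1fun u - H1fun v)] with x a1 a2 a3 a4 a5 a6
    rw [a6, a5, a4]
    have := hL x a3 _ _ a1 a2
    simpa [mul_comm] using this
  rw [integral_const_mul, ← L2.inner_def] at h1
  refine h1.trans ?_
  gcongr
  refine (real_inner_le_norm _ _).trans ?_
  rw [norm_abs_eq_norm]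

theorem tendsto_potEnergy (hΩ : IsOpen Ω) {d : E N → ℝ} {f : E N → ℝ → ℝ}
    (h : IsReaction Ω d f)
    (hf : ContinuousOn (fun p : E N × ℝ => potential f p.1 p.2) (Ω ×ˢ Set.univ))
    {u : ℕ → H1 Ω} {v : H1 Ω} (hu : ∀ n, ∀ᵐ x ∂(volume.restrict Ω), 0 ≤ H1fun (u n) x)
    (hv : ∀ᵐ x ∂(volume.restrict Ω), 0 ≤ H1fun v x)
    (hlim : Tendsto (fun n => H1fun (u n)) atTop (𝓝 (H1fun v))) :
    Tendsto (fun n => potEnergy Ω f (u n)) atTop (𝓝 (potEnergy Ω f v)) := by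
  obtain ⟨L, hL⟩ := abs_potEnergy_sub_le hΩ h hf
  rw [tendsto_iff_norm_sub_tendsto_zero]
  have h1 := (((hlim.add_const (H1fun v)).norm).mul
    (tendsto_iff_norm_sub_tendsto_zero.1 hlim)).const_mul L
  rw [mul_zero, mul_zero] at h1
  exact squeeze_zero (fun n => norm_nonneg _) (fun n => hL _ _ (hu n) hv) h1

theorem abs_potEnergy_sub_le_of_abs_sub_le (hΩ : IsRegularDomain Ω) {d d' : E N → ℝ}
    {f g : E N → ℝ → ℝ} (h : IsReaction Ω d f) (h' : IsReaction Ω d' g)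
    (hf : ContinuousOn (fun p : E N × ℝ => potential f p.1 p.2) (Ω ×ˢ Set.univ))
    (hg : ContinuousOn (fun p : E N × ℝ => potential g p.1 p.2) (Ω ×ˢ Set.univ)) {ε : ℝ}
    (hε : ∀ x ∈ Ω, ∀ s, |potential f x s - potential g x s| ≤ ε) {u : H1 Ω}
    (hu : ∀ᵐ x ∂(volume.restrict Ω), 0 ≤ H1fun u x) :
    |potEnergy Ω f u - potEnergy Ω g u| ≤ ε * volume.real Ω := by
  rw [potEnergy, potEnergy, ← integral_sub (integrable_potential hΩ.isOpen h hf hu)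
    (integrable_potential hΩ.isOpen h' hg hu)]
  have e : ∀ x ∈ Ω, ‖potential f x (H1fun u x) - potential g x (H1fun u x)‖ ≤ ε :=
    fun x hx => hε x hx _
  exact norm_setIntegral_le_of_norm_le_const hΩ.isBounded.measure_lt_top e

end Potential

section Boundary

variable {N k : ℕ} {Ω : Set (E N)}

theorem ae_nonneg_of_tendsto {α : Type*} [MeasurableSpace α] {μ : Measure α}
    {f : ℕ → Lp ℝ 2 μ} {g : Lp ℝ 2 μ} (hf : ∀ n, ∀ᵐ x ∂μ, 0 ≤ f n x)
    (h : Tendsto f atTop (𝓝 g)) : ∀ᵐ x ∂μ, 0 ≤ g x := by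
  obtain ⟨σ, -, hσ⟩ := exists_subseq_tendsto_ae h
  filter_upwards [hσ, ae_all_iff.2 hf] with x h1 h2
  exact ge_of_tendsto' h1 fun n => h2 _

theorem ae_mul_eq_zero_of_tendsto {α : Type*} [MeasurableSpace α] {μ : Measure α}
    {f f' : ℕ → Lp ℝ 2 μ} {g g' : Lp ℝ 2 μ} (hf : ∀ n, ∀ᵐ x ∂μ, f n x * f' n x = 0)
    (h : Tendsto f atTop (𝓝 g)) (h' : Tendsto f' atTop (𝓝 g')) : ∀ᵐ x ∂μ, g x * g' x = 0 := by
  obtain ⟨σ, hσ, h1⟩ := exists_subseq_tendsto_ae h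
  obtain ⟨τ, hτ, h2⟩ := exists_subseq_tendsto_ae (h'.comp hσ.tendsto_atTop)
  filter_upwards [h1, h2, ae_all_iff.2 hf] with x a1 a2 a3
  have a4 := (a1.comp hτ.tendsto_atTop).mul a2
  refine tendsto_nhds_unique a4 ?_
  simp only [Function.comp_apply, a3]
  exact tendsto_const_nhds

theorem TendstoHHalf.exists_lift {φn : ℕ → L2Boundary Ω} {φ : L2Boundary Ω}
    (h : TendstoHHalf Ω φn φ) (hn : ∀ n, φn n ∈ HHalf Ω) (hφ : φ ∈ HHalf Ω) :
    ∃ g : ℕ → H1 Ω, (∀ n, HasTrace Ω (g n) (φn n - φ)) ∧ Tendsto g atTop (𝓝 0) := by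
  have hex : ∀ n, ∃ g, HasTrace Ω g (φn n - φ) ∧
      ‖g‖ₑ ≤ traceNorm Ω (φn n - φ) + ((n : ℝ≥0∞) + 1)⁻¹ := by
    intro n
    obtain ⟨u, hu⟩ := hn n
    obtain ⟨v, hv⟩ := hφ
    have hfin : traceNorm Ω (φn n - φ) ≠ ⊤ :=
      ((iInf₂_le (u - v) (hu.sub hv)).trans_lt enorm_lt_top).ne
    have hlt : traceNorm Ω (φn n - φ) < traceNorm Ω (φn n - φ) + ((n : ℝ≥0∞) + 1)⁻¹ :=
      ENNReal.lt_add_right hfin (by simp)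
    rw [traceNorm] at hlt
    obtain ⟨g, hg⟩ := iInf_lt_iff.1 hlt
    obtain ⟨hg1, hg2⟩ := iInf_lt_iff.1 hg
    exact ⟨g, hg1, hg2.le⟩
  choose g hg1 hg2 using hex
  refine ⟨g, hg1, ?_⟩
  have h1 : Tendsto (fun n : ℕ => ((n : ℝ≥0∞) + 1)⁻¹) atTop (𝓝 0) := by
    have := (tendsto_add_atTop_iff_nat 1).2 ENNReal.tendsto_inv_nat_nhds_zero
    simpa using this
  have h2 := Tendsto.add h h1
  rw [add_zero] at h2
  rw [tendsto_iff_edist_tendsto_0]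
  refine tendsto_of_tendsto_of_tendsto_of_le_of_le tendsto_const_nhds h2 (fun _ => zero_le) ?_
  intro n
  simp only [edist_zero_right]
  exact hg2 n

theorem tendsto_of_lift (hN : 2 ≤ N) (hΩ : IsRegularDomain Ω) {φn : ℕ → L2Boundary Ω}
    {φ : L2Boundary Ω} {g : ℕ → H1 Ω} (hg : ∀ n, HasTrace Ω (g n) (φn n - φ))
    (hlim : Tendsto g atTop (𝓝 0)) : Tendsto φn atTop (𝓝 φ) := by
  obtain ⟨C, hC⟩ := exists_norm_trace_le hN hΩ
  rw [tendsto_iff_norm_sub_tendsto_zero]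
  have h1 := hlim.norm.const_mul C
  rw [norm_zero, mul_zero] at h1
  exact squeeze_zero (fun n => norm_nonneg _) (fun n => hC _ _ (hg n)) h1

theorem IsAdmissible.of_tendsto {φn : ℕ → Fin k → L2Boundary Ω} {φ : Fin k → L2Boundary Ω}
    (hφn : ∀ n, IsAdmissible Ω (φn n)) (hφ : ∀ i, φ i ∈ HHalf Ω)
    (h : ∀ i, Tendsto (fun n => φn n i) atTop (𝓝 (φ i))) : IsAdmissible Ω φ where
  mem_HHalf := hφ
  nonneg i := ae_nonneg_of_tendsto (fun n => (hφn n).nonneg i) (h i)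
  disjoint i j hij := ae_mul_eq_zero_of_tendsto (fun n => (hφn n).disjoint i j hij) (h i) (h j)

end Boundary

section Energy

variable {N k : ℕ} {Ω : Set (E N)}

theorem tendsto_form_self {a b : E N → ℝ} (ha : MemLp a ∞ (volume.restrict Ω))
    (hb : MemLp b ∞ (volume.restrict Ω)) {u : ℕ → H1 Ω} {v : H1 Ω}
    (h : Tendsto u atTop (𝓝 v)) :
    Tendsto (fun n => form ha hb (u n) (u n)) atTop (𝓝 (form ha hb v v)) := by
  have h1 := (continuous_form ha hb).tendsto (v, v)
  have h2 := h.prodMk_nhds h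
  have h3 := Tendsto.comp h1 h2
  exact h3

theorem form_add_self {a b : E N → ℝ} (ha : MemLp a ∞ (volume.restrict Ω))
    (hb : MemLp b ∞ (volume.restrict Ω)) (w z : H1 Ω) : form ha hb (w + z) (w + z)
      = form ha hb w w + 2 * form ha hb w z + form ha hb z z := by
  have h1 := form_add_left ha hb w z (w + z)
  have h2 := form_add_right ha hb w w z
  have h3 := form_add_right ha hb z w z
  have h4 := form_comm ha hb z w
  linarith

theorem energy_eq (hΩ : IsRegularDomain Ω) {d : Fin k → E N → ℝ}
    (hd : ∀ i, ContinuousOn (d i) (closure Ω)) {f : Fin k → E N → ℝ → ℝ}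
    (hf : ∀ i, IsReaction Ω (d i) (f i))
    (hF : ∀ i, ContinuousOn (fun p : E N × ℝ => potential (f i) p.1 p.2) (Ω ×ˢ Set.univ))
    {U : Fin k → H1 Ω} (hU : ∀ i, ∀ᵐ x ∂(volume.restrict Ω), 0 ≤ H1fun (U i) x) :
    energy Ω d f U = ∑ i, (1 / 2 * gform (memLp_top_of_sq hΩ (hd i)) (U i) (U i)
      - potEnergy Ω (f i) (U i)) := by
  refine Finset.sum_congr rfl fun i _ => ?_
  have h1 := integrable_mul_inner (memLp_top_of_sq hΩ (hd i)) (H1grad (U i)) (H1grad (U i))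
  rw [gform, form_self, potEnergy, ← integral_const_mul, ← integral_sub]
  · refine integral_congr_ae (Eventually.of_forall fun x => ?_)
    simp only
    ring
  · simpa only [real_inner_self_eq_norm_sq, zero_mul, sub_zero] using h1.const_mul (1 / 2)
  · exact integrable_potential hΩ.isOpen (hf i) (hF i) (hU i)

theorem tendsto_potEnergy_sub (hΩ : IsRegularDomain Ω) {d : E N → ℝ} {fn : ℕ → E N → ℝ → ℝ}
    {f : E N → ℝ → ℝ} (hfn : ∀ n, IsReaction Ω d (fn n)) (hf : IsReaction Ω d f)
    (hF : TendstoC1 (Ω ×ˢ (Set.univ : Set ℝ)) (fun n p => potential (fn n) p.1 p.2)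
      (fun p => potential f p.1 p.2))
    {u : ℕ → H1 Ω} (hu : ∀ n, ∀ᵐ x ∂(volume.restrict Ω), 0 ≤ H1fun (u n) x) :
    Tendsto (fun n => potEnergy Ω (fn n) (u n) - potEnergy Ω f (u n)) atTop (𝓝 0) := by
  rw [Metric.tendsto_atTop']
  intro ε hε
  have hV : 0 ≤ volume.real Ω := measureReal_nonneg
  set δ := ε / (volume.real Ω + 1) with hδ
  have hδ0 : 0 < δ := by positivity
  obtain ⟨n₀, hn₀⟩ := eventually_atTop.1 (Metric.tendstoUniformlyOn_iff.1 hF.tendsto δ hδ0)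
  refine ⟨n₀, fun n hn => ?_⟩
  rw [Real.dist_eq, sub_zero]
  refine (abs_potEnergy_sub_le_of_abs_sub_le hΩ (hfn n) hf (hF.contDiffOn_seq n).continuousOn
    hF.contDiffOn.continuousOn (ε := δ) (fun x hx s => ?_) (hu n)).trans_lt ?_
  · have := hn₀ n hn.le (x, s) ⟨hx, trivial⟩
    rw [dist_comm, Real.dist_eq] at this
    exact this.le
  · have : δ * (volume.real Ω + 1) = ε := by rw [hδ]; field_simp
    linarith

set_option maxHeartbeats 800000 in
/-- Coercivity of one summand of the energy on an affine trace class. -/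
theorem exists_coercive_potEnergy (hN : 2 ≤ N) (hΩ : IsRegularDomain Ω) {d : E N → ℝ}
    (hd : ContinuousOn d (closure Ω)) (hd_pos : ∀ x ∈ closure Ω, 0 < d x) {f : E N → ℝ → ℝ}
    (hf : IsReaction Ω d f)
    (hF : ContinuousOn (fun p : E N × ℝ => potential f p.1 p.2) (Ω ×ˢ Set.univ)) :
    ∃ c > 0, ∃ C : ℝ, ∀ w z : H1 Ω, HasTrace Ω z 0 →
      (∀ᵐ x ∂(volume.restrict Ω), 0 ≤ H1fun (w + z) x) →
      c * ‖z‖ ^ 2 ≤ 1 / 2 * gform (memLp_top_of_sq hΩ hd) (w + z) (w + z)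
        - potEnergy Ω f (w + z) + C * (1 + ‖w‖ ^ 2) := by
  obtain ⟨b, hb, ⟨s₀, hs₀, hbs⟩, hpos⟩ := hf.growth
  obtain ⟨m, hm0, hm⟩ := exists_sq_lower_bound hΩ hd hd_pos
  have ha := memLp_top_of_sq hΩ hd
  obtain ⟨c, hc0, hc⟩ := exists_coercive hN hΩ ha hb hm0 hm hpos
  obtain ⟨C₀, hC₀⟩ := hf.exists_potential_le hΩ.isOpen hs₀ hbs
  obtain ⟨Λ, hΛ0, hΛ⟩ := exists_abs_form_le ha hb
  have hfin := isFiniteMeasure_restrict hΩ.isBounded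
  set v := volume.real Ω with hv
  have hv0 : 0 ≤ v := measureReal_nonneg
  refine ⟨c / 4, by positivity, |C₀| * v + (Λ ^ 2 / c + Λ), fun w z hz hu => ?_⟩
  have h1 : potEnergy Ω f (w + z) ≤ C₀ * v
      + 1 / 2 * inner ℝ (mulL ℝ hb (H1fun (w + z))) (H1fun (w + z)) := by
    have hi : Integrable (fun x => b x * H1fun (w + z) x ^ 2) (volume.restrict Ω) := by
      refine (integrable_mul_inner hb (H1fun (w + z)) (H1fun (w + z))).congr
        (Eventually.of_forall fun x => ?_)
      simp only [real_inner_self_eq_norm_sq, Real.norm_eq_abs, sq_abs]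
    have e : C₀ * v + 1 / 2 * inner ℝ (mulL ℝ hb (H1fun (w + z))) (H1fun (w + z))
        = ∫ x in Ω, (C₀ + 1 / 2 * (b x * H1fun (w + z) x ^ 2)) := by
      rw [integral_add (integrable_const _) (hi.const_mul _), integral_const_mul, inner_mulL,
        integral_const, smul_eq_mul, mul_comm C₀, measureReal_restrict_apply_univ]
      simp only [real_inner_self_eq_norm_sq, Real.norm_eq_abs, sq_abs, hv]
    rw [e]
    refine integral_mono_ae (integrable_potential hΩ.isOpen hf hF hu)
      ((integrable_const _).add (hi.const_mul _)) ?_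
    filter_upwards [hu, hC₀] with x a1 a2
    exact a2 _ a1
  have h2 := form_eq_gform_sub ha hb (w + z) (w + z)
  have h3 := form_add_self ha hb w z
  have h4 := hc z hz
  have h5 := (abs_le.1 (hΛ w w)).1
  have h6 := (abs_le.1 (hΛ w z)).1
  have h7 : 2 * (Λ * ‖w‖ * ‖z‖) ≤ c / 2 * ‖z‖ ^ 2 + 2 * (Λ ^ 2 / c) * ‖w‖ ^ 2 := by
    have e : c / 2 * ‖z‖ ^ 2 + 2 * (Λ ^ 2 / c) * ‖w‖ ^ 2 - 2 * (Λ * ‖w‖ * ‖z‖)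
        = (c * ‖z‖ - 2 * Λ * ‖w‖) ^ 2 / (2 * c) := by
      field_simp; ring
    have : 0 ≤ (c * ‖z‖ - 2 * Λ * ‖w‖) ^ 2 / (2 * c) := by positivity
    linarith
  have h8 : C₀ * v ≤ |C₀| * v := by gcongr; exact le_abs_self _
  have h9 : 0 ≤ |C₀| * v * ‖w‖ ^ 2 := by positivity
  have h10 : 0 ≤ Λ ^ 2 / c + Λ := by positivity
  have h11 : 0 ≤ Λ * ‖w‖ ^ 2 := by positivity
  have h12 : Λ * ‖w‖ * ‖w‖ = Λ * ‖w‖ ^ 2 := by ring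
  have h13 : (|C₀| * v + (Λ ^ 2 / c + Λ)) * (1 + ‖w‖ ^ 2) = |C₀| * v + |C₀| * v * ‖w‖ ^ 2
    + (Λ ^ 2 / c + Λ) + Λ ^ 2 / c * ‖w‖ ^ 2 + Λ * ‖w‖ ^ 2 := by ring
  rw [h13]
  rw [h3] at h2
  generalize gform ha (w + z) (w + z) = q0 at *
  generalize form ha hb w w = q1 at *
  generalize form ha hb w z = q2 at *
  generalize form ha hb z z = q3 at *
  generalize inner ℝ (mulL ℝ hb (H1fun (w + z))) (H1fun (w + z)) = q4 at *
  generalize potEnergy Ω f (w + z) = q5 at *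
  linarith

theorem tendsto_energy (hΩ : IsRegularDomain Ω) {d : Fin k → E N → ℝ}
    (hd : ∀ i, ContinuousOn (d i) (closure Ω)) {fn : ℕ → Fin k → E N → ℝ → ℝ}
    {f : Fin k → E N → ℝ → ℝ} (hfn : ∀ n i, IsReaction Ω (d i) (fn n i))
    (hf : ∀ i, IsReaction Ω (d i) (f i))
    (hF : ∀ i, TendstoC1 (Ω ×ˢ (Set.univ : Set ℝ)) (fun n p => potential (fn n i) p.1 p.2)
      (fun p => potential (f i) p.1 p.2))
    {u : ℕ → Fin k → H1 Ω} {v : Fin k → H1 Ω}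
    (hu : ∀ n i, ∀ᵐ x ∂(volume.restrict Ω), 0 ≤ H1fun (u n i) x)
    (hv : ∀ i, ∀ᵐ x ∂(volume.restrict Ω), 0 ≤ H1fun (v i) x)
    (hlim : ∀ i, Tendsto (fun n => u n i) atTop (𝓝 (v i))) :
    Tendsto (fun n => energy Ω d (fn n) (u n)) atTop (𝓝 (energy Ω d f v)) := by
  rw [energy_eq hΩ hd hf (fun i => (hF i).contDiffOn.continuousOn) hv]
  simp only [fun n => energy_eq hΩ hd (hfn n)
    (fun i => ((hF i).contDiffOn_seq n).continuousOn) (hu n)]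
  refine tendsto_finsetSum _ fun i _ => Tendsto.sub (Tendsto.const_mul _ ?_) ?_
  · exact tendsto_form_self _ _ (hlim i)
  · have h1 := tendsto_potEnergy hΩ.isOpen (hf i) (hF i).contDiffOn.continuousOn
      (fun n => hu n i) (hv i) ((continuous_H1fun.tendsto _).comp (hlim i))
    have h2 := (tendsto_potEnergy_sub hΩ (fun n => hfn n i) (hf i) (hF i)
      (fun n => hu n i)).add h1
    rw [zero_add] at h2
    exact h2.congr fun n => sub_add_cancel _ _

end Energy

section Compactness

variable {N k : ℕ} {Ω : Set (E N)}

/-- Bounded sequences of tuples in `H¹` have a common weakly convergent subsequence. -/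
theorem exists_weak_limit_pi {z : ℕ → Fin k → H1 Ω} {M : Fin k → ℝ}
    (hM : ∀ n i, ‖z n i‖ ≤ M i) : ∃ (Z : Fin k → H1 Ω) (σ : ℕ → ℕ), StrictMono σ ∧
      ∀ i w, Tendsto (fun n => inner ℝ (z (σ n) i) w) atTop (𝓝 (inner ℝ (Z i) w)) := by
  classical
  obtain ⟨Z, σ, hσ, hw⟩ := exists_weak_limit
    (fun n => (WithLp.toLp 2 (z n) : PiLp 2 (fun _ : Fin k => H1 Ω)))
    (Real.sqrt (∑ i, M i ^ 2)) fun n => by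
      refine Real.le_sqrt_of_sq_le ?_
      rw [PiLp.norm_sq_eq_of_L2]
      exact Finset.sum_le_sum fun i _ => pow_le_pow_left₀ (norm_nonneg _) (hM n i) 2
  refine ⟨fun i => Z i, σ, hσ, fun i w => ?_⟩
  have e : ∀ y : PiLp 2 (fun _ : Fin k => H1 Ω),
      inner ℝ y (WithLp.toLp 2 (Pi.single i w) : PiLp 2 (fun _ : Fin k => H1 Ω))
        = inner ℝ (y i) w := by
    intro y
    rw [PiLp.inner_apply, Finset.sum_eq_single i]
    · simp
    · intro j _ hj
      simp [Pi.single_eq_of_ne hj]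
    · simp
  have h1 := hw (WithLp.toLp 2 (Pi.single i w))
  simp only [e] at h1
  exact h1

/-- Recovery sequences: a segregated state with the limiting boundary values is the strong limit
of segregated states with the approximating boundary values. -/
theorem exists_recovery (hN : 2 ≤ N) (hΩ : IsRegularDomain Ω) {φn : ℕ → Fin k → L2Boundary Ω}
    {φ : Fin k → L2Boundary Ω} (hφn : ∀ n, IsAdmissible Ω (φn n)) {g : ℕ → Fin k → H1 Ω}
    (hg : ∀ n i, HasTrace Ω (g n i) (φn n i - φ i))
    (hg0 : ∀ i, Tendsto (fun n => g n i) atTop (𝓝 0)) {V : Fin k → H1 Ω}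
    (hV : V ∈ segregatedStates Ω φ) :
    ∃ Vn : ℕ → Fin k → H1 Ω, (∀ n, Vn n ∈ segregatedStates Ω (φn n)) ∧
      ∀ i, Tendsto (fun n => Vn n i) atTop (𝓝 (V i)) := by
  have htr : ∀ n i, HasTrace Ω (V i + g n i) (φn n i) := fun n i => by
    have := (hV.1 i).add (hg n i)
    rwa [add_sub_cancel] at this
  refine ⟨fun n => segH fun i => V i + g n i, fun n => segH_mem hN hΩ (hφn n) (htr n), ?_⟩
  have := tendsto_segH hN hΩ htr hV.1 fun i => by
    simpa using (hg0 i).const_add (V i)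
  rwa [segH_eq_self hN hΩ hV] at this

theorem tendsto_H1_of_tendsto_gform (hΩ : IsRegularDomain Ω) {d : E N → ℝ}
    (hd : ContinuousOn d (closure Ω)) (hd_pos : ∀ x ∈ closure Ω, 0 < d x) {u : ℕ → H1 Ω}
    {v : H1 Ω} (hfun : Tendsto (fun n => H1fun (u n)) atTop (𝓝 (H1fun v)))
    (hform : Tendsto (fun n => gform (memLp_top_of_sq hΩ hd) (u n - v) (u n - v)) atTop (𝓝 0)) :
    Tendsto u atTop (𝓝 v) := by
  obtain ⟨m, hm0, hm⟩ := exists_sq_lower_bound hΩ hd hd_pos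
  refine H1_tendsto_iff.2 ⟨hfun, ?_⟩
  rw [tendsto_iff_norm_sub_tendsto_zero]
  have h1 : Tendsto (fun n => ‖H1grad (u n) - H1grad v‖ ^ 2) atTop (𝓝 0) := by
    have h2 := hform.const_mul m⁻¹
    rw [mul_zero] at h2
    refine squeeze_zero (fun n => sq_nonneg _) (fun n => ?_) h2
    rw [← H1grad_sub, ← div_eq_inv_mul, le_div_iff₀' hm0]
    exact mul_norm_grad_sq_le_gform hΩ.isOpen _ hm _
  have h3 := h1.sqrt
  simpa using h3

theorem exists_norm_sub_le (hN : 2 ≤ N) (hΩ : IsRegularDomain Ω) {d : Fin k → E N → ℝ}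
    (hd : ∀ i, ContinuousOn (d i) (closure Ω)) (hd_pos : ∀ i, ∀ x ∈ closure Ω, 0 < d i x)
    {fn : ℕ → Fin k → E N → ℝ → ℝ} {f : Fin k → E N → ℝ → ℝ}
    (hfn : ∀ n i, IsReaction Ω (d i) (fn n i)) (hf : ∀ i, IsReaction Ω (d i) (f i))
    (hF : ∀ i, TendstoC1 (Ω ×ˢ (Set.univ : Set ℝ)) (fun n p => potential (fn n i) p.1 p.2)
      (fun p => potential (f i) p.1 p.2))
    {w z : ℕ → Fin k → H1 Ω} {h : Fin k → H1 Ω}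
    (hw : ∀ i, Tendsto (fun n => w n i) atTop (𝓝 (h i))) (hz : ∀ n i, HasTrace Ω (z n i) 0)
    (hnn : ∀ n i, ∀ᵐ x ∂(volume.restrict Ω), 0 ≤ H1fun (w n i + z n i) x) {e : ℕ → ℝ} {e₀ : ℝ}
    (he : Tendsto e atTop (𝓝 e₀))
    (hle : ∀ n, energy Ω d (fn n) (fun i => w n i + z n i) ≤ e n) :
    ∃ M : Fin k → ℝ, ∀ n i, ‖z n i‖ ≤ M i := by
  choose c hc0 C hC using fun i => exists_coercive_potEnergy hN hΩ (hd i) (hd_pos i) (hf i)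
    (hF i).contDiffOn.continuousOn
  have hlim : Tendsto (fun n => e n
      + ∑ i, ((potEnergy Ω (fn n i) (w n i + z n i) - potEnergy Ω (f i) (w n i + z n i))
        + C i * (1 + ‖w n i‖ ^ 2))) atTop
      (𝓝 (e₀ + ∑ i, (0 + C i * (1 + ‖h i‖ ^ 2)))) :=
    he.add (tendsto_finsetSum _ fun i _ => (tendsto_potEnergy_sub hΩ (fun n => hfn n i) (hf i)
      (hF i) fun n => hnn n i).add ((((hw i).norm.pow 2).const_add 1).const_mul _))
  obtain ⟨K, hK⟩ := hlim.bddAbove_range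
  have hsum : ∀ n, ∑ i, c i * ‖z n i‖ ^ 2 ≤ K := by
    intro n
    refine le_trans ?_ (hK ⟨n, rfl⟩)
    have h1 := hle n
    rw [energy_eq hΩ hd (hfn n) (fun i => ((hF i).contDiffOn_seq n).continuousOn) (hnn n)] at h1
    refine le_trans ?_ (add_le_add_left h1 _)
    rw [← Finset.sum_add_distrib]
    refine Finset.sum_le_sum fun i _ => ?_
    have := hC i (w n i) (z n i) (hz n i) (hnn n i)
    linarith
  refine ⟨fun i => Real.sqrt (K / c i), fun n i => Real.le_sqrt_of_sq_le ?_⟩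
  rw [le_div_iff₀' (hc0 i)]
  exact (Finset.single_le_sum (f := fun i => c i * ‖z n i‖ ^ 2)
    (fun j _ => mul_nonneg (hc0 j).le (sq_nonneg _)) (Finset.mem_univ i)).trans (hsum n)

end Compactness

section Minimality

variable {N k : ℕ} {Ω : Set (E N)}

/-- Lower semicontinuity of the energy along minimizers, with the gap controlling the Dirichlet
energy of the difference. -/
theorem exists_gap (hΩ : IsRegularDomain Ω) {d : Fin k → E N → ℝ}
    (hd : ∀ i, ContinuousOn (d i) (closure Ω))
    {fn : ℕ → Fin k → E N → ℝ → ℝ} {f : Fin k → E N → ℝ → ℝ}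
    (hfn : ∀ n i, IsReaction Ω (d i) (fn n i)) (hf : ∀ i, IsReaction Ω (d i) (f i))
    (hF : ∀ i, TendstoC1 (Ω ×ˢ (Set.univ : Set ℝ)) (fun n p => potential (fn n i) p.1 p.2)
      (fun p => potential (f i) p.1 p.2))
    {u : ℕ → Fin k → H1 Ω} {U : Fin k → H1 Ω}
    (hu : ∀ n i, ∀ᵐ x ∂(volume.restrict Ω), 0 ≤ H1fun (u n i) x)
    (hU : ∀ i, ∀ᵐ x ∂(volume.restrict Ω), 0 ≤ H1fun (U i) x)
    (hweak : ∀ i w, Tendsto (fun n => inner ℝ (u n i) w) atTop (𝓝 (inner ℝ (U i) w)))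
    (hfun : ∀ i, Tendsto (fun n => H1fun (u n i)) atTop (𝓝 (H1fun (U i))))
    {e : ℕ → ℝ} {e₀ : ℝ} (he : Tendsto e atTop (𝓝 e₀))
    (hle : ∀ n, energy Ω d (fn n) (u n) ≤ e n) :
    ∃ R : ℕ → ℝ, Tendsto R atTop (𝓝 (e₀ - energy Ω d f U)) ∧
      ∀ n, ∑ i, 1 / 2 * gform (memLp_top_of_sq hΩ (hd i)) (u n i - U i) (u n i - U i) ≤ R n := by
  have hp : ∀ i, Tendsto (fun n => potEnergy Ω (fn n i) (u n i)) atTop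
      (𝓝 (potEnergy Ω (f i) (U i))) := by
    intro i
    have h1 := tendsto_potEnergy hΩ.isOpen (hf i) (hF i).contDiffOn.continuousOn
      (fun n => hu n i) (hU i) (hfun i)
    have h2 := (tendsto_potEnergy_sub hΩ (fun n => hfn n i) (hf i) (hF i)
      (fun n => hu n i)).add h1
    rw [zero_add] at h2
    exact h2.congr fun n => sub_add_cancel _ _
  refine ⟨fun n => e n + ∑ i, (potEnergy Ω (fn n i) (u n i)
    - (gform (memLp_top_of_sq hΩ (hd i)) (U i) (u n i)
      - 1 / 2 * gform (memLp_top_of_sq hΩ (hd i)) (U i) (U i))), ?_, fun n => ?_⟩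
  · have h1 := he.add (tendsto_finsetSum Finset.univ fun i _ => (hp i).sub
      ((tendsto_form_of_weak (memLp_top_of_sq hΩ (hd i)) memLp_zero_top (hweak i)
        (U i)).sub_const (1 / 2 * gform (memLp_top_of_sq hΩ (hd i)) (U i) (U i))))
    convert h1 using 2
    rw [energy_eq hΩ hd hf (fun i => (hF i).contDiffOn.continuousOn) hU, sub_eq_add_neg,
      ← Finset.sum_neg_distrib]
    congr 1
    refine Finset.sum_congr rfl fun i _ => ?_
    rw [gform]
    ring
  · have h1 := hle n
    rw [energy_eq hΩ hd (hfn n) (fun i => ((hF i).contDiffOn_seq n).continuousOn) (hu n)] at h1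
    refine le_trans ?_ (add_le_add_left h1 _)
    rw [← Finset.sum_add_distrib]
    refine Finset.sum_le_sum fun i _ => ?_
    have h2 := form_add_self (memLp_top_of_sq hΩ (hd i)) memLp_zero_top (u n i - U i) (U i)
    have h3 := form_sub_left (memLp_top_of_sq hΩ (hd i)) memLp_zero_top (u n i) (U i) (U i)
    have h4 := form_comm (memLp_top_of_sq hΩ (hd i)) memLp_zero_top (U i) (u n i)
    rw [sub_add_cancel] at h2
    rw [gform]
    linarith

end Minimality

set_option maxHeartbeats 1600000 in
/-- Continuous dependence of minimizers on the boundary data and the potentials. -/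
theorem exists_subseq_tendsto_solution {N k : ℕ} (hN : 2 ≤ N)
    (Ω : Set (E N)) (hΩ : IsRegularDomain Ω)
    (d : Fin k → E N → ℝ)
    (hd : ∀ i, ContinuousOn (d i) (closure Ω)) (hd_pos : ∀ i, ∀ x ∈ closure Ω, 0 < d i x)
    (fn : ℕ → Fin k → E N → ℝ → ℝ) (f : Fin k → E N → ℝ → ℝ)
    (hfn : ∀ n i, IsReaction Ω (d i) (fn n i))
    (hf : ∀ i, IsReaction Ω (d i) (f i))
    (hF : ∀ i, TendstoC1 (Ω ×ˢ (Set.univ : Set ℝ))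
      (fun n p => potential (fn n i) p.1 p.2)
      (fun p => potential (f i) p.1 p.2))
    (φn : ℕ → Fin k → L2Boundary Ω) (φ : Fin k → L2Boundary Ω)
    (hφn : ∀ n, IsAdmissible Ω (φn n))
    (hφ : ∀ i, φ i ∈ HHalf Ω)
    (hφ_lim : ∀ i, TendstoHHalf Ω (fun n => φn n i) (φ i))
    (Un : ℕ → Fin k → H1 Ω)
    (hUn : ∀ n, IsSolution Ω d (fn n) (φn n) (Un n)) :
    IsAdmissible Ω φ ∧
    ∃ (U : Fin k → H1 Ω) (σ : ℕ → ℕ), StrictMono σ ∧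
      (∀ i, Tendsto (fun n => Un (σ n) i) atTop (𝓝 (U i))) ∧
      IsSolution Ω d f φ U := by
  have hreg : ∀ i, ContinuousOn (fun p : E N × ℝ => potential (f i) p.1 p.2) (Ω ×ˢ Set.univ) :=
    fun i => (hF i).contDiffOn.continuousOn
  choose g' hg' hg0 using fun i => (hφ_lim i).exists_lift (fun n => (hφn n).mem_HHalf i) (hφ i)
  set g : ℕ → Fin k → H1 Ω := fun n i => g' i n with hgdef
  have hg : ∀ n i, HasTrace Ω (g n i) (φn n i - φ i) := fun n i => hg' i n
  have hadm : IsAdmissible Ω φ :=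
    IsAdmissible.of_tendsto hφn hφ fun i => tendsto_of_lift hN hΩ (hg' i) (hg0 i)
  choose h hh using hφ
  have hUnn : ∀ n i, ∀ᵐ x ∂(volume.restrict Ω), 0 ≤ H1fun (Un n i) x := fun n => (hUn n).1.2.1
  obtain ⟨W, hW, hWlim⟩ := exists_recovery hN hΩ hφn hg hg0 (segH_mem hN hΩ hadm hh)
  set w : ℕ → Fin k → H1 Ω := fun n i => h i + g n i with hwdef
  set z : ℕ → Fin k → H1 Ω := fun n i => Un n i - w n i with hzdef
  have hwz : ∀ n i, w n i + z n i = Un n i := fun n i => add_sub_cancel _ _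
  have hwlim : ∀ i, Tendsto (fun n => w n i) atTop (𝓝 (h i)) := fun i => by
    simpa using (hg0 i).const_add (h i)
  have hwtr : ∀ n i, HasTrace Ω (w n i) (φn n i) := fun n i => by
    have := (hh i).add (hg n i)
    rwa [add_sub_cancel] at this
  have hztr : ∀ n i, HasTrace Ω (z n i) 0 := fun n i => by
    have := ((hUn n).1.1 i).sub (hwtr n i)
    rwa [sub_self] at this
  obtain ⟨M, hM⟩ := exists_norm_sub_le hN hΩ hd hd_pos hfn hf hF hwlim hztr
    (fun n i => by rw [hwz]; exact hUnn n i)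
    (tendsto_energy hΩ hd hfn hf hF (fun n => (hW n).2.1) (segH_mem hN hΩ hadm hh).2.1 hWlim)
    (fun n => by simp only [hwz]; exact (hUn n).2 _ (hW n))
  obtain ⟨Z, σ, hσ, hZ⟩ := exists_weak_limit_pi hM
  have hZtr : ∀ i, HasTrace Ω (Z i) 0 := fun i =>
    HasTrace.of_weak_zero (fun n => hztr (σ n) i) (hZ i)
  have hwσ : ∀ i, Tendsto (fun n => w (σ n) i) atTop (𝓝 (h i)) := fun i =>
    (hwlim i).comp hσ.tendsto_atTop
  set U : Fin k → H1 Ω := fun i => h i + Z i with hUdef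
  have hweak : ∀ i v, Tendsto (fun n => inner ℝ (Un (σ n) i) v) atTop (𝓝 (inner ℝ (U i) v)) := by
    intro i v
    have h1 := ((hwσ i).inner (tendsto_const_nhds (x := v))).add (hZ i v)
    rw [← inner_add_left] at h1
    refine h1.congr fun n => ?_
    rw [← inner_add_left, hwz]
  have hfun : ∀ i, Tendsto (fun n => H1fun (Un (σ n) i)) atTop (𝓝 (H1fun (U i))) := by
    intro i
    have h1 := tendsto_H1fun_of_weak hN hΩ (u := fun n => z (σ n) i - Z i)
      (fun n => (hztr (σ n) i).sub (hZtr i))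
      (fun n => (norm_sub_le _ _).trans (add_le_add_left (hM (σ n) i) _))
      (tendsto_sub_inner_zero (hZ i))
    have h2 := (((continuous_H1fun.tendsto _).comp (hwσ i)).add h1).add_const (H1fun (Z i))
    rw [add_zero, ← H1fun_add] at h2
    refine h2.congr fun n => ?_
    simp only [Function.comp_apply]
    rw [← H1fun_add, ← H1fun_add, add_assoc, sub_add_cancel, hwz]
  have hUtr : ∀ i, HasTrace Ω (U i) (φ i) := fun i => by
    have := (hh i).add (hZtr i)
    rwa [add_zero] at this
  have hUmem : U ∈ segregatedStates Ω φ :=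
    ⟨hUtr, fun i => ae_nonneg_of_tendsto (fun n => hUnn (σ n) i) (hfun i), fun i j hij =>
      ae_mul_eq_zero_of_tendsto (fun n => (hUn (σ n)).1.2.2 i j hij) (hfun i) (hfun j)⟩
  have hFσ : ∀ i, TendstoC1 (Ω ×ˢ (Set.univ : Set ℝ))
      (fun n p => potential (fn (σ n) i) p.1 p.2) (fun p => potential (f i) p.1 p.2) := fun i =>
    { contDiffOn_seq := fun n => (hF i).contDiffOn_seq (σ n)
      contDiffOn := (hF i).contDiffOn
      tendsto := fun s hs => hσ.tendsto_atTop.eventually ((hF i).tendsto s hs)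
      tendsto_fderiv := fun s hs => hσ.tendsto_atTop.eventually ((hF i).tendsto_fderiv s hs) }
  have hgap : ∀ V ∈ segregatedStates Ω φ, ∃ R : ℕ → ℝ,
      Tendsto R atTop (𝓝 (energy Ω d f V - energy Ω d f U)) ∧ ∀ n, ∑ i, 1 / 2 *
        gform (memLp_top_of_sq hΩ (hd i)) (Un (σ n) i - U i) (Un (σ n) i - U i) ≤ R n := by
    intro V hV
    obtain ⟨Vn, hVn, hVlim⟩ := exists_recovery hN hΩ hφn hg hg0 hV
    exact exists_gap hΩ hd (fun n => hfn (σ n)) hf hFσ (fun n => hUnn (σ n)) hUmem.2.1 hweak hfun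
      ((tendsto_energy hΩ hd hfn hf hF (fun n => (hVn n).2.1) hV.2.1 hVlim).comp
        hσ.tendsto_atTop) (fun n => (hUn (σ n)).2 _ (hVn (σ n)))
  have hpos : ∀ i v, 0 ≤ 1 / 2 * gform (memLp_top_of_sq hΩ (hd i)) v v := fun i v =>
    mul_nonneg (by norm_num) (le_trans (by simp)
      (mul_norm_grad_sq_le_gform hΩ.isOpen (memLp_top_of_sq hΩ (hd i)) (m := 0)
        (fun x _ => sq_nonneg (d i x)) v))
  refine ⟨hadm, U, σ, hσ, fun i => ?_, hUmem, fun V hV => ?_⟩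
  · obtain ⟨R, hR, hRle⟩ := hgap U hUmem
    rw [sub_self] at hR
    refine tendsto_H1_of_tendsto_gform hΩ (hd i) (hd_pos i) (hfun i) ?_
    have h1 := squeeze_zero (fun n => hpos i (Un (σ n) i - U i))
      (fun n => (Finset.single_le_sum (f := fun i => 1 / 2 *
        gform (memLp_top_of_sq hΩ (hd i)) (Un (σ n) i - U i) (Un (σ n) i - U i))
        (fun j _ => hpos j _) (Finset.mem_univ i)).trans (hRle n)) hR
    have h2 := h1.const_mul 2
    rw [mul_zero] at h2
    exact h2.congr fun n => by ring
  · obtain ⟨R, hR, hRle⟩ := hgap V hV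
    exact sub_nonneg.1 (ge_of_tendsto' hR fun n =>
      (Finset.sum_nonneg fun i _ => hpos i _).trans (hRle n))

end Segregation

end

theorem mainTheorem2 {N k : ℕ} (hN : 2 ≤ N) (hk : 2 ≤ k)
    (Ω : Set (Segregation.E N)) (hΩ : Segregation.IsRegularDomain Ω)
    (d : Fin k → Segregation.E N → ℝ)
    (hd : ∀ i, ContinuousOn (d i) (closure Ω)) (hd_pos : ∀ i, ∀ x ∈ closure Ω, 0 < d i x)
    (fn : ℕ → Fin k → Segregation.E N → ℝ → ℝ) (f : Fin k → Segregation.E N → ℝ → ℝ)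
    (hfn : ∀ n i, Segregation.IsReaction Ω (d i) (fn n i))
    (hf : ∀ i, Segregation.IsReaction Ω (d i) (f i))
    (hF : ∀ i, Segregation.TendstoC1 (Ω ×ˢ (Set.univ : Set ℝ))
      (fun n p => Segregation.potential (fn n i) p.1 p.2)
      (fun p => Segregation.potential (f i) p.1 p.2))
    (φn : ℕ → Fin k → Segregation.L2Boundary Ω) (φ : Fin k → Segregation.L2Boundary Ω)
    (hφn : ∀ n, Segregation.IsAdmissible Ω (φn n))
    (hφ : ∀ i, φ i ∈ Segregation.HHalf Ω)
    (hφ_lim : ∀ i, Segregation.TendstoHHalf Ω (fun n => φn n i) (φ i))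
    (Un : ℕ → Fin k → Segregation.H1 Ω)
    (hUn : ∀ n, Segregation.IsSolution Ω d (fn n) (φn n) (Un n)) :
    Segregation.IsAdmissible Ω φ ∧
    ∃ (U : Fin k → Segregation.H1 Ω) (σ : ℕ → ℕ), StrictMono σ ∧
      (∀ i, Tendsto (fun n => Un (σ n) i) atTop (𝓝 (U i))) ∧
      Segregation.IsSolution Ω d f φ U := by
  exact Segregation.exists_subseq_tendsto_solution hN Ω hΩ d hd hd_pos fn f hfn hf hF φn φ hφn hφ
    hφ_lim Un hUn
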